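/- Consider the M/G/1 queue: customers arrive according to a Poisson process of rate $\lambda>0$ and are served one at a time by a single server who never idles while customers are present and never interrupts a service (for instance first-come-first-served). The lengths $S_0,S_1,\dots$ of the successive services are i.i.d. with distribution $G$ on $[0,\infty)$ and are independent of the arrivals. Write $g_k=\int x^k\,dG(x)$ and assume $g_1>0$, $g_3<\infty$. Put $\mu=1/g_1$, $\rho=\lambda/\mu$, $c^2=g_2/g_1^2-1$, and assume $\rho<1$. At time $0$ there are $Q(0)$ customers in the system and, if $Q(0)>0$, the service in progress has remaining length $R>0$. The pair $(Q(0),R)$ has an arbitrary joint distribution with $\operatorname{Var}(Q(0))<\infty$ and is independent of the arrivals after time $0$ and of the lengths of the services started later. Let $A(t)$ be the number of arrivals during $[0,t]$, $D(t)$ the number of service completions during $[0,t]$ and $Q(t)=Q(0)+A(t)-D(t)$ the number of customers in the system at time $t$. Let $\pi$ be the stationary distribution of the number of customers in the system, and $\sigma_\pi^2$ its variance. Assume that 1. there are real numbers $\overline v$ and $\overline b$ such that $\operatorname{Var}(D(t))=\overline v\,t+\overline b+o(1)$ as $t\to\infty$; 2. $\lim_{t\to\infty}\operatorname{Var}(Q(t))=\sigma_\pi^2$;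 3. $\lim_{t\to\infty}\operatorname{Cov}(Q(0),Q(t))=0$. Then $$\lim_{t\to\infty}\operatorname{Cov}\bigl(A(t),Q(t)\bigr)=\frac{\rho}{(1-\rho)^2}\Bigl(1+(c^2-1)\frac{\rho(2-\rho)}{2}\Bigr).$$ -/

import Mathlib

open MeasureTheory ProbabilityTheory Filter Topology

/-- The primitives of an M/G/1 queue with Poisson arrivals of rate `lam` and service time
distribution `G`, started from an arbitrary (random) state at time `0`.

`service k` is the length of the `k`-th service that is started (counted from `0`).  If there
are customers at time `0`, then the service with number `0` is already in progress at that time,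
and what remains of it is `residual` instead of `service 0`.  The pair
`(initial, residual)` has an arbitrary joint law. -/
structure MG1Queue {Ω : Type*} [MeasurableSpace Ω] (P : Measure Ω) (lam : ℝ) (G : Measure ℝ) where
  /-- `interarrival n` is the time between the arrivals number `n - 1` and `n`
  (between time `0` and the first arrival, if `n = 0`). -/
  interarrival : ℕ → Ω → ℝ
  /-- the successive service times -/
  service : ℕ → Ω → ℝ
  /-- the number of customers in the system at time `0` -/
  initial : Ω → ℕ
  /-- the remaining service time of the customer who is in service at time `0`, if any -/
  residual : Ω → ℝ
  measurable_interarrival : ∀ n, Measurable (interarrival n)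
  measurable_service : ∀ n, Measurable (service n)
  measurable_initial : Measurable initial
  measurable_residual : Measurable residual
  law_interarrival : ∀ n, P.map (interarrival n) = expMeasure lam
  law_service : ∀ n, P.map (service n) = G
  residual_pos : ∀ᵐ ω ∂P, 0 < initial ω → 0 < residual ω
  iIndep_interarrival : iIndepFun interarrival P
  iIndep_service : iIndepFun service P
  indep_interarrival_service :
    IndepFun (fun ω n => interarrival n ω) (fun ω n => service n ω) P
  indep_start :
    IndepFun (fun ω => (initial ω, residual ω))
      (fun ω => ((fun n => interarrival n ω), (fun n => service n ω))) P

namespace MG1Queue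

variable {Ω : Type*} [MeasurableSpace Ω] {P : Measure Ω} {lam : ℝ} {G : Measure ℝ}

/-- The epoch of the `n`-th arrival after time `0` (counted from `0`). -/
noncomputable def arrivalTime (X : MG1Queue P lam G) (n : ℕ) (ω : Ω) : ℝ :=
  ∑ i ∈ Finset.range (n + 1), X.interarrival i ω

/-- `A(t)`: the number of arrivals during `[0, t]`. -/
noncomputable def arrivals (X : MG1Queue P lam G) (t : ℝ) (ω : Ω) : ℕ :=
  Set.ncard {n : ℕ | X.arrivalTime n ω ≤ t}

/-- The time from which the `k`-th customer is available for service, where the customers present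
at time `0` are numbered first. -/
noncomputable def entryTime (X : MG1Queue P lam G) (k : ℕ) (ω : Ω) : ℝ :=
  if k < X.initial ω then 0 else X.arrivalTime (k - X.initial ω) ω

/-- The time that the `k`-th service takes after time `0`. -/
noncomputable def workTime (X : MG1Queue P lam G) (k : ℕ) (ω : Ω) : ℝ :=
  if k = 0 ∧ 0 < X.initial ω then X.residual ω else X.service k ω

/-- The epoch of the `k`-th service completion: the single server starts the next service as
soon as the previous one is completed and a further customer is there, and never interrupts it. -/
noncomputable def departureTime (X : MG1Queue P lam G) : ℕ → Ω → ℝ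
  | 0, ω => X.entryTime 0 ω + X.workTime 0 ω
  | k + 1, ω => max (X.entryTime (k + 1) ω) (departureTime X k ω) + X.workTime (k + 1) ω

/-- `D(t)`: the number of service completions during `[0, t]`. -/
noncomputable def departures (X : MG1Queue P lam G) (t : ℝ) (ω : Ω) : ℕ :=
  Set.ncard {k : ℕ | X.departureTime k ω ≤ t}

/-- `Q(t)`: the number of customers who have entered the system by time `t` and have not left
it by then. -/
noncomputable def queueLength (X : MG1Queue P lam G) (t : ℝ) (ω : Ω) : ℕ :=
  Set.ncard {k : ℕ | X.entryTime k ω ≤ t ∧ t < X.departureTime k ω}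

end MG1Queue

/-- `π` is a stationary distribution of the number of customers in the M/G/1 queue: with a suitable
initial state the number of customers has law `π` at all times. -/
def IsStationaryQueueLaw (lam : ℝ) (G : Measure ℝ) (π : Measure ℕ) : Prop :=
  ∃ (Ω : Type) (_ : MeasurableSpace Ω) (P : Measure Ω) (_ : IsProbabilityMeasure P)
    (X : MG1Queue P lam G), ∀ t : ℝ, 0 ≤ t → P.map (X.queueLength t) = π

/-- The `k`-th moment of the service time distribution. -/
noncomputable def serviceMoment (G : Measure ℝ) (k : ℕ) : ℝ := ∫ x, x ^ k ∂G

/-- The traffic intensity `ρ = λ / μ`, where `μ = 1 / g₁`. -/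
noncomputable def trafficIntensity (lam : ℝ) (G : Measure ℝ) : ℝ :=
  lam / (serviceMoment G 1)⁻¹

/-- The squared coefficient of variation `c²` of the service time distribution. -/
noncomputable def sqCoeffVar (G : Measure ℝ) : ℝ :=
  serviceMoment G 2 / serviceMoment G 1 ^ 2 - 1

/-!
Write `A`, `D`, `Q` for the numbers of arrivals, of departures and of customers in the system, and
`K(t) = Cov(A(t), Q(t))`.  Two descriptions of `K` are compared.

On the one hand, `Q + D = Q(0) + A` and the independence of `Q(0)` and `A` express `K(t)` by the
variances of `Q(0)`, `A(t)`, `Q(t)`, `D(t)` and by `Cov(Q(0), Q(t))`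
(`covariance_arrivals_queueLength`).  The hypotheses therefore make `K` asymptotically affine,
`K(t) = α t + β + o(1)`, with unknown `α` and `β`.

On the other hand, `K(t) = lam t - Cov(A(t), D(t))`.  Let `T n` be the epoch of the `n`-th arrival
and `B n` the epoch at which this customer departs.  As `A(t) - lam t` is a martingale with
independent increments, `Cov(A(t), D(t)) = ∑ E[(n - lam T n) 1{B n ≤ t}]` (`hasSum_covTerm`), with
the Laplace-Stieltjes transform `J(s) = ∑ E[(n - lam T n) exp (-s B n)]` (`covTransform`,
`laplace_tsum_covTerm`).  By an Abelian argument `J(s) = (lam - α) / s - β + o(1)` as `s → 0`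
(`tendsto_laplace_of_asymptote`).

The function `J` can be computed.  The generating function of the joint transforms of `T n` and the
workload `B n - T n` satisfies a kernel equation, which is solved at the zero `η` of its kernel
(`tsum_workTransform`).  Formally `J` is the derivative of this generating function in a tilting
parameter `z` at `z = 1`.  Instead of differentiating series, one uses that the tilted sum lies
above its tangent, so that the difference has a local minimum, and one takes `η` rather than `z`
as the parameter, since `z` and `s` are explicit in `η` while `η` is only implicit in them.  The
result is a closed formula for `J` at `s = η - lam (1 - laplace G η)` (`covTransform_eq`).
Expanding it for `η → 0` gives `J(s) = lam / s - L + o(1)` with the asserted limit `L`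
(`tendsto_covTransform_sub`); comparison yields `α = 0` and `β = L`.

The expansion needs the initial work to have a finite mean, which is not assumed.  It follows from
the boundedness of `Var Q(t)`: while the residual service `R` lasts nobody departs, so that `Q(t)`
is larger than its mean by an amount of order `t`, and hence `P(R > t) = O(t⁻²)`
(`sq_mul_measureReal_residual_le`, `integrable_initialWork`).
-/

/-! ### The Poisson arrival process -/

/-- The exponential law has a density on the open half-line. -/
lemma lintegral_expMeasure (lam : ℝ) (f : ℝ → ENNReal) :
    ∫⁻ x, f x ∂(expMeasure lam) =
      ∫⁻ x in Set.Ioi 0, ENNReal.ofReal (lam * Real.exp (-(lam * x))) * f x := by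
  have h : expMeasure lam = (volume.restrict (Set.Ioi 0)).withDensity
      (fun x => ENNReal.ofReal (lam * Real.exp (-(lam * x)))) := by
    rw [expMeasure, gammaMeasure, restrict_Ioi_eq_restrict_Ici,
      ← withDensity_indicator measurableSet_Ici]
    congr 1
    ext x
    by_cases hx : 0 ≤ x
    · rw [Set.indicator_of_mem (by exact hx)]
      exact exponentialPDF_of_nonneg hx
    · rw [Set.indicator_of_notMem (by exact hx)]
      exact exponentialPDF_of_neg (not_le.mp hx)
  rw [h, lintegral_withDensity_eq_lintegral_mul_non_measurable]
  · rfl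
  · fun_prop
  · exact ae_of_all _ fun x => ENNReal.ofReal_lt_top

section Poisson

variable {Ω : Type*} [MeasurableSpace Ω] {P : Measure Ω}

/-- Fubini's theorem for independent random variables. -/
lemma lintegral_of_indepFun {α β : Type*} [MeasurableSpace α] [MeasurableSpace β]
    [IsProbabilityMeasure P] {Y : Ω → α} {Z : Ω → β} (h : IndepFun Y Z P) (hY : Measurable Y)
    (hZ : Measurable Z) {f : α → β → ENNReal} (hf : Measurable (Function.uncurry f)) :
    ∫⁻ ω, f (Y ω) (Z ω) ∂P = ∫⁻ ω, ∫⁻ ω', f (Y ω) (Z ω') ∂P ∂P := by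
  have h1 := (indepFun_iff_map_prod_eq_prod_map_map hY.aemeasurable hZ.aemeasurable).1 h
  have := Measure.isProbabilityMeasure_map (μ := P) hZ.aemeasurable
  have h2 : ∫⁻ ω, f (Y ω) (Z ω) ∂P
      = ∫⁻ p, Function.uncurry f p ∂(P.map (fun ω => (Y ω, Z ω))) := by
    rw [lintegral_map hf (hY.prodMk hZ)]; rfl
  rw [h2, h1, lintegral_prod _ hf.aemeasurable, lintegral_map hf.lintegral_prod_right' hY]
  refine lintegral_congr fun ω => ?_
  exact lintegral_map (f := fun y => f (Y ω) y) (hf.comp measurable_prodMk_left) hZ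

/-- Erlang density of the sum of `n + 1` independent exponential variables. -/
lemma lintegral_sum_exponential [IsProbabilityMeasure P] {lam : ℝ} (hlam : 0 < lam)
    {e : ℕ → Ω → ℝ} (he : ∀ n, Measurable (e n)) (hlaw : ∀ n, P.map (e n) = expMeasure lam)
    (hind : iIndepFun e P) (n : ℕ) {f : ℝ → ENNReal} (hf : Measurable f) :
    ∫⁻ ω, f (∑ i ∈ Finset.range (n + 1), e i ω) ∂P =
      ∫⁻ x in Set.Ioi 0, ENNReal.ofReal
        (lam ^ (n + 1) * x ^ n / n.factorial * Real.exp (-(lam * x))) * f x := by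
  induction n generalizing f with
  | zero =>
    have : ∫⁻ ω, f (∑ i ∈ Finset.range (0 + 1), e i ω) ∂P = ∫⁻ x, f x ∂(expMeasure lam) := by
      rw [← hlaw 0, lintegral_map hf (he 0)]; simp
    rw [this, lintegral_expMeasure]; simp
  | succ n ih =>
    have hT : Measurable (fun ω => ∑ i ∈ Finset.range (n + 1), e i ω) :=
      Finset.measurable_sum _ fun i _ => he i
    have hi : IndepFun (fun ω => ∑ i ∈ Finset.range (n + 1), e i ω) (e (n + 1)) P := by
      have := hind.indepFun_sum_range_succ he (n + 1)
      convert! this using 1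
      ext ω; simp
    have h1 : ∫⁻ ω, f (∑ i ∈ Finset.range (n + 1 + 1), e i ω) ∂P
        = ∫⁻ ω, (∫⁻ x in Set.Ioi 0, ENNReal.ofReal (lam * Real.exp (-(lam * x))) *
          f ((∑ i ∈ Finset.range (n + 1), e i ω) + x)) ∂P := by
      simp_rw [Finset.sum_range_succ _ (n + 1)]
      rw [lintegral_of_indepFun (f := fun y x => f (y + x)) hi hT (he _)
        (hf.comp (measurable_fst.add measurable_snd))]
      refine lintegral_congr fun ω => ?_
      rw [← lintegral_expMeasure lam (fun x => f ((∑ i ∈ Finset.range (n + 1), e i ω) + x)),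
        ← hlaw (n + 1), lintegral_map (by fun_prop) (he _)]
    have hm : Measurable (fun y : ℝ => ∫⁻ x in Set.Ioi 0,
        ENNReal.ofReal (lam * Real.exp (-(lam * x))) * f (y + x)) := by
      apply Measurable.lintegral_prod_right'
        (f := fun p : ℝ × ℝ => ENNReal.ofReal (lam * Real.exp (-(lam * p.2))) * f (p.1 + p.2))
      fun_prop
    rw [h1, ih hm]
    -- shift the inner integration variable and exchange the order of integration
    have h2 : ∀ y : ℝ, 0 < y → ENNReal.ofReal (lam ^ (n + 1) * y ^ n / n.factorial *
          Real.exp (-(lam * y))) * ∫⁻ x in Set.Ioi 0,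
            ENNReal.ofReal (lam * Real.exp (-(lam * x))) * f (y + x)
        = ∫⁻ u in Set.Ioi 0, (Set.Ioi y).indicator (fun u => ENNReal.ofReal (lam ^ (n + 2) *
            y ^ n / n.factorial * Real.exp (-(lam * u))) * f u) u := by
      intro y hy
      have h3 : ∫⁻ x in Set.Ioi 0, ENNReal.ofReal (lam * Real.exp (-(lam * x))) * f (y + x)
          = ∫⁻ u in Set.Ioi y, ENNReal.ofReal (lam * Real.exp (-(lam * (u - y)))) * f u := by
        rw [← lintegral_indicator measurableSet_Ioi, ← lintegral_indicator measurableSet_Ioi,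
          ← lintegral_add_left_eq_self ((Set.Ioi y).indicator fun u =>
            ENNReal.ofReal (lam * Real.exp (-(lam * (u - y)))) * f u) y]
        refine lintegral_congr fun x => ?_
        simp only [Set.indicator, Set.mem_Ioi, lt_add_iff_pos_right, add_sub_cancel_left]
      rw [h3, ← lintegral_const_mul' _ _ ENNReal.ofReal_ne_top,
        setLIntegral_indicator measurableSet_Ioi,
        Set.inter_eq_left.2 (Set.Ioi_subset_Ioi hy.le)]
      refine lintegral_congr fun u => ?_
      rw [← mul_assoc, ← ENNReal.ofReal_mul (by positivity)]
      congr 2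
      have : Real.exp (-(lam * u)) = Real.exp (-(lam * y)) * Real.exp (-(lam * (u - y))) := by
        rw [← Real.exp_add]; congr 1; ring
      rw [this]; ring
    rw [setLIntegral_congr_fun measurableSet_Ioi h2, lintegral_lintegral_swap]
    · refine setLIntegral_congr_fun measurableSet_Ioi fun u hu => ?_
      have hu' : (0 : ℝ) < u := hu
      have h4 : ∀ y, (Set.Ioi y).indicator (fun u => ENNReal.ofReal (lam ^ (n + 2) *
            y ^ n / n.factorial * Real.exp (-(lam * u))) * f u) u
          = (Set.Iio u).indicator (fun y => ENNReal.ofReal (lam ^ (n + 2) *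
            y ^ n / n.factorial * Real.exp (-(lam * u))) * f u) y := fun y => by
        simp [Set.indicator]
      simp_rw [h4]
      rw [setLIntegral_indicator measurableSet_Iio, lintegral_mul_const _ (by fun_prop),
        Set.inter_comm, Set.Ioi_inter_Iio]
      congr 1
      rw [← ofReal_integral_eq_lintegral_ofReal]
      · rw [← integral_Ioc_eq_integral_Ioo, ← intervalIntegral.integral_of_le hu'.le]
        congr 1
        have : ∀ y : ℝ, lam ^ (n + 2) * y ^ n / n.factorial * Real.exp (-(lam * u))
          = (lam ^ (n + 2) / n.factorial * Real.exp (-(lam * u))) * y ^ n := fun y => by ring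
        simp_rw [this]
        rw [intervalIntegral.integral_const_mul, integral_pow, Nat.factorial_succ]
        have : (n.factorial : ℝ) ≠ 0 := by positivity
        have : (n + 1 : ℝ) ≠ 0 := by positivity
        push_cast
        simp only [zero_pow (Nat.succ_ne_zero n)]
        field_simp
        ring
      · exact (Continuous.integrableOn_Ioc (by fun_prop)).mono_set Set.Ioo_subset_Ioc_self
      · filter_upwards [self_mem_ae_restrict measurableSet_Ioo] with y hy
        have := hy.1.le
        positivity
    · apply Measurable.aemeasurable
      have : (Function.uncurry fun y u : ℝ => (Set.Ioi y).indicator (fun u => ENNReal.ofReal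
          (lam ^ (n + 2) * y ^ n / n.factorial * Real.exp (-(lam * u))) * f u) u)
          = {p : ℝ × ℝ | p.1 < p.2}.indicator (fun p => ENNReal.ofReal
          (lam ^ (n + 2) * p.1 ^ n / n.factorial * Real.exp (-(lam * p.2))) * f p.2) := by
        ext p; simp [Set.indicator, Function.uncurry]
      rw [this]
      exact Measurable.indicator (by fun_prop) (measurableSet_lt measurable_fst measurable_snd)

/-- The epochs of a Poisson process have the total intensity `lam`: the Erlang densities add up
to `lam`. -/
lemma tsum_erlang {lam x : ℝ} (hlam : 0 < lam) (hx : 0 < x) :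
    ∑' n : ℕ, ENNReal.ofReal (lam ^ (n + 1) * x ^ n / n.factorial * Real.exp (-(lam * x)))
      = ENNReal.ofReal lam := by
  have h : HasSum (fun n : ℕ => lam ^ (n + 1) * x ^ n / n.factorial * Real.exp (-(lam * x)))
      lam := by
    have h1 := (NormedSpace.expSeries_div_hasSum_exp (𝔸 := ℝ) (lam * x)).mul_left
      (lam * Real.exp (-(lam * x)))
    rw [← Real.exp_eq_exp_ℝ, mul_assoc, ← Real.exp_add] at h1
    simp only [neg_add_cancel, Real.exp_zero, mul_one] at h1
    convert! h1 using 2 with n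
    rw [mul_pow]; ring
  rw [← ENNReal.ofReal_tsum_of_nonneg (fun n => by positivity) h.summable, h.tsum_eq]

lemma tsum_mul_erlang {lam x : ℝ} (hlam : 0 < lam) (hx : 0 < x) :
    ∑' n : ℕ, (n : ENNReal) *
        ENNReal.ofReal (lam ^ (n + 1) * x ^ n / n.factorial * Real.exp (-(lam * x)))
      = ENNReal.ofReal (lam ^ 2 * x) := by
  rw [tsum_eq_zero_add' ENNReal.summable]
  simp only [Nat.cast_zero, zero_mul, zero_add]
  have h : ∀ n : ℕ, ((n + 1 : ℕ) : ENNReal) * ENNReal.ofReal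
      (lam ^ (n + 1 + 1) * x ^ (n + 1) / (n + 1).factorial * Real.exp (-(lam * x)))
      = ENNReal.ofReal (lam * x) *
        ENNReal.ofReal (lam ^ (n + 1) * x ^ n / n.factorial * Real.exp (-(lam * x))) := by
    intro n
    rw [← ENNReal.ofReal_natCast, ← ENNReal.ofReal_mul (by positivity),
      ← ENNReal.ofReal_mul (by positivity), Nat.factorial_succ]
    congr 1
    have : (n.factorial : ℝ) ≠ 0 := by positivity
    have : (n + 1 : ℝ) ≠ 0 := by positivity
    push_cast
    field_simp
    ring
  simp_rw [h]
  rw [ENNReal.tsum_mul_left, tsum_erlang hlam hx, ← ENNReal.ofReal_mul (by positivity)]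
  congr 1; ring

/-- The number of arrivals up to time `u`, for the arrival process with interarrival times `e`. -/
noncomputable def arrivalCount (e : ℕ → ℝ) (u : ℝ) : ENNReal :=
  ∑' n : ℕ, (Set.Iic u).indicator 1 (∑ i ∈ Finset.range (n + 1), e i)

lemma measurable_arrivalCount :
    Measurable (fun p : ℝ × (ℕ → ℝ) => arrivalCount p.2 p.1) := by
  unfold arrivalCount
  refine Measurable.tsum fun n => ?_
  have : (fun p : ℝ × (ℕ → ℝ) => (Set.Iic p.1).indicator (1 : ℝ → ENNReal)
      (∑ i ∈ Finset.range (n + 1), p.2 i))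
      = {p : ℝ × (ℕ → ℝ) | ∑ i ∈ Finset.range (n + 1), p.2 i ≤ p.1}.indicator 1 := by
    ext p; simp [Set.indicator]
  rw [this]
  exact measurable_one.indicator (measurableSet_le (by fun_prop) (by fun_prop))

variable [IsProbabilityMeasure P] {lam : ℝ} {e : ℕ → Ω → ℝ}

/-- The intensity of the arrival process is `lam`. -/
lemma lintegral_arrivalCount (hlam : 0 < lam) (he : ∀ n, Measurable (e n))
    (hlaw : ∀ n, P.map (e n) = expMeasure lam) (hind : iIndepFun e P) (u : ℝ) :
    ∫⁻ ω, arrivalCount (fun n => e n ω) u ∂P = ENNReal.ofReal (lam * u) := by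
  unfold arrivalCount
  have hm : Measurable ((Set.Iic u).indicator (1 : ℝ → ENNReal)) :=
    measurable_one.indicator measurableSet_Iic
  have hm' : ∀ n : ℕ, Measurable fun ω => (Set.Iic u).indicator (1 : ℝ → ENNReal)
      (∑ i ∈ Finset.range (n + 1), e i ω) :=
    fun n => hm.comp (Finset.measurable_sum _ fun i _ => he i)
  rw [lintegral_tsum fun n => (hm' n).aemeasurable]
  simp_rw [lintegral_sum_exponential hlam he hlaw hind _ hm]
  rw [← lintegral_tsum fun n => by fun_prop]
  have : ∀ x ∈ Set.Ioi (0 : ℝ), ∑' n : ℕ, ENNReal.ofReal (lam ^ (n + 1) * x ^ n / n.factorial *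
      Real.exp (-(lam * x))) * (Set.Iic u).indicator (1 : ℝ → ENNReal) x
      = (Set.Iic u).indicator (fun _ => ENNReal.ofReal lam) x := by
    intro x hx
    rw [ENNReal.tsum_mul_right, tsum_erlang hlam hx]
    simp [Set.indicator]
  rw [setLIntegral_congr_fun measurableSet_Ioi this, setLIntegral_indicator measurableSet_Iic,
    setLIntegral_const, Set.inter_comm, Set.Ioi_inter_Iic, Real.volume_Ioc, sub_zero,
    ENNReal.ofReal_mul hlam.le]

/-- Half of the second factorial moment of the number of arrivals. -/
lemma lintegral_tsum_mul_arrival (hlam : 0 < lam) (he : ∀ n, Measurable (e n))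
    (hlaw : ∀ n, P.map (e n) = expMeasure lam) (hind : iIndepFun e P) {u : ℝ} (hu : 0 ≤ u) :
    ∫⁻ ω, ∑' n : ℕ, (n : ENNReal) *
        (Set.Iic u).indicator 1 (∑ i ∈ Finset.range (n + 1), e i ω) ∂P
      = ENNReal.ofReal (lam ^ 2 * u ^ 2 / 2) := by
  have hm : Measurable ((Set.Iic u).indicator (1 : ℝ → ENNReal)) :=
    measurable_one.indicator measurableSet_Iic
  have hm' : ∀ n : ℕ, Measurable fun ω => (Set.Iic u).indicator (1 : ℝ → ENNReal)
      (∑ i ∈ Finset.range (n + 1), e i ω) :=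
    fun n => hm.comp (Finset.measurable_sum _ fun i _ => he i)
  rw [lintegral_tsum fun n => ((hm' n).const_mul _).aemeasurable]
  simp_rw [lintegral_const_mul _ (hm' _), lintegral_sum_exponential hlam he hlaw hind _ hm]
  have h0 : ∀ n : ℕ, Measurable (fun x : ℝ => ENNReal.ofReal (lam ^ (n + 1) * x ^ n / n.factorial *
      Real.exp (-(lam * x))) * (Set.Iic u).indicator (1 : ℝ → ENNReal) x) := fun n => by fun_prop
  simp_rw [← lintegral_const_mul _ (h0 _)]
  rw [← lintegral_tsum fun n => by fun_prop]
  have : ∀ x ∈ Set.Ioi (0 : ℝ), ∑' n : ℕ, (n : ENNReal) * (ENNReal.ofReal (lam ^ (n + 1) * x ^ n /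
      n.factorial * Real.exp (-(lam * x))) * (Set.Iic u).indicator (1 : ℝ → ENNReal) x)
      = (Set.Iic u).indicator (fun x => ENNReal.ofReal (lam ^ 2 * x)) x := by
    intro x hx
    simp_rw [← mul_assoc]
    rw [ENNReal.tsum_mul_right, tsum_mul_erlang hlam hx]
    simp [Set.indicator]
  rw [setLIntegral_congr_fun measurableSet_Ioi this, setLIntegral_indicator measurableSet_Iic,
    Set.inter_comm, Set.Ioi_inter_Iic, ← ofReal_integral_eq_lintegral_ofReal]
  · rw [← intervalIntegral.integral_of_le hu, intervalIntegral.integral_const_mul, integral_id]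
    congr 1; ring
  · exact Continuous.integrableOn_Ioc (by fun_prop)
  · filter_upwards [self_mem_ae_restrict measurableSet_Ioc] with y hy
    have := hy.1.le
    positivity

end Poisson

/-! ### Sample paths of the queue -/

/-- The work present at time `0` if there are `N` customers with residual service time `r`. -/
noncomputable def initialWorkOf (N : ℕ) (r : ℝ) (S : ℕ → ℝ) : ℝ :=
  if N = 0 then 0 else r + ∑ k ∈ Finset.Ico 1 N, S k

/-- The epoch at which the work of the `N` initial customers and of the first `n` arriving
customers is done, for the interarrival times `e` and the service times `S`. -/
noncomputable def clearTimeOf (N : ℕ) (r : ℝ) (e S : ℕ → ℝ) : ℕ → ℝ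
  | 0 => initialWorkOf N r S
  | n + 1 => max (∑ i ∈ Finset.range (n + 1), e i) (clearTimeOf N r e S n) + S (N + n)

lemma clearTimeOf_congr {N : ℕ} {r : ℝ} {e e' S S' : ℕ → ℝ} {n : ℕ}
    (he : ∀ i < n, e i = e' i) (hS : ∀ k < N + n, S k = S' k) :
    clearTimeOf N r e S n = clearTimeOf N r e' S' n := by
  induction n with
  | zero =>
    simp only [clearTimeOf, initialWorkOf]
    congr 2
    exact Finset.sum_congr rfl fun k hk => hS k (by have := (Finset.mem_Ico.1 hk).2; omega)
  | succ n ih =>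
    rw [clearTimeOf, clearTimeOf, ih (fun i hi => he i (by omega)) (fun k hk => hS k (by omega)),
      hS (N + n) (by omega),
      Finset.sum_congr rfl fun i hi => he i (Finset.mem_range.1 hi)]

lemma measurable_clearTimeOf (n : ℕ) : Measurable fun p : (ℕ × ℝ) × (ℕ → ℝ) × (ℕ → ℝ) =>
    clearTimeOf p.1.1 p.1.2 p.2.1 p.2.2 n := by
  have h : ∀ N : ℕ, Measurable fun q : ℝ × (ℕ → ℝ) × (ℕ → ℝ) =>
      clearTimeOf N q.1 q.2.1 q.2.2 n := by
    intro N
    induction n with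
    | zero =>
      simp only [clearTimeOf, initialWorkOf]
      split_ifs <;> fun_prop
    | succ n ih =>
      simp only [clearTimeOf]
      fun_prop
  exact (measurable_from_prod_countable_right (f := fun p : ℕ × ℝ × (ℕ → ℝ) × (ℕ → ℝ) =>
    clearTimeOf p.1 p.2.1 p.2.2.1 p.2.2.2 n) h).comp (by fun_prop : Measurable
      fun p : (ℕ × ℝ) × (ℕ → ℝ) × (ℕ → ℝ) => (p.1.1, p.1.2, p.2.1, p.2.2))

namespace MG1Queue

variable {Ω : Type*} [MeasurableSpace Ω] {P : Measure Ω} {lam : ℝ} {G : Measure ℝ}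

/-- The sum of the first `n` interarrival times; for `0 < n` it is the epoch of the arrival with
number `n - 1`. -/
noncomputable def arrivalSum (X : MG1Queue P lam G) (n : ℕ) (ω : Ω) : ℝ :=
  ∑ i ∈ Finset.range n, X.interarrival i ω

/-- The work present at time `0`: the residual service and the services of the customers who
are waiting at that time. -/
noncomputable def initialWork (X : MG1Queue P lam G) (ω : Ω) : ℝ :=
  initialWorkOf (X.initial ω) (X.residual ω) fun k => X.service k ω

/-- The epoch at which the work of the initial customers and of the first `n` arriving customers
is done.  For `0 < n` it is the departure epoch of the `n`-th arriving customer. -/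
noncomputable def clearTime (X : MG1Queue P lam G) (n : ℕ) (ω : Ω) : ℝ :=
  clearTimeOf (X.initial ω) (X.residual ω) (fun i => X.interarrival i ω) (fun k => X.service k ω) n

lemma clearTime_zero (X : MG1Queue P lam G) (ω : Ω) : X.clearTime 0 ω = X.initialWork ω := rfl

lemma clearTime_succ (X : MG1Queue P lam G) (n : ℕ) (ω : Ω) : X.clearTime (n + 1) ω =
    max (X.arrivalSum (n + 1) ω) (X.clearTime n ω) + X.service (X.initial ω + n) ω := rfl

/-- The sign conditions which hold for almost every sample path. -/
structure IsRegular (X : MG1Queue P lam G) (ω : Ω) : Prop where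
  interarrival_pos : ∀ n, 0 < X.interarrival n ω
  service_nonneg : ∀ k, 0 ≤ X.service k ω
  residual_pos : 0 < X.initial ω → 0 < X.residual ω

lemma ae_isRegular (hG_nonneg : ∀ᵐ x ∂G, 0 ≤ x) (X : MG1Queue P lam G) :
    ∀ᵐ ω ∂P, X.IsRegular ω := by
  have h1 : ∀ᵐ ω ∂P, ∀ n, 0 < X.interarrival n ω := by
    rw [ae_all_iff]
    intro n
    have : ∀ᵐ x ∂(expMeasure lam), 0 < x := by
      rw [ae_iff]
      have h := lintegral_expMeasure lam ({x | ¬ 0 < x}.indicator 1)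
      rw [lintegral_indicator_one (by measurability)] at h
      rw [h, setLIntegral_congr_fun measurableSet_Ioi (g := fun _ => 0)]
      · simp
      · intro x hx
        have : (0 : ℝ) < x := hx
        simp [this]
    rw [← X.law_interarrival n] at this
    exact ae_of_ae_map (X.measurable_interarrival n).aemeasurable this
  have h2 : ∀ᵐ ω ∂P, ∀ k, 0 ≤ X.service k ω := by
    rw [ae_all_iff]
    intro k
    rw [← X.law_service k] at hG_nonneg
    exact ae_of_ae_map (X.measurable_service k).aemeasurable hG_nonneg
  filter_upwards [h1, h2, X.residual_pos] with ω a b c using ⟨a, b, c⟩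

section Path

variable {X : MG1Queue P lam G} {ω : Ω}

lemma arrivalSum_succ (X : MG1Queue P lam G) (n : ℕ) (ω : Ω) :
    X.arrivalSum (n + 1) ω = X.arrivalSum n ω + X.interarrival n ω :=
  Finset.sum_range_succ _ _

lemma IsRegular.arrivalSum_nonneg (h : X.IsRegular ω) (n : ℕ) : 0 ≤ X.arrivalSum n ω :=
  Finset.sum_nonneg fun i _ => (h.interarrival_pos i).le

lemma IsRegular.arrivalTime_pos (h : X.IsRegular ω) (n : ℕ) : 0 < X.arrivalTime n ω :=
  Finset.sum_pos (fun i _ => h.interarrival_pos i) ⟨0, by simp⟩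

lemma IsRegular.monotone_arrivalSum (h : X.IsRegular ω) : Monotone fun n => X.arrivalSum n ω :=
  monotone_nat_of_le_succ fun n => by
    rw [X.arrivalSum_succ]; linarith [h.interarrival_pos n]

lemma IsRegular.workTime_nonneg (h : X.IsRegular ω) (k : ℕ) : 0 ≤ X.workTime k ω := by
  unfold workTime
  split_ifs with hk
  · exact (h.residual_pos hk.2).le
  · exact h.service_nonneg k

lemma IsRegular.initialWork_nonneg (h : X.IsRegular ω) : 0 ≤ X.initialWork ω := by
  unfold initialWork initialWorkOf
  split_ifs with h0
  · rfl
  · exact add_nonneg (h.residual_pos (Nat.pos_of_ne_zero h0)).le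
      (Finset.sum_nonneg fun k _ => h.service_nonneg k)

lemma IsRegular.arrivalSum_le_clearTime (h : X.IsRegular ω) (n : ℕ) :
    X.arrivalSum n ω ≤ X.clearTime n ω := by
  cases n with
  | zero => simpa [arrivalSum, clearTime_zero] using h.initialWork_nonneg
  | succ n =>
    rw [clearTime_succ]
    linarith [le_max_left (X.arrivalSum (n + 1) ω) (X.clearTime n ω),
      h.service_nonneg (X.initial ω + n)]

lemma IsRegular.entryTime_le_departureTime (h : X.IsRegular ω) (k : ℕ) :
    X.entryTime k ω ≤ X.departureTime k ω := by
  cases k with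
  | zero => rw [departureTime]; linarith [h.workTime_nonneg 0]
  | succ k =>
    rw [departureTime]
    linarith [h.workTime_nonneg (k + 1),
      le_max_left (X.entryTime (k + 1) ω) (X.departureTime k ω)]

lemma IsRegular.monotone_departureTime (h : X.IsRegular ω) :
    Monotone fun k => X.departureTime k ω :=
  monotone_nat_of_le_succ fun k => by
    rw [departureTime]
    linarith [h.workTime_nonneg (k + 1),
      le_max_right (X.entryTime (k + 1) ω) (X.departureTime k ω)]

lemma departureTime_zero_of_initial_pos (h0 : 0 < X.initial ω) :
    X.departureTime 0 ω = X.residual ω := by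
  simp [departureTime, entryTime, workTime, h0]

lemma IsRegular.departureTime_pos (h : X.IsRegular ω) (k : ℕ) : 0 < X.departureTime k ω := by
  refine lt_of_lt_of_le ?_ (h.monotone_departureTime (Nat.zero_le k))
  rcases Nat.eq_zero_or_pos (X.initial ω) with h0 | h0
  · refine lt_of_lt_of_le ?_ (h.entryTime_le_departureTime 0)
    simpa [entryTime, h0] using h.arrivalTime_pos 0
  · simpa only [departureTime_zero_of_initial_pos h0] using h.residual_pos h0

lemma IsRegular.departureTime_of_lt_initial (h : X.IsRegular ω) {k : ℕ} (hk : k < X.initial ω) :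
    X.departureTime k ω = X.residual ω + ∑ j ∈ Finset.Ico 1 (k + 1), X.service j ω := by
  induction k with
  | zero => rw [departureTime_zero_of_initial_pos hk]; simp
  | succ k ih =>
    have hpos := h.departureTime_pos k
    rw [departureTime, entryTime, if_pos hk, max_eq_right hpos.le, ih (by omega), workTime,
      if_neg (by omega),
      Finset.sum_Ico_succ_top (b := k + 1) (by omega), add_assoc]

/-- The customer with number `X.initial ω + n` departs at `X.clearTime (n + 1) ω`. -/
lemma IsRegular.departureTime_initial_add (h : X.IsRegular ω) (n : ℕ) :
    X.departureTime (X.initial ω + n) ω = X.clearTime (n + 1) ω := by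
  have hent : ∀ n, X.entryTime (X.initial ω + n) ω = X.arrivalSum (n + 1) ω := fun n => by
    simp [entryTime, arrivalTime, arrivalSum]
  have hwork : ∀ n, X.workTime (X.initial ω + n) ω = X.service (X.initial ω + n) ω := fun n => by
    rw [workTime, if_neg (by omega)]
  have key : ∀ n, X.departureTime (X.initial ω + n) ω =
      max (X.arrivalSum (n + 1) ω) (if X.initial ω + n = 0 then 0 else
        X.departureTime (X.initial ω + n - 1) ω) + X.service (X.initial ω + n) ω := by
    intro n
    rw [← hwork n, ← hent]
    rcases hk : X.initial ω + n with _ | k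
    · have := h.arrivalTime_pos 0
      have hN : X.initial ω = 0 := by omega
      rw [if_pos rfl, departureTime, max_eq_left]
      simp only [entryTime, hN, lt_irrefl, if_false]
      exact this.le
    · rw [departureTime, if_neg (by omega), Nat.add_sub_cancel]
  induction n with
  | zero =>
    rw [key, clearTime_succ, clearTime_zero, initialWork, initialWorkOf]
    simp only [add_zero]
    split_ifs with h0
    · rfl
    · rw [h.departureTime_of_lt_initial (by omega), Nat.sub_add_cancel (by omega)]
  | succ n ih =>
    rw [key, clearTime_succ, if_neg (by omega), ← ih]
    rfl

lemma tsum_indicator_one_eq_ncard {s : Set ℕ} (hs : s.Finite) :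
    ∑' n, s.indicator (1 : ℕ → ENNReal) n = (s.ncard : ENNReal) := by
  rw [tsum_eq_sum (s := hs.toFinset) (fun n hn => by simpa using hn),
    Set.ncard_eq_toFinset_card _ hs, Finset.card_eq_sum_ones, Nat.cast_sum]
  exact Finset.sum_congr rfl fun n hn => by
    rw [Set.indicator_of_mem (by simpa using hn)]; simp

lemma arrivalCount_eq_tsum (X : MG1Queue P lam G) (ω : Ω) (t : ℝ) :
    arrivalCount (fun n => X.interarrival n ω) t
      = ∑' n, {n : ℕ | X.arrivalTime n ω ≤ t}.indicator (1 : ℕ → ENNReal) n := by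
  unfold arrivalCount
  congr 1 with n

lemma finite_of_arrivalCount_ne_top {t : ℝ}
    (h : arrivalCount (fun n => X.interarrival n ω) t ≠ ⊤) :
    {n : ℕ | X.arrivalTime n ω ≤ t}.Finite := by
  rw [arrivalCount_eq_tsum] at h
  refine (ENNReal.finite_const_le_of_tsum_ne_top h one_ne_zero).subset fun n hn => ?_
  simp only [Set.mem_ofPred_eq] at hn
  simp [hn]

lemma arrivals_eq_arrivalCount {t : ℝ} (hfin : {n : ℕ | X.arrivalTime n ω ≤ t}.Finite) :
    (X.arrivals t ω : ENNReal) = arrivalCount (fun n => X.interarrival n ω) t := by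
  rw [arrivalCount_eq_tsum, tsum_indicator_one_eq_ncard hfin]
  rfl

lemma setOf_entryTime_le {t : ℝ} (ht : 0 ≤ t) :
    {k | X.entryTime k ω ≤ t} = Set.Iio (X.initial ω) ∪
      (fun n => X.initial ω + n) '' {n : ℕ | X.arrivalTime n ω ≤ t} := by
  ext k
  simp only [Set.mem_ofPred_eq, Set.mem_union, Set.mem_Iio, Set.mem_image, entryTime]
  by_cases hk : k < X.initial ω
  · simp [hk, ht]
  · simp only [hk, if_false, false_or]
    constructor
    · intro h; exact ⟨_, h, by omega⟩
    · rintro ⟨n, hn, rfl⟩; simpa using hn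

/-- The balance equation `Q(t) + D(t) = Q(0) + A(t)`. -/
lemma IsRegular.queueLength_add_departures (h : X.IsRegular ω) {t : ℝ} (ht : 0 ≤ t)
    (hfin : {n : ℕ | X.arrivalTime n ω ≤ t}.Finite) :
    X.queueLength t ω + X.departures t ω = X.initial ω + X.arrivals t ω := by
  have hE := setOf_entryTime_le (X := X) (ω := ω) ht
  have hEfin : {k | X.entryTime k ω ≤ t}.Finite := by
    rw [hE]; exact (Set.finite_Iio _).union (hfin.image _)
  have h1 : {k | X.entryTime k ω ≤ t}.ncard = X.initial ω + X.arrivals t ω := by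
    rw [hE, Set.ncard_union_eq _ (Set.finite_Iio _) (hfin.image _),
      Set.ncard_image_of_injective _ (add_right_injective _), arrivals]
    · simp [Set.ncard_eq_toFinset_card']
    · rw [Set.disjoint_left]
      rintro k hk ⟨n, -, rfl⟩
      simp only [Set.mem_Iio] at hk
      omega
  have hf1 : {k | X.entryTime k ω ≤ t ∧ t < X.departureTime k ω}.Finite :=
    hEfin.subset fun k hk => hk.1
  have hf2 : {k | X.departureTime k ω ≤ t}.Finite :=
    hEfin.subset fun k hk => (h.entryTime_le_departureTime k).trans hk
  rw [← h1, queueLength, departures, ← Set.ncard_union_eq ?_ hf1 hf2]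
  · congr 1
    ext k
    simp only [Set.mem_union, Set.mem_ofPred_eq]
    constructor
    · rintro (h2 | h2)
      · exact h2.1
      · exact (h.entryTime_le_departureTime k).trans h2
    · intro h2
      rcases lt_or_ge t (X.departureTime k ω) with h3 | h3
      · exact Or.inl ⟨h2, h3⟩
      · exact Or.inr h3
  · rw [Set.disjoint_left]
    intro k hk hk'
    exact absurd hk.2 (not_lt.2 hk')

lemma IsRegular.queueLength_zero (h : X.IsRegular ω) : X.queueLength 0 ω = X.initial ω := by
  have h0 : {n : ℕ | X.arrivalTime n ω ≤ 0} = ∅ := by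
    ext n; simpa using h.arrivalTime_pos n
  have h1 : {k : ℕ | X.departureTime k ω ≤ 0} = ∅ := by
    ext n; simpa using h.departureTime_pos n
  have := h.queueLength_add_departures le_rfl (by rw [h0]; exact Set.finite_empty)
  rwa [departures, arrivals, h0, h1, Set.ncard_empty] at this

/-- The departures up to time `t`, split into those of the initial customers and those of the
customers who arrive after time `0`. -/
lemma IsRegular.departures_eq (h : X.IsRegular ω) {t : ℝ}
    (hfin : {n : ℕ | X.arrivalTime n ω ≤ t}.Finite) :
    (X.departures t ω : ENNReal) =
      (∑' k : ℕ, {k | k < X.initial ω ∧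
          X.residual ω + ∑ j ∈ Finset.Ico 1 (k + 1), X.service j ω ≤ t}.indicator 1 k)
      + ∑' n : ℕ, {n | X.clearTime (n + 1) ω ≤ t}.indicator 1 n := by
  have hf1 : {k | k < X.initial ω ∧
      X.residual ω + ∑ j ∈ Finset.Ico 1 (k + 1), X.service j ω ≤ t}.Finite :=
    (Set.finite_Iio (X.initial ω)).subset fun k hk => hk.1
  have hf2 : {n | X.clearTime (n + 1) ω ≤ t}.Finite :=
    hfin.subset fun n hn => (h.arrivalSum_le_clearTime (n + 1)).trans hn
  rw [tsum_indicator_one_eq_ncard hf1, tsum_indicator_one_eq_ncard hf2, ← Nat.cast_add,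
    ← Set.ncard_image_of_injective {n | X.clearTime (n + 1) ω ≤ t}
      (add_right_injective (X.initial ω)),
    ← Set.ncard_union_eq _ hf1 (hf2.image _), departures]
  · congr 2
    ext k
    simp only [Set.mem_union, Set.mem_ofPred_eq, Set.mem_image]
    by_cases hk : k < X.initial ω
    · rw [h.departureTime_of_lt_initial hk]
      simp only [hk, true_and]
      constructor
      · exact Or.inl
      · rintro (h1 | ⟨n, -, rfl⟩)
        · exact h1
        · omega
    · simp only [hk, false_and, false_or]
      constructor
      · intro h1
        refine ⟨k - X.initial ω, ?_, by omega⟩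
        rw [← h.departureTime_initial_add, Nat.add_sub_of_le (not_lt.1 hk)]
        exact h1
      · rintro ⟨n, h1, rfl⟩
        rwa [h.departureTime_initial_add]
  · rw [Set.disjoint_left]
    rintro k hk ⟨n, -, rfl⟩
    simp only [Set.mem_ofPred_eq] at hk
    omega

end Path

end MG1Queue

/-! ### Independence of past and future -/

section Independence

variable {Ω : Type*} [MeasurableSpace Ω] {P : Measure Ω}

lemma indepFun_assoc [IsProbabilityMeasure P] {α β γ : Type*} [MeasurableSpace α]
    [MeasurableSpace β] [MeasurableSpace γ]
    {U : Ω → α} {Y : Ω → β} {Z : Ω → γ} (hU : Measurable U) (hY : Measurable Y) (hZ : Measurable Z)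
    (h1 : IndepFun U (fun ω => (Y ω, Z ω)) P) (h2 : IndepFun Y Z P) :
    IndepFun (fun ω => (U ω, Y ω)) Z P := by
  have := Measure.isProbabilityMeasure_map (μ := P) hU.aemeasurable
  have := Measure.isProbabilityMeasure_map (μ := P) hY.aemeasurable
  have := Measure.isProbabilityMeasure_map (μ := P) hZ.aemeasurable
  have h3 : IndepFun U Y P := h1.comp measurable_id measurable_fst
  rw [indepFun_iff_map_prod_eq_prod_map_map (hU.prodMk hY).aemeasurable hZ.aemeasurable,
    (indepFun_iff_map_prod_eq_prod_map_map hU.aemeasurable hY.aemeasurable).1 h3,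
    ← MeasurableEquiv.prodAssoc.map_measurableEquiv_injective.eq_iff, Measure.prodAssoc_prod,
    ← (indepFun_iff_map_prod_eq_prod_map_map hY.aemeasurable hZ.aemeasurable).1 h2,
    ← (indepFun_iff_map_prod_eq_prod_map_map hU.aemeasurable (hY.prodMk hZ).aemeasurable).1 h1,
    Measure.map_map (by fun_prop) (by fun_prop)]
  rfl

lemma indepFun_restrict_of_disjoint {f : ℕ → Ω → ℝ} (hf : ∀ n, Measurable (f n))
    (h : iIndepFun f P) {A B : Set ℕ} (hAB : Disjoint A B) :
    IndepFun (fun ω (i : A) => f i ω) (fun ω (i : B) => f i ω) P := by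
  rw [IndepFun_iff_Indep]
  have h1 := indep_iSup_of_disjoint (m := fun i => MeasurableSpace.comap (f i) inferInstance)
    (fun i => (hf i).comap_le) h.iIndep hAB
  refine indep_of_indep_of_le h1 ?_ ?_
  all_goals
    refine Measurable.comap_le ?_
    refine @measurable_pi_lambda _ _ _ (_) _ _ fun i => ?_
    exact Measurable.mono (comap_measurable (f i))
      (le_iSup₂ (f := fun (i : ℕ) _ => MeasurableSpace.comap (f i) inferInstance) _ i.2) le_rfl

end Independence

namespace MG1Queue

variable {Ω : Type*} [MeasurableSpace Ω] {P : Measure Ω} {lam : ℝ} {G : Measure ℝ}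

@[fun_prop]
lemma measurable_arrivalSum (X : MG1Queue P lam G) (n : ℕ) : Measurable (X.arrivalSum n) :=
  Finset.measurable_sum _ fun i _ => X.measurable_interarrival i

lemma measurable_interarrivals (X : MG1Queue P lam G) :
    Measurable fun ω (n : ℕ) => X.interarrival n ω :=
  measurable_pi_lambda _ X.measurable_interarrival

lemma measurable_services (X : MG1Queue P lam G) : Measurable fun ω (n : ℕ) => X.service n ω :=
  measurable_pi_lambda _ X.measurable_service

lemma measurable_start (X : MG1Queue P lam G) :
    Measurable fun ω => (X.initial ω, X.residual ω) :=
  X.measurable_initial.prodMk X.measurable_residual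

@[fun_prop]
lemma measurable_clearTime (X : MG1Queue P lam G) (n : ℕ) : Measurable (X.clearTime n) :=
  (measurable_clearTimeOf n).comp
    (X.measurable_start.prodMk (X.measurable_interarrivals.prodMk X.measurable_services))

@[fun_prop]
lemma measurable_initialWork (X : MG1Queue P lam G) : Measurable X.initialWork :=
  X.measurable_clearTime 0

variable [IsProbabilityMeasure P]

/-- The interarrival times are independent of the initial state and the services. -/
lemma indepFun_start_service_interarrival (X : MG1Queue P lam G) :
    IndepFun (fun ω => ((X.initial ω, X.residual ω), fun n => X.service n ω))
      (fun ω n => X.interarrival n ω) P :=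
  indepFun_assoc X.measurable_start X.measurable_services X.measurable_interarrivals
    (X.indep_start.comp measurable_id (measurable_snd.prodMk measurable_fst))
    X.indep_interarrival_service.symm

/-- The first `n` interarrival times, the services and the initial state are independent of the
later interarrival times. -/
lemma indepFun_past_interarrival (X : MG1Queue P lam G) (n : ℕ) :
    IndepFun (fun ω => ((X.initial ω, X.residual ω), (fun k => X.service k ω),
      fun i : Set.Iio n => X.interarrival i ω))
      (fun ω (i : Set.Ici n) => X.interarrival i ω) P := by
  have h0 := indepFun_restrict_of_disjoint X.measurable_interarrival X.iIndep_interarrival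
    (A := Set.Iio n) (B := Set.Ici n) (Set.Iio_disjoint_Ici le_rfl)
  have hm : ∀ A : Set ℕ, Measurable fun (x : ℕ → ℝ) (i : A) => x i := fun A =>
    measurable_pi_lambda _ fun i => measurable_pi_apply _
  have hpast := (hm (Set.Iio n)).comp X.measurable_interarrivals
  have hfut := (hm (Set.Ici n)).comp X.measurable_interarrivals
  have h1 := indepFun_assoc (P := P) X.measurable_services hpast hfut
    (X.indep_interarrival_service.symm.comp measurable_id
      ((hm (Set.Iio n)).prodMk (hm (Set.Ici n)))) h0
  refine indepFun_assoc X.measurable_start (X.measurable_services.prodMk hpast) hfut ?_ h1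
  exact X.indep_start.comp measurable_id
    ((measurable_snd.prodMk ((hm (Set.Iio n)).comp measurable_fst)).prodMk
      ((hm (Set.Ici n)).comp measurable_fst))

/-- A service is independent of the initial state, the arrivals and the earlier services. -/
lemma indepFun_past_service (X : MG1Queue P lam G) (k : ℕ) :
    IndepFun (fun ω => ((X.initial ω, X.residual ω), (fun i => X.interarrival i ω),
      fun i : Set.Iio k => X.service i ω)) (X.service k) P := by
  have h0 := (indepFun_restrict_of_disjoint X.measurable_service X.iIndep_service
    (A := Set.Iio k) (B := {k}) (by simp)).comp measurable_id
    (measurable_pi_apply (⟨k, rfl⟩ : ({k} : Set ℕ)))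
  have hm : ∀ A : Set ℕ, Measurable fun (x : ℕ → ℝ) (i : A) => x i := fun A =>
    measurable_pi_lambda _ fun i => measurable_pi_apply _
  have hpast := (hm (Set.Iio k)).comp X.measurable_services
  have h1 := indepFun_assoc (P := P) X.measurable_interarrivals hpast (X.measurable_service k)
    (X.indep_interarrival_service.comp measurable_id
      ((hm (Set.Iio k)).prodMk (measurable_pi_apply k))) h0
  refine indepFun_assoc X.measurable_start (X.measurable_interarrivals.prodMk hpast)
    (X.measurable_service k) ?_ h1
  exact X.indep_start.comp measurable_id
    ((measurable_fst.prodMk ((hm (Set.Iio k)).comp measurable_snd)).prodMk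
      ((measurable_pi_apply k).comp measurable_snd))

/-- Extension of a vector of reals, indexed by a set of natural numbers, by `0`. -/
noncomputable def zeroExtend {A : Set ℕ} [DecidablePred (· ∈ A)] (x : A → ℝ) (i : ℕ) : ℝ :=
  if h : i ∈ A then x ⟨i, h⟩ else 0

@[fun_prop]
lemma measurable_zeroExtend {A : Set ℕ} [DecidablePred (· ∈ A)] :
    Measurable (zeroExtend : (A → ℝ) → ℕ → ℝ) := by
  refine measurable_pi_lambda _ fun i => ?_
  by_cases h : i ∈ A
  · simpa [zeroExtend, h] using measurable_pi_apply _
  · simp [zeroExtend, h]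

/-- The arrivals after the `n`-th one are independent of what has happened by then. -/
lemma indepFun_clearTime_interarrival (X : MG1Queue P lam G) (n : ℕ) :
    IndepFun (fun ω => (X.arrivalSum n ω, X.clearTime n ω))
      (fun ω i => X.interarrival (n + i) ω) P := by
  have h := (X.indepFun_past_interarrival n).comp
    (φ := fun p : (ℕ × ℝ) × (ℕ → ℝ) × (Set.Iio n → ℝ) =>
      (∑ i ∈ Finset.range n, zeroExtend p.2.2 i,
        clearTimeOf p.1.1 p.1.2 (zeroExtend p.2.2) p.2.1 n))
    (ψ := fun (x : Set.Ici n → ℝ) (i : ℕ) => x ⟨n + i, by simp⟩)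
    (Measurable.prodMk (Finset.measurable_sum _ fun i _ => by fun_prop)
      ((measurable_clearTimeOf n).comp (by fun_prop : Measurable
        fun p : (ℕ × ℝ) × (ℕ → ℝ) × (Set.Iio n → ℝ) => (p.1, zeroExtend p.2.2, p.2.1))))
    (measurable_pi_lambda _ fun i => measurable_pi_apply _)
  have he : ∀ ω, ∀ i < n, zeroExtend (fun i : Set.Iio n => X.interarrival i ω) i
      = X.interarrival i ω := fun ω i hi => by simp [zeroExtend, hi]
  convert! h using 1
  ext ω
  · exact Finset.sum_congr rfl fun i hi => (he ω i (Finset.mem_range.1 hi)).symm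
  · exact clearTimeOf_congr (fun i hi => (he ω i hi).symm) fun k _ => rfl

/-- The service of the `n`-th arriving customer has law `G` and does not depend on the past,
although its number `X.initial ω + n` is random. -/
lemma lintegral_mul_service (X : MG1Queue P lam G) (n : ℕ) {y : ℝ × ℝ → ENNReal}
    (hy : Measurable y) {φ : ℝ → ENNReal} (hφ : Measurable φ) :
    ∫⁻ ω, y (X.arrivalSum (n + 1) ω, X.clearTime n ω) * φ (X.service (X.initial ω + n) ω) ∂P
      = (∫⁻ ω, y (X.arrivalSum (n + 1) ω, X.clearTime n ω) ∂P) * ∫⁻ x, φ x ∂G := by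
  have hset : ∀ m, MeasurableSet (X.initial ⁻¹' {m}) := fun m =>
    X.measurable_initial (measurableSet_singleton m)
  have hdisj : Pairwise (Function.onFun Disjoint fun m => X.initial ⁻¹' {m}) := by
    intro i j hij
    exact Disjoint.preimage _ (by simpa using hij)
  have hcover : ⋃ m, X.initial ⁻¹' {m} = Set.univ := by ext ω; simp
  have hsplit : ∀ f : Ω → ENNReal, ∫⁻ ω, f ω ∂P = ∑' m, ∫⁻ ω in X.initial ⁻¹' {m}, f ω ∂P := by
    intro f
    rw [← lintegral_iUnion hset hdisj, hcover, setLIntegral_univ]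
  rw [hsplit, hsplit, ← ENNReal.tsum_mul_right]
  refine tsum_congr fun m => ?_
  -- on the event `initial = m` the past is determined by the services with number below `m + n`
  let W : (ℕ × ℝ) × (ℕ → ℝ) × (Set.Iio (m + n) → ℝ) → ENNReal := fun p =>
    ({m} : Set ℕ).indicator 1 p.1.1 * y (∑ i ∈ Finset.range (n + 1), p.2.1 i,
      clearTimeOf m p.1.2 p.2.1 (zeroExtend p.2.2) n)
  have hWm : Measurable W := by
    refine Measurable.mul ?_ (hy.comp (Measurable.prodMk (by fun_prop)
      ((measurable_clearTimeOf n).comp (by fun_prop : Measurable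
        fun p : (ℕ × ℝ) × (ℕ → ℝ) × (Set.Iio (m + n) → ℝ) =>
          ((m, p.1.2), p.2.1, zeroExtend p.2.2)))))
    exact (measurable_one.indicator (measurableSet_singleton m)).comp (by fun_prop)
  have hW : ∀ ω, W ((X.initial ω, X.residual ω), (fun i => X.interarrival i ω),
      fun i : Set.Iio (m + n) => X.service i ω)
      = (X.initial ⁻¹' {m}).indicator
        (fun ω => y (X.arrivalSum (n + 1) ω, X.clearTime n ω)) ω := by
    intro ω
    by_cases hω : X.initial ω = m
    · rw [Set.indicator_of_mem (by exact hω)]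
      simp only [W, hω, Set.mem_singleton_iff, Set.indicator_of_mem, Pi.one_apply, one_mul]
      congr 2
      rw [clearTime, hω]
      exact clearTimeOf_congr (fun i _ => rfl) fun k hk => by simp [zeroExtend, hk]
    · rw [Set.indicator_of_notMem (by exact hω)]
      simp [W, hω]
  have hind := (X.indepFun_past_service (m + n)).comp hWm hφ
  have hprod := lintegral_mul_eq_lintegral_mul_lintegral_of_indepFun
    (hWm.comp (X.measurable_start.prodMk (X.measurable_interarrivals.prodMk
      (measurable_pi_lambda _ fun i => X.measurable_service _))))
    (hφ.comp (X.measurable_service (m + n))) hind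
  have h1 : ∫⁻ ω in X.initial ⁻¹' {m}, y (X.arrivalSum (n + 1) ω, X.clearTime n ω) *
      φ (X.service (X.initial ω + n) ω) ∂P
      = ∫⁻ ω, (X.initial ⁻¹' {m}).indicator
        (fun ω => y (X.arrivalSum (n + 1) ω, X.clearTime n ω)) ω * φ (X.service (m + n) ω) ∂P := by
    rw [← lintegral_indicator (hset m)]
    refine lintegral_congr fun ω => ?_
    by_cases hω : X.initial ω = m
    · rw [Set.indicator_of_mem (by exact hω), Set.indicator_of_mem (by exact hω), hω]
    · rw [Set.indicator_of_notMem (by exact hω), Set.indicator_of_notMem (by exact hω), zero_mul]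
  have h2 : ∫⁻ x, φ x ∂G = ∫⁻ ω, φ (X.service (m + n) ω) ∂P := by
    rw [← lintegral_map (μ := P) hφ (X.measurable_service (m + n)), X.law_service]
  rw [h1, ← lintegral_indicator (hset m), h2]
  simp_rw [← hW]
  exact hprod

end MG1Queue

/-! ### Moments of the arrival and departure counts -/

namespace MG1Queue

variable {Ω : Type*} [MeasurableSpace Ω] {P : Measure Ω} {lam : ℝ}
  {G : Measure ℝ}

lemma measurable_arrivalCount_interarrival (X : MG1Queue P lam G) (t : ℝ) :
    Measurable fun ω => arrivalCount (fun n => X.interarrival n ω) t :=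
  measurable_arrivalCount.comp (measurable_const.prodMk X.measurable_interarrivals)

lemma aestronglyMeasurable_of_natCast_ae_eq {N : Ω → ℕ} {f : Ω → ENNReal} (hf : Measurable f)
    (h : ∀ᵐ ω ∂P, (N ω : ENNReal) = f ω) : AEStronglyMeasurable (fun ω => (N ω : ℝ)) P := by
  refine hf.ennreal_toReal.aestronglyMeasurable.congr ?_
  filter_upwards [h] with ω hω
  rw [← hω]; simp

lemma IsRegular.setOf_arrivalTime_le {X : MG1Queue P lam G} {ω : Ω} (h : X.IsRegular ω) {t : ℝ}
    (hfin : {n : ℕ | X.arrivalTime n ω ≤ t}.Finite) :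
    {n : ℕ | X.arrivalTime n ω ≤ t} = Set.Iio (X.arrivals t ω) := by
  have hex : ∃ m, ¬ X.arrivalTime m ω ≤ t := by
    by_contra! hcon
    exact Set.infinite_univ (hfin.subset fun n _ => hcon n)
  classical
  have h1 : {n : ℕ | X.arrivalTime n ω ≤ t} = Set.Iio (Nat.find hex) := by
    ext n
    simp only [Set.mem_ofPred_eq, Set.mem_Iio, Nat.lt_find_iff, not_not]
    exact ⟨fun hn m hm => (h.monotone_arrivalSum (Nat.succ_le_succ hm)).trans hn,
      fun hn => hn n le_rfl⟩
  have h2 : X.arrivals t ω = Nat.find hex := by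
    rw [arrivals, h1]; simp [Set.ncard_eq_toFinset_card']
  rw [h1, h2]

variable [IsProbabilityMeasure P]

lemma ae_finite_arrivalTime_le (hlam : 0 < lam) (X : MG1Queue P lam G) (t : ℝ) :
    ∀ᵐ ω ∂P, {n : ℕ | X.arrivalTime n ω ≤ t}.Finite := by
  have h := lintegral_arrivalCount hlam X.measurable_interarrival X.law_interarrival
    X.iIndep_interarrival t
  filter_upwards [ae_lt_top (X.measurable_arrivalCount_interarrival t)
    (by rw [h]; exact ENNReal.ofReal_ne_top)] with ω hω
  exact finite_of_arrivalCount_ne_top hω.ne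

lemma ae_arrivals_eq (hlam : 0 < lam) (X : MG1Queue P lam G) (t : ℝ) :
    ∀ᵐ ω ∂P, (X.arrivals t ω : ENNReal) = arrivalCount (fun n => X.interarrival n ω) t := by
  filter_upwards [X.ae_finite_arrivalTime_le hlam t] with ω hω
  exact arrivals_eq_arrivalCount hω

lemma aestronglyMeasurable_arrivals (hlam : 0 < lam) (X : MG1Queue P lam G) (t : ℝ) :
    AEStronglyMeasurable (fun ω => (X.arrivals t ω : ℝ)) P :=
  aestronglyMeasurable_of_natCast_ae_eq (X.measurable_arrivalCount_interarrival t)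
    (X.ae_arrivals_eq hlam t)

lemma integral_arrivals (hlam : 0 < lam) (X : MG1Queue P lam G) {t : ℝ} (ht : 0 ≤ t) :
    ∫ ω, (X.arrivals t ω : ℝ) ∂P = lam * t := by
  rw [integral_eq_lintegral_of_nonneg_ae (ae_of_all _ fun ω => Nat.cast_nonneg _)
    (X.aestronglyMeasurable_arrivals hlam t)]
  simp_rw [ENNReal.ofReal_natCast]
  rw [lintegral_congr_ae (X.ae_arrivals_eq hlam t), lintegral_arrivalCount hlam
    X.measurable_interarrival X.law_interarrival X.iIndep_interarrival,
    ENNReal.toReal_ofReal (by positivity)]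

/-- The second moment of the Poisson variable `A(t)`, from `a ^ 2 = 2 * ∑ n < a, n + a`. -/
lemma lintegral_arrivals_sq (hlam : 0 < lam) (hG_nonneg : ∀ᵐ x ∂G, 0 ≤ x)
    (X : MG1Queue P lam G) {t : ℝ} (ht : 0 ≤ t) :
    ∫⁻ ω, (X.arrivals t ω : ENNReal) ^ 2 ∂P = ENNReal.ofReal (lam ^ 2 * t ^ 2 + lam * t) := by
  have h1 : ∀ᵐ ω ∂P, (X.arrivals t ω : ENNReal) ^ 2 = 2 * (∑' n : ℕ, (n : ENNReal) *
      (Set.Iic t).indicator 1 (∑ i ∈ Finset.range (n + 1), X.interarrival i ω))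
      + arrivalCount (fun n => X.interarrival n ω) t := by
    filter_upwards [X.ae_finite_arrivalTime_le hlam t, X.ae_isRegular hG_nonneg] with ω hω hreg
    rw [← arrivals_eq_arrivalCount hω]
    have hset := hreg.setOf_arrivalTime_le hω
    have : ∑' n : ℕ, (n : ENNReal) *
        (Set.Iic t).indicator 1 (∑ i ∈ Finset.range (n + 1), X.interarrival i ω)
        = ∑ n ∈ Finset.range (X.arrivals t ω), (n : ENNReal) := by
      have h2 : ∀ n : ℕ, (∑ i ∈ Finset.range (n + 1), X.interarrival i ω ∈ Set.Iic t) ↔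
          n ∈ Finset.range (X.arrivals t ω) := fun n => by
        rw [Finset.mem_range]
        exact Set.ext_iff.1 hset n
      rw [tsum_eq_sum (s := Finset.range (X.arrivals t ω))]
      · refine Finset.sum_congr rfl fun n hn => ?_
        rw [Set.indicator_of_mem ((h2 n).2 hn), Pi.one_apply, mul_one]
      · intro n hn
        rw [Set.indicator_of_notMem (fun hc => hn ((h2 n).1 hc)), mul_zero]
    rw [this, ← Nat.cast_sum]
    have h3 := Finset.sum_range_id_mul_two (X.arrivals t ω)
    norm_cast
    rw [mul_comm, h3]
    generalize X.arrivals t ω = a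
    cases a with
    | zero => rfl
    | succ a => simp only [Nat.add_sub_cancel]; ring
  have hm : Measurable fun ω => ∑' n : ℕ, (n : ENNReal) *
      (Set.Iic t).indicator (1 : ℝ → ENNReal)
        (∑ i ∈ Finset.range (n + 1), X.interarrival i ω) :=
    Measurable.tsum fun n => ((measurable_one.indicator measurableSet_Iic).comp
      (X.measurable_arrivalSum (n + 1))).const_mul _
  rw [lintegral_congr_ae h1, lintegral_add_left (hm.const_mul _), lintegral_const_mul _ hm,
    lintegral_tsum_mul_arrival hlam X.measurable_interarrival X.law_interarrival
      X.iIndep_interarrival ht,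
    lintegral_arrivalCount hlam X.measurable_interarrival X.law_interarrival
      X.iIndep_interarrival]
  have : (2 : ENNReal) = ENNReal.ofReal 2 := by simp
  rw [this, ← ENNReal.ofReal_mul (by norm_num),
    ← ENNReal.ofReal_add (by positivity) (by positivity)]
  congr 1; ring

lemma memLp_arrivals (hlam : 0 < lam) (hG_nonneg : ∀ᵐ x ∂G, 0 ≤ x) (X : MG1Queue P lam G)
    {t : ℝ} (ht : 0 ≤ t) : MemLp (fun ω => (X.arrivals t ω : ℝ)) 2 P := by
  rw [memLp_two_iff_integrable_sq (X.aestronglyMeasurable_arrivals hlam t)]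
  refine ⟨(X.aestronglyMeasurable_arrivals hlam t).pow 2, ?_⟩
  rw [hasFiniteIntegral_iff_ofReal (ae_of_all _ fun ω => sq_nonneg _)]
  simp_rw [ENNReal.ofReal_pow (Nat.cast_nonneg _), ENNReal.ofReal_natCast]
  rw [X.lintegral_arrivals_sq hlam hG_nonneg ht]
  exact ENNReal.ofReal_lt_top

lemma variance_arrivals (hlam : 0 < lam) (hG_nonneg : ∀ᵐ x ∂G, 0 ≤ x) (X : MG1Queue P lam G)
    {t : ℝ} (ht : 0 ≤ t) : variance (fun ω => (X.arrivals t ω : ℝ)) P = lam * t := by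
  rw [variance_eq_sub (X.memLp_arrivals hlam hG_nonneg ht), X.integral_arrivals hlam ht]
  have : ∫ ω, (X.arrivals t ω : ℝ) ^ 2 ∂P = lam ^ 2 * t ^ 2 + lam * t := by
    rw [integral_eq_lintegral_of_nonneg_ae (ae_of_all _ fun ω => sq_nonneg _)
      ((X.aestronglyMeasurable_arrivals hlam t).pow 2)]
    simp_rw [ENNReal.ofReal_pow (Nat.cast_nonneg _), ENNReal.ofReal_natCast]
    rw [X.lintegral_arrivals_sq hlam hG_nonneg ht, ENNReal.toReal_ofReal (by positivity)]
  simp only [Pi.pow_apply]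
  rw [this]; ring

/-- The compensated arrival process is a martingale: the event `X.clearTime n ≤ t` does not depend
on the arrivals after the epoch `X.arrivalSum n`, whose mean number up to time `t` is
`lam * (t - X.arrivalSum n)`. -/
lemma integral_arrivals_mul_indicator (hlam : 0 < lam) (hG_nonneg : ∀ᵐ x ∂G, 0 ≤ x)
    (X : MG1Queue P lam G) {t : ℝ} (n : ℕ) :
    ∫ ω, (X.arrivals t ω : ℝ) * {ω | X.clearTime n ω ≤ t}.indicator 1 ω ∂P =
      ∫ ω, (n + lam * (t - X.arrivalSum n ω)) * {ω | X.clearTime n ω ≤ t}.indicator 1 ω ∂P := by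
  have hset : MeasurableSet {ω | X.clearTime n ω ≤ t} :=
    measurableSet_le (X.measurable_clearTime n) measurable_const
  have hone : AEStronglyMeasurable ({ω | X.clearTime n ω ≤ t}.indicator (1 : Ω → ℝ)) P :=
    (measurable_one.indicator hset).aestronglyMeasurable
  have hreg := X.ae_isRegular hG_nonneg
  have hnn : ∀ ω, 0 ≤ {ω | X.clearTime n ω ≤ t}.indicator (1 : Ω → ℝ) ω :=
    Set.indicator_nonneg fun ω _ => zero_le_one
  have hnn2 : ∀ᵐ ω ∂P, 0 ≤ (n + lam * (t - X.arrivalSum n ω)) *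
      {ω | X.clearTime n ω ≤ t}.indicator (1 : Ω → ℝ) ω := by
    filter_upwards [hreg] with ω hω
    by_cases h : X.clearTime n ω ≤ t
    · rw [Set.indicator_of_mem (by exact h)]
      have := (hω.arrivalSum_le_clearTime n).trans h
      simp only [Pi.one_apply, mul_one]
      have : 0 ≤ t - X.arrivalSum n ω := by linarith
      positivity
    · rw [Set.indicator_of_notMem (by exact h), mul_zero]
  rw [integral_eq_lintegral_of_nonneg_ae
      (ae_of_all _ fun ω => mul_nonneg (Nat.cast_nonneg _) (hnn ω))
      ((X.aestronglyMeasurable_arrivals hlam t).mul hone),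
    integral_eq_lintegral_of_nonneg_ae hnn2
      (AEStronglyMeasurable.mul (by fun_prop) hone)]
  congr 1
  set shift : Ω → ℕ → ℝ := fun ω i => X.interarrival (n + i) ω
  set g : ℝ × ℝ → ENNReal := {p : ℝ × ℝ | p.2 ≤ t}.indicator 1 with hg
  have hgm : Measurable g :=
    measurable_one.indicator (measurableSet_le measurable_snd measurable_const)
  have h1 : ∀ᵐ ω ∂P, ENNReal.ofReal ((X.arrivals t ω : ℝ) *
      {ω | X.clearTime n ω ≤ t}.indicator 1 ω)
      = g (X.arrivalSum n ω, X.clearTime n ω) *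
        (n + arrivalCount (shift ω) (t - X.arrivalSum n ω)) := by
    filter_upwards [hreg, X.ae_arrivals_eq hlam t] with ω hω hA
    by_cases h : X.clearTime n ω ≤ t
    · rw [Set.indicator_of_mem (by exact h), hg, Set.indicator_of_mem (by exact h)]
      simp only [Pi.one_apply, mul_one, one_mul, ENNReal.ofReal_natCast]
      rw [hA, arrivalCount, ← ENNReal.summable.sum_add_tsum_nat_add' (k := n)]
      have hT := (hω.arrivalSum_le_clearTime n).trans h
      congr 1
      · rw [Finset.sum_congr rfl (g := fun _ => 1)]
        · simp
        · intro i hi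
          rw [Set.indicator_of_mem, Pi.one_apply]
          exact (hω.monotone_arrivalSum (Nat.succ_le_of_lt (Finset.mem_range.1 hi))).trans hT
      · unfold arrivalCount
        refine tsum_congr fun j => ?_
        have : ∑ i ∈ Finset.range (j + n + 1), X.interarrival i ω
            = X.arrivalSum n ω + ∑ i ∈ Finset.range (j + 1), shift ω i := by
          rw [arrivalSum, show j + n + 1 = n + (j + 1) by ring, Finset.sum_range_add]
        rw [this]
        simp only [Set.indicator, Set.mem_Iic, le_sub_iff_add_le', Pi.one_apply]
    · rw [Set.indicator_of_notMem (by exact h), hg, Set.indicator_of_notMem (by exact h)]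
      simp
  have h2 : ∀ᵐ ω ∂P, ENNReal.ofReal ((n + lam * (t - X.arrivalSum n ω)) *
      {ω | X.clearTime n ω ≤ t}.indicator 1 ω)
      = g (X.arrivalSum n ω, X.clearTime n ω) *
        (n + ENNReal.ofReal (lam * (t - X.arrivalSum n ω))) := by
    filter_upwards [hreg] with ω hω
    by_cases h : X.clearTime n ω ≤ t
    · rw [Set.indicator_of_mem (by exact h), hg, Set.indicator_of_mem (by exact h)]
      have := (hω.arrivalSum_le_clearTime n).trans h
      have : 0 ≤ t - X.arrivalSum n ω := by linarith
      rw [Pi.one_apply, Pi.one_apply, mul_one, one_mul, ENNReal.ofReal_add (by positivity)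
        (by positivity), ENNReal.ofReal_natCast]
    · rw [Set.indicator_of_notMem (by exact h), hg, Set.indicator_of_notMem (by exact h)]
      simp
  have hsm : Measurable shift := measurable_pi_lambda _ fun i => X.measurable_interarrival _
  rw [lintegral_congr_ae h1, lintegral_congr_ae h2,
    lintegral_of_indepFun (f := fun p x => g p * (n + arrivalCount x (t - p.1)))
      (X.indepFun_clearTime_interarrival n) (by fun_prop) hsm]
  · refine lintegral_congr fun ω => ?_
    have hm : Measurable fun ω' => arrivalCount (shift ω') (t - X.arrivalSum n ω) :=
      measurable_arrivalCount.comp (measurable_const.prodMk hsm)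
    rw [lintegral_const_mul _ (hm.const_add _), lintegral_add_left measurable_const,
      lintegral_const, measure_univ, mul_one]
    congr 2
    exact lintegral_arrivalCount hlam (fun i => X.measurable_interarrival _)
      (fun i => X.law_interarrival _) (X.iIndep_interarrival.precomp (add_right_injective n)) _
  · exact (hgm.comp measurable_fst).mul ((measurable_arrivalCount.comp
      (((measurable_fst.comp measurable_fst).const_sub t).prodMk measurable_snd)).const_add _)

end MG1Queue

/-! ### The covariance of arrivals and departures -/

namespace MG1Queue

variable {Ω : Type*} [MeasurableSpace Ω] {P : Measure Ω} {lam : ℝ} {G : Measure ℝ}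

/-- The contribution to `Cov(A(t), D(t))` of the departure at the epoch `X.clearTime n`. -/
noncomputable def covTerm (X : MG1Queue P lam G) (n : ℕ) (t : ℝ) : ℝ :=
  ∫ ω, (n - lam * X.arrivalSum n ω) * {ω | X.clearTime n ω ≤ t}.indicator 1 ω ∂P

/-- The number of initial customers who have left by time `t`. -/
noncomputable def initialDepartures (X : MG1Queue P lam G) (t : ℝ) (ω : Ω) : ENNReal :=
  ∑' k : ℕ, {k | k < X.initial ω ∧
    X.residual ω + ∑ j ∈ Finset.Ico 1 (k + 1), X.service j ω ≤ t}.indicator 1 k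

/-- The number of customers who have arrived after time `0` and have left by time `t`. -/
noncomputable def laterDepartures (X : MG1Queue P lam G) (t : ℝ) (ω : Ω) : ENNReal :=
  ∑' n : ℕ, {n | X.clearTime (n + 1) ω ≤ t}.indicator 1 n

lemma measurable_laterDepartures (X : MG1Queue P lam G) (t : ℝ) :
    Measurable (X.laterDepartures t) := by
  refine Measurable.tsum fun n => ?_
  have : (fun ω => {n | X.clearTime (n + 1) ω ≤ t}.indicator (1 : ℕ → ENNReal) n)
      = {ω | X.clearTime (n + 1) ω ≤ t}.indicator 1 := by
    ext ω; simp [Set.indicator]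
  rw [this]
  exact measurable_one.indicator (measurableSet_le (X.measurable_clearTime _) measurable_const)

/-- `X.initialDepartures t` as a function of the initial state and the services. -/
lemma exists_measurable_initialDepartures (X : MG1Queue P lam G) (t : ℝ) :
    ∃ f : (ℕ × ℝ) × (ℕ → ℝ) → ENNReal, Measurable f ∧ ∀ ω, X.initialDepartures t ω
      = f ((X.initial ω, X.residual ω), fun n => X.service n ω) := by
  refine ⟨fun p => ∑' k : ℕ, {p : (ℕ × ℝ) × (ℕ → ℝ) | k < p.1.1 ∧
    p.1.2 + ∑ j ∈ Finset.Ico 1 (k + 1), p.2 j ≤ t}.indicator 1 p, ?_, fun ω => ?_⟩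
  · refine Measurable.tsum fun k => measurable_one.indicator ?_
    have h : Measurable fun p : (ℕ × ℝ) × (ℕ → ℝ) =>
        p.1.2 + ∑ j ∈ Finset.Ico 1 (k + 1), p.2 j := by fun_prop
    exact (measurableSet_lt measurable_const (measurable_fst.comp measurable_fst)).inter
      (measurableSet_le h measurable_const)
  · exact tsum_congr fun k => by simp [Set.indicator]

lemma measurable_initialDepartures (X : MG1Queue P lam G) (t : ℝ) :
    Measurable (X.initialDepartures t) := by
  obtain ⟨f, hf, hfX⟩ := X.exists_measurable_initialDepartures t
  rw [show X.initialDepartures t = _ from funext hfX]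
  exact hf.comp (X.measurable_start.prodMk X.measurable_services)

lemma memLp_initial (hG_nonneg : ∀ᵐ x ∂G, 0 ≤ x) (X : MG1Queue P lam G)
    (hQ0 : MemLp (fun ω => (X.queueLength 0 ω : ℝ)) 2 P) :
    MemLp (fun ω => (X.initial ω : ℝ)) 2 P := by
  refine hQ0.ae_eq ?_
  filter_upwards [X.ae_isRegular hG_nonneg] with ω hω
  rw [hω.queueLength_zero]

variable [IsProbabilityMeasure P]

lemma ae_departures_eq (hlam : 0 < lam) (hG_nonneg : ∀ᵐ x ∂G, 0 ≤ x) (X : MG1Queue P lam G)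
    (t : ℝ) : ∀ᵐ ω ∂P, (X.departures t ω : ENNReal)
      = X.initialDepartures t ω + X.laterDepartures t ω := by
  filter_upwards [X.ae_finite_arrivalTime_le hlam t, X.ae_isRegular hG_nonneg] with ω h1 h2
  exact h2.departures_eq h1

lemma ae_balance (hlam : 0 < lam) (hG_nonneg : ∀ᵐ x ∂G, 0 ≤ x) (X : MG1Queue P lam G)
    {t : ℝ} (ht : 0 ≤ t) : ∀ᵐ ω ∂P, (X.queueLength t ω : ℝ) + X.departures t ω
      = X.queueLength 0 ω + X.arrivals t ω := by
  filter_upwards [X.ae_finite_arrivalTime_le hlam t, X.ae_isRegular hG_nonneg] with ω h1 h2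
  rw [h2.queueLength_zero]
  exact_mod_cast h2.queueLength_add_departures ht h1

lemma memLp_departures (hlam : 0 < lam) (hG_nonneg : ∀ᵐ x ∂G, 0 ≤ x) (X : MG1Queue P lam G)
    (hQ0 : MemLp (fun ω => (X.queueLength 0 ω : ℝ)) 2 P) {t : ℝ} (ht : 0 ≤ t) :
    MemLp (fun ω => (X.departures t ω : ℝ)) 2 P := by
  refine MemLp.mono' (hQ0.add (X.memLp_arrivals hlam hG_nonneg ht))
    (aestronglyMeasurable_of_natCast_ae_eq ((X.measurable_initialDepartures t).add
      (X.measurable_laterDepartures t)) (X.ae_departures_eq hlam hG_nonneg t)) ?_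
  filter_upwards [X.ae_balance hlam hG_nonneg ht] with ω hω
  rw [Real.norm_of_nonneg (Nat.cast_nonneg _), Pi.add_apply, ← hω]
  linarith [(Nat.cast_nonneg (X.queueLength t ω) : (0 : ℝ) ≤ _)]

lemma memLp_queueLength (hlam : 0 < lam) (hG_nonneg : ∀ᵐ x ∂G, 0 ≤ x) (X : MG1Queue P lam G)
    (hQ0 : MemLp (fun ω => (X.queueLength 0 ω : ℝ)) 2 P) {t : ℝ} (ht : 0 ≤ t) :
    MemLp (fun ω => (X.queueLength t ω : ℝ)) 2 P := by
  refine ((hQ0.add (X.memLp_arrivals hlam hG_nonneg ht)).sub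
    (X.memLp_departures hlam hG_nonneg hQ0 ht)).ae_eq ?_
  filter_upwards [X.ae_balance hlam hG_nonneg ht] with ω hω
  simp only [Pi.sub_apply, Pi.add_apply]
  linarith

lemma integral_arrivals_sub_mul_indicator (hlam : 0 < lam) (hG_nonneg : ∀ᵐ x ∂G, 0 ≤ x)
    (X : MG1Queue P lam G) {t : ℝ} (ht : 0 ≤ t) (n : ℕ) :
    ∫ ω, ((X.arrivals t ω : ℝ) - lam * t) * {ω | X.clearTime n ω ≤ t}.indicator 1 ω ∂P
      = X.covTerm n t := by
  have hset : MeasurableSet {ω | X.clearTime n ω ≤ t} :=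
    measurableSet_le (X.measurable_clearTime n) measurable_const
  have hA := (X.memLp_arrivals hlam hG_nonneg ht).integrable one_le_two
  have hind : ∀ f : Ω → ℝ, (fun ω => f ω * {ω | X.clearTime n ω ≤ t}.indicator 1 ω)
      = {ω | X.clearTime n ω ≤ t}.indicator f := fun f => by
    ext ω; simp [Set.indicator]
  have i1 : Integrable (fun ω => (X.arrivals t ω : ℝ) *
      {ω | X.clearTime n ω ≤ t}.indicator 1 ω) P := by
    rw [hind]; exact hA.indicator hset
  have i2 : Integrable (fun ω => lam * t * {ω | X.clearTime n ω ≤ t}.indicator 1 ω) P := by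
    rw [hind]; exact (integrable_const _).indicator hset
  have i3 : Integrable (fun ω => (n + lam * (t - X.arrivalSum n ω)) *
      {ω | X.clearTime n ω ≤ t}.indicator 1 ω) P := by
    refine Integrable.mono' (integrable_const (n + lam * t)) (AEStronglyMeasurable.mul
      (by fun_prop) (measurable_one.indicator hset).aestronglyMeasurable) ?_
    filter_upwards [X.ae_isRegular hG_nonneg] with ω hω
    by_cases h : X.clearTime n ω ≤ t
    · rw [Set.indicator_of_mem (by exact h), Pi.one_apply, mul_one]
      have h1 := (hω.arrivalSum_le_clearTime n).trans h
      have h2 := hω.arrivalSum_nonneg n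
      have h3 : 0 ≤ lam * (t - X.arrivalSum n ω) := mul_nonneg hlam.le (by linarith)
      rw [Real.norm_of_nonneg (by positivity)]
      nlinarith
    · rw [Set.indicator_of_notMem (by exact h), mul_zero, norm_zero]
      positivity
  simp_rw [sub_mul]
  rw [integral_sub i1 i2, X.integral_arrivals_mul_indicator hlam hG_nonneg n,
    ← integral_sub i3 i2, covTerm]
  congr 1 with ω
  ring

/-- `Cov(A(t), D(t))` is the sum of the contributions of the customers who arrive after time
`0`; the departures of the initial customers do not depend on the arrivals. -/
lemma hasSum_covTerm (hlam : 0 < lam) (hG_nonneg : ∀ᵐ x ∂G, 0 ≤ x)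
    (X : MG1Queue P lam G) (hQ0 : MemLp (fun ω => (X.queueLength 0 ω : ℝ)) 2 P)
    {t : ℝ} (ht : 0 ≤ t) : HasSum (fun n => X.covTerm (n + 1) t)
      (covariance (fun ω => (X.arrivals t ω : ℝ)) (fun ω => (X.departures t ω : ℝ)) P) := by
  have hA := X.memLp_arrivals hlam hG_nonneg ht
  have hD := X.memLp_departures hlam hG_nonneg hQ0 ht
  set D0 : Ω → ℝ := fun ω => (X.initialDepartures t ω).toReal with hD0
  set D1 : Ω → ℝ := fun ω => (X.laterDepartures t ω).toReal with hD1
  have hDeq : ∀ᵐ ω ∂P, (X.departures t ω : ℝ) = D0 ω + D1 ω := by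
    filter_upwards [X.ae_departures_eq hlam hG_nonneg t] with ω hω
    have htop : X.initialDepartures t ω + X.laterDepartures t ω ≠ ⊤ := by
      rw [← hω]; exact ENNReal.natCast_ne_top _
    rw [ENNReal.add_ne_top] at htop
    rw [hD0, hD1]
    simp only
    rw [← ENNReal.toReal_add htop.1 htop.2, ← hω, ENNReal.toReal_natCast]
  have hD0L : MemLp D0 2 P := by
    refine MemLp.mono' hD
      (X.measurable_initialDepartures t).ennreal_toReal.aestronglyMeasurable ?_
    filter_upwards [hDeq] with ω hω
    rw [Real.norm_of_nonneg ENNReal.toReal_nonneg, hω]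
    linarith [(ENNReal.toReal_nonneg : 0 ≤ D1 ω)]
  have hD1L : MemLp D1 2 P := by
    refine (hD.sub hD0L).ae_eq ?_
    filter_upwards [hDeq] with ω hω
    simp [hω]
  -- the initial customers
  have hc0 : covariance (fun ω => (X.arrivals t ω : ℝ)) D0 P = 0 := by
    obtain ⟨f, hf, hfX⟩ := X.exists_measurable_initialDepartures t
    have h := (X.indepFun_start_service_interarrival.comp hf.ennreal_toReal
      (measurable_arrivalCount.comp (measurable_const.prodMk measurable_id :
        Measurable fun x : ℕ → ℝ => (t, x))).ennreal_toReal).symm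
    refine IndepFun.covariance_eq_zero (h.congr ?_ ?_) hA hD0L
    · filter_upwards [X.ae_arrivals_eq hlam t] with ω hω
      simp only [Function.comp_apply]
      rw [← hω, ENNReal.toReal_natCast]
    · exact ae_of_all _ fun ω => by simp [hD0, hfX]
  have hc : covariance (fun ω => (X.arrivals t ω : ℝ)) (fun ω => (X.departures t ω : ℝ)) P
      = ∫ ω, ((X.arrivals t ω : ℝ) - lam * t) * D1 ω ∂P := by
    have e1 : covariance (fun ω => (X.arrivals t ω : ℝ)) (fun ω => (X.departures t ω : ℝ)) P
        = covariance (fun ω => (X.arrivals t ω : ℝ)) (D0 + D1) P := by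
      have hi : ∫ ω, (X.departures t ω : ℝ) ∂P = ∫ ω, (D0 + D1) ω ∂P := integral_congr_ae hDeq
      refine integral_congr_ae ?_
      filter_upwards [hDeq] with ω hω
      rw [hi, hω, Pi.add_apply]
    rw [e1, covariance_add_right hA hD0L hD1L, hc0, zero_add, covariance_eq_sub hA hD1L,
      X.integral_arrivals hlam ht]
    simp_rw [sub_mul]
    have i1 : Integrable (fun ω => (X.arrivals t ω : ℝ) * D1 ω) P := hA.integrable_mul hD1L
    rw [integral_sub i1 ((hD1L.integrable one_le_two).const_mul _), integral_const_mul]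
    rfl
  have hsum : ∀ᵐ ω ∂P, HasSum (fun n => {ω | X.clearTime (n + 1) ω ≤ t}.indicator (1 : Ω → ℝ) ω)
      (D1 ω) := by
    filter_upwards [X.ae_departures_eq hlam hG_nonneg t] with ω hω
    have htop : X.initialDepartures t ω + X.laterDepartures t ω ≠ ⊤ := by
      rw [← hω]; exact ENNReal.natCast_ne_top _
    have h1 := ENNReal.hasSum_toReal (ENNReal.add_ne_top.1 htop).2
    rw [← ENNReal.tsum_toReal_eq fun n => by by_cases h : X.clearTime (n + 1) ω ≤ t <;>
      simp [Set.indicator, h]] at h1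
    convert! h1 using 2 with n
    by_cases h : X.clearTime (n + 1) ω ≤ t <;> simp [Set.indicator, h]
  have hAD : Integrable (fun ω => ((X.arrivals t ω : ℝ) - lam * t) * D1 ω) P :=
    (hA.sub (memLp_const (lam * t))).integrable_mul hD1L
  rw [hc]
  simp_rw [← X.integral_arrivals_sub_mul_indicator hlam hG_nonneg ht]
  have hnn : ∀ n ω, 0 ≤ {ω | X.clearTime (n + 1) ω ≤ t}.indicator (1 : Ω → ℝ) ω := fun n =>
    Set.indicator_nonneg fun ω _ => zero_le_one
  refine hasSum_integral_of_dominated_convergence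
    (fun n ω => |(X.arrivals t ω : ℝ) - lam * t| *
      {ω | X.clearTime (n + 1) ω ≤ t}.indicator (1 : Ω → ℝ) ω) (fun n => ?_) (fun n => ?_) ?_ ?_ ?_
  · exact ((X.aestronglyMeasurable_arrivals hlam t).sub aestronglyMeasurable_const).mul
      (measurable_one.indicator (measurableSet_le (X.measurable_clearTime _)
        measurable_const)).aestronglyMeasurable
  · refine ae_of_all _ fun ω => ?_
    rw [norm_mul, Real.norm_eq_abs, Real.norm_of_nonneg (hnn n ω)]
  · filter_upwards [hsum] with ω hω
    exact (hω.mul_left _).summable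
  · refine hAD.norm.congr ?_
    filter_upwards [hsum] with ω hω
    rw [(hω.mul_left _).tsum_eq, norm_mul, Real.norm_eq_abs,
      Real.norm_of_nonneg (ENNReal.toReal_nonneg : 0 ≤ D1 ω)]
  · filter_upwards [hsum] with ω hω
    exact hω.mul_left _

/-- `Cov(A(t), Q(t)) = Var A(t) - Cov(A(t), D(t))`, and the value that the variance of
`D(t) = Q(0) + A(t) - Q(t)` gives to this covariance. -/
lemma covariance_arrivals_queueLength (hlam : 0 < lam) (hG_nonneg : ∀ᵐ x ∂G, 0 ≤ x)
    (X : MG1Queue P lam G) (hQ0 : MemLp (fun ω => (X.queueLength 0 ω : ℝ)) 2 P)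
    {t : ℝ} (ht : 0 ≤ t) :
    covariance (fun ω => (X.arrivals t ω : ℝ)) (fun ω => (X.queueLength t ω : ℝ)) P
      = lam * t - ∑' n, X.covTerm (n + 1) t ∧
    covariance (fun ω => (X.arrivals t ω : ℝ)) (fun ω => (X.queueLength t ω : ℝ)) P
      = (lam * t + variance (fun ω => (X.queueLength 0 ω : ℝ)) P
        + variance (fun ω => (X.queueLength t ω : ℝ)) P
        - 2 * covariance (fun ω => (X.queueLength 0 ω : ℝ)) (fun ω => (X.queueLength t ω : ℝ)) P
        - variance (fun ω => (X.departures t ω : ℝ)) P) / 2 := by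
  have hA := X.memLp_arrivals hlam hG_nonneg ht
  have hD := X.memLp_departures hlam hG_nonneg hQ0 ht
  have hQ := X.memLp_queueLength hlam hG_nonneg hQ0 ht
  have hind : covariance (fun ω => (X.queueLength 0 ω : ℝ)) (fun ω => (X.arrivals t ω : ℝ)) P
      = 0 := by
    have h := X.indepFun_start_service_interarrival.comp
      (φ := fun p : (ℕ × ℝ) × (ℕ → ℝ) => (p.1.1 : ℝ)) (by fun_prop)
      (measurable_arrivalCount.comp (measurable_const.prodMk measurable_id :
        Measurable fun x : ℕ → ℝ => (t, x))).ennreal_toReal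
    refine IndepFun.covariance_eq_zero (h.congr ?_ ?_) hQ0 hA
    · filter_upwards [X.ae_isRegular hG_nonneg] with ω hω
      simp [hω.queueLength_zero]
    · filter_upwards [X.ae_arrivals_eq hlam t] with ω hω
      simp only [Function.comp_apply]
      rw [← hω, ENNReal.toReal_natCast]
  set A : Ω → ℝ := fun ω => (X.arrivals t ω : ℝ)
  set Q : Ω → ℝ := fun ω => (X.queueLength t ω : ℝ)
  set Q0 : Ω → ℝ := fun ω => (X.queueLength 0 ω : ℝ)
  set D : Ω → ℝ := fun ω => (X.departures t ω : ℝ)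
  have hbal : D =ᵐ[P] Q0 + A - Q := by
    filter_upwards [X.ae_balance hlam hG_nonneg ht] with ω hω
    simp only [A, Q, Q0, D, Pi.sub_apply, Pi.add_apply]
    linarith
  have hAD : covariance A D P = variance A P - covariance A Q P := by
    have e1 : covariance A D P = covariance A (Q0 + A - Q) P := by
      refine integral_congr_ae ?_
      filter_upwards [hbal] with ω hω
      rw [integral_congr_ae hbal, hω]
    rw [e1, covariance_sub_right hA (hQ0.add hA) hQ, covariance_add_right hA hQ0 hA,
      covariance_comm A Q0, hind, covariance_self hA.aemeasurable, zero_add]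
  have hAv : variance A P = lam * t := X.variance_arrivals hlam hG_nonneg ht
  constructor
  · rw [(X.hasSum_covTerm hlam hG_nonneg hQ0 ht).tsum_eq]
    change _ = lam * t - covariance A D P
    rw [hAD, hAv]; ring
  · rw [variance_congr hbal, variance_sub (hQ0.add hA) hQ, variance_add hQ0 hA, hind,
      covariance_add_left hQ0 hA hQ, hAv]
    ring

end MG1Queue

/-! ### Laplace transforms along the sequence of arrivals -/

lemma lintegral_exp_neg_mul_expMeasure {lam s : ℝ} (hlam : 0 < lam) (hκ : 0 < lam + s) :
    ∫⁻ x, ENNReal.ofReal (Real.exp (-(s * x))) ∂(expMeasure lam)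
      = ENNReal.ofReal (lam / (lam + s)) := by
  have h1 := lintegral_expMeasure (lam + s) 1
  have := isProbabilityMeasure_expMeasure hκ
  simp only [Pi.one_apply, lintegral_const, measure_univ, mul_one] at h1
  rw [lintegral_expMeasure]
  have h2 : ∀ x : ℝ, ENNReal.ofReal (lam * Real.exp (-(lam * x))) *
      ENNReal.ofReal (Real.exp (-(s * x))) = ENNReal.ofReal (lam / (lam + s)) *
        ENNReal.ofReal ((lam + s) * Real.exp (-((lam + s) * x))) := fun x => by
    rw [← ENNReal.ofReal_mul (by positivity), ← ENNReal.ofReal_mul (by positivity)]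
    congr 1
    rw [mul_assoc, ← Real.exp_add, show -((lam + s) * x) = -(lam * x) + -(s * x) by ring]
    field_simp
  simp_rw [h2]
  rw [lintegral_const_mul _ (by fun_prop), ← h1, mul_one]

/-- The transform of the workload `v` after an exponential time, during which it decreases at unit
rate until it vanishes. -/
lemma lintegral_exp_workload {lam s α v : ℝ} (hlam : 0 < lam) (hκ : 0 < lam + s)
    (hα : α ≠ lam + s) (hv : 0 ≤ v) :
    ∫⁻ x, ENNReal.ofReal (Real.exp (-(s * x) - α * max (v - x) 0)) ∂(expMeasure lam)
      = ENNReal.ofReal (lam * ((Real.exp (-(α * v)) - Real.exp (-((lam + s) * v))) / (lam + s - α)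
          + Real.exp (-((lam + s) * v)) / (lam + s))) := by
  rw [lintegral_expMeasure, ← Set.Ioc_union_Ioi_eq_Ioi hv,
    lintegral_union measurableSet_Ioi (Set.Ioc_disjoint_Ioi le_rfl)]
  set κ := lam + s with hκdef
  have hne : κ - α ≠ 0 := sub_ne_zero.2 hα.symm
  have h1 : ∫⁻ x in Set.Ioc 0 v, ENNReal.ofReal (lam * Real.exp (-(lam * x))) *
      ENNReal.ofReal (Real.exp (-(s * x) - α * max (v - x) 0))
      = ENNReal.ofReal (lam * ((Real.exp (-(α * v)) - Real.exp (-(κ * v))) / (κ - α))) := by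
    have : ∀ x ∈ Set.Ioc 0 v, ENNReal.ofReal (lam * Real.exp (-(lam * x))) *
        ENNReal.ofReal (Real.exp (-(s * x) - α * max (v - x) 0))
        = ENNReal.ofReal (lam * Real.exp (-(α * v)) * Real.exp (-((κ - α) * x))) := by
      intro x hx
      rw [max_eq_left (by linarith [hx.2]), ← ENNReal.ofReal_mul (by positivity)]
      congr 1
      rw [mul_assoc, mul_assoc, ← Real.exp_add, ← Real.exp_add, hκdef]
      congr 2; ring
    rw [setLIntegral_congr_fun measurableSet_Ioc this, ← ofReal_integral_eq_lintegral_ofReal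
      (Continuous.integrableOn_Ioc (by fun_prop)) (ae_of_all _ fun x => by positivity),
      ← intervalIntegral.integral_of_le hv]
    congr 1
    rw [intervalIntegral.integral_const_mul]
    have hd : ∀ x ∈ Set.uIcc 0 v, HasDerivAt (fun x => -Real.exp (-((κ - α) * x)) / (κ - α))
        (Real.exp (-((κ - α) * x))) x := by
      intro x _
      have := ((((hasDerivAt_id x).const_mul (κ - α)).neg.exp).neg).div_const (κ - α)
      simp only [id_eq, mul_one] at this
      convert! this using 1
      field_simp
      rfl
    rw [intervalIntegral.integral_eq_sub_of_hasDerivAt hd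
      (Continuous.intervalIntegrable (by fun_prop) _ _)]
    have : Real.exp (-(κ * v)) = Real.exp (-(α * v)) * Real.exp (-((κ - α) * v)) := by
      rw [← Real.exp_add]; congr 1; ring
    rw [this]
    simp only [mul_zero, neg_zero, Real.exp_zero]
    field_simp
    ring
  have h2 : ∫⁻ x in Set.Ioi v, ENNReal.ofReal (lam * Real.exp (-(lam * x))) *
      ENNReal.ofReal (Real.exp (-(s * x) - α * max (v - x) 0))
      = ENNReal.ofReal (lam * (Real.exp (-(κ * v)) / κ)) := by
    have : ∀ x ∈ Set.Ioi v, ENNReal.ofReal (lam * Real.exp (-(lam * x))) *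
        ENNReal.ofReal (Real.exp (-(s * x) - α * max (v - x) 0))
        = ENNReal.ofReal (lam * Real.exp (-κ * x)) := by
      intro x hx
      have hx' : v < x := hx
      rw [max_eq_right (by linarith), ← ENNReal.ofReal_mul (by positivity)]
      congr 1
      rw [mul_assoc, ← Real.exp_add, hκdef]
      congr 2; ring
    rw [setLIntegral_congr_fun measurableSet_Ioi this, ← ofReal_integral_eq_lintegral_ofReal
      ((integrableOn_exp_mul_Ioi (by linarith) v).const_mul lam)
      (ae_of_all _ fun x => by positivity), integral_const_mul, integral_exp_mul_Ioi (by linarith)]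
    congr 2
    rw [neg_div_neg_eq, neg_mul]
  rw [h1, h2, ← ENNReal.ofReal_add]
  · congr 1; ring
  · refine mul_nonneg hlam.le ?_
    -- numerator and denominator have the same sign
    rcases lt_or_gt_of_ne hα with h | h
    · refine div_nonneg ?_ (by linarith)
      rw [sub_nonneg]
      exact Real.exp_le_exp.2 (by nlinarith)
    · refine div_nonneg_of_nonpos ?_ (by linarith)
      rw [sub_nonpos]
      exact Real.exp_le_exp.2 (by nlinarith)
  · positivity

/-- The Laplace transform of a measure. -/
noncomputable def laplace (G : Measure ℝ) (α : ℝ) : ℝ := ∫ x, Real.exp (-(α * x)) ∂G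

namespace MG1Queue

variable {Ω : Type*} [MeasurableSpace Ω] {P : Measure Ω} {lam : ℝ} {G : Measure ℝ}

/-- The joint transform of the epoch of the `n`-th arrival and the workload at that epoch. -/
noncomputable def workTransform (X : MG1Queue P lam G) (s α : ℝ) (n : ℕ) : ℝ :=
  ∫ ω, Real.exp (-(s * X.arrivalSum n ω) - α * (X.clearTime n ω - X.arrivalSum n ω)) ∂P

lemma workTransform_nonneg (X : MG1Queue P lam G) (s α : ℝ) (n : ℕ) :
    0 ≤ X.workTransform s α n := integral_nonneg fun _ => (Real.exp_pos _).le

variable [IsProbabilityMeasure P]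

lemma integrable_exp_arrivalSum (hlam : 0 < lam) (X : MG1Queue P lam G) {s : ℝ}
    (hκ : 0 < lam + s) (n : ℕ) :
    Integrable (fun ω => Real.exp (-(s * X.arrivalSum n ω))) P ∧
      ∫ ω, Real.exp (-(s * X.arrivalSum n ω)) ∂P = (lam / (lam + s)) ^ n := by
  have h0 : ∀ i, ∫⁻ ω, ENNReal.ofReal (Real.exp (-(s * X.interarrival i ω))) ∂P
      = ENNReal.ofReal (lam / (lam + s)) := fun i => by
    rw [← lintegral_exp_neg_mul_expMeasure hlam hκ, ← X.law_interarrival i,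
      lintegral_map (by fun_prop) (X.measurable_interarrival i)]
  have hm : ∀ i, Measurable fun ω => Real.exp (-(s * X.interarrival i ω)) := fun i =>
    ((X.measurable_interarrival i).const_mul s).neg.exp
  have h1 : ∀ i, Integrable (fun ω => Real.exp (-s * X.interarrival i ω)) P := fun i => by
    simp_rw [neg_mul]
    refine ⟨(hm i).aestronglyMeasurable, ?_⟩
    rw [hasFiniteIntegral_iff_ofReal (ae_of_all _ fun ω => (Real.exp_pos _).le), h0]
    exact ENNReal.ofReal_lt_top
  have h2 : ∀ i, mgf (X.interarrival i) P (-s) = lam / (lam + s) := fun i => by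
    rw [mgf, integral_eq_lintegral_of_nonneg_ae (ae_of_all _ fun ω => (Real.exp_pos _).le)
      (h1 i).1]
    simp_rw [neg_mul]
    rw [h0, ENNReal.toReal_ofReal (by positivity)]
  have h3 := X.iIndep_interarrival.integrable_exp_mul_sum X.measurable_interarrival
    (s := Finset.range n) (t := -s) fun i _ => h1 i
  have h4 := X.iIndep_interarrival.mgf_sum X.measurable_interarrival (t := -s) (Finset.range n)
  simp_rw [h2, Finset.prod_const, Finset.card_range] at h4
  rw [mgf] at h4
  simp only [Finset.sum_apply, neg_mul] at h3 h4
  exact ⟨h3, h4⟩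

lemma integrable_workTransform (hlam : 0 < lam) (hG_nonneg : ∀ᵐ x ∂G, 0 ≤ x)
    (X : MG1Queue P lam G) {s α : ℝ} (hκ : 0 < lam + s) (hα : 0 ≤ α) (n : ℕ) :
    Integrable (fun ω => Real.exp (-(s * X.arrivalSum n ω) -
      α * (X.clearTime n ω - X.arrivalSum n ω))) P := by
  refine (X.integrable_exp_arrivalSum hlam hκ n).1.mono' (by fun_prop) ?_
  filter_upwards [X.ae_isRegular hG_nonneg] with ω hω
  rw [Real.norm_of_nonneg (Real.exp_pos _).le, Real.exp_le_exp]
  have := mul_nonneg hα (sub_nonneg.2 (hω.arrivalSum_le_clearTime n))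
  linarith

lemma workTransform_le (hlam : 0 < lam) (hG_nonneg : ∀ᵐ x ∂G, 0 ≤ x)
    (X : MG1Queue P lam G) {s α : ℝ} (hκ : 0 < lam + s) (hα : 0 ≤ α) (n : ℕ) :
    X.workTransform s α n ≤ (lam / (lam + s)) ^ n := by
  rw [← (X.integrable_exp_arrivalSum hlam hκ n).2]
  refine integral_mono_ae (X.integrable_workTransform hlam hG_nonneg hκ hα n)
    (X.integrable_exp_arrivalSum hlam hκ n).1 ?_
  filter_upwards [X.ae_isRegular hG_nonneg] with ω hω
  rw [Real.exp_le_exp]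
  have := mul_nonneg hα (sub_nonneg.2 (hω.arrivalSum_le_clearTime n))
  linarith

/-- The recursion of the workload at arrival epochs, in terms of transforms. -/
lemma workTransform_succ (hlam : 0 < lam) (hG_nonneg : ∀ᵐ x ∂G, 0 ≤ x)
    (X : MG1Queue P lam G) {s α : ℝ} (hκ : 0 < lam + s) (hα : 0 ≤ α) (hne : α ≠ lam + s)
    (n : ℕ) :
    (lam + s - α) * X.workTransform s α (n + 1) = lam * laplace G α *
      (X.workTransform s α n - α / (lam + s) * X.workTransform s (lam + s) n) := by
  have hreg := X.ae_isRegular hG_nonneg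
  set y : ℝ × ℝ → ENNReal := fun p =>
    ENNReal.ofReal (Real.exp (-(s * p.1) - α * max (p.2 - p.1) 0)) with hy
  have hym : Measurable y := by fun_prop
  have h1 : ∀ ω, ENNReal.ofReal (Real.exp (-(s * X.arrivalSum (n + 1) ω) -
      α * (X.clearTime (n + 1) ω - X.arrivalSum (n + 1) ω)))
      = y (X.arrivalSum (n + 1) ω, X.clearTime n ω) *
        ENNReal.ofReal (Real.exp (-(α * X.service (X.initial ω + n) ω))) := by
    intro ω
    rw [hy, ← ENNReal.ofReal_mul (Real.exp_pos _).le, ← Real.exp_add, clearTime_succ]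
    congr 2
    have : max (X.arrivalSum (n + 1) ω) (X.clearTime n ω)
        = X.arrivalSum (n + 1) ω + max (X.clearTime n ω - X.arrivalSum (n + 1) ω) 0 := by
      rw [← max_add_add_left, max_comm]
      simp
    rw [this]; ring
  have h2 : ∫⁻ ω, y (X.arrivalSum (n + 1) ω, X.clearTime n ω) ∂P
      = ∫⁻ ω, ENNReal.ofReal (Real.exp (-(s * X.arrivalSum n ω)) * (lam *
        ((Real.exp (-(α * (X.clearTime n ω - X.arrivalSum n ω))) -
          Real.exp (-((lam + s) * (X.clearTime n ω - X.arrivalSum n ω)))) / (lam + s - α)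
          + Real.exp (-((lam + s) * (X.clearTime n ω - X.arrivalSum n ω))) / (lam + s)))) ∂P := by
    have e1 := lintegral_of_indepFun (f := fun (p : ℝ × ℝ) (x : ℕ → ℝ) => y (p.1 + x 0, p.2))
      (X.indepFun_clearTime_interarrival n) (by fun_prop)
      (measurable_pi_lambda _ fun i => X.measurable_interarrival _)
      (hym.comp (by fun_prop : Measurable fun q : (ℝ × ℝ) × (ℕ → ℝ) => (q.1.1 + q.2 0, q.1.2)))
    simp only [add_zero, ← arrivalSum_succ] at e1
    rw [e1]
    refine lintegral_congr_ae ?_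
    filter_upwards [hreg] with ω hω
    have e2 : ∀ x, y (X.arrivalSum n ω + x, X.clearTime n ω)
        = ENNReal.ofReal (Real.exp (-(s * X.arrivalSum n ω))) * ENNReal.ofReal
          (Real.exp (-(s * x) - α * max (X.clearTime n ω - X.arrivalSum n ω - x) 0)) := fun x => by
      rw [hy, ← ENNReal.ofReal_mul (Real.exp_pos _).le, ← Real.exp_add]
      simp only
      rw [sub_add_eq_sub_sub]
      congr 2; ring
    simp_rw [e2]
    have hm : Measurable fun x => ENNReal.ofReal
        (Real.exp (-(s * x) - α * max (X.clearTime n ω - X.arrivalSum n ω - x) 0)) := by fun_prop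
    have e3 := lintegral_map (μ := P) hm (X.measurable_interarrival n)
    rw [X.law_interarrival,
      lintegral_exp_workload hlam hκ hne (sub_nonneg.2 (hω.arrivalSum_le_clearTime n))] at e3
    rw [lintegral_const_mul' _ _ ENNReal.ofReal_ne_top, ← e3,
      ← ENNReal.ofReal_mul (Real.exp_pos _).le]
  have h3 : X.workTransform s α (n + 1) = (∫ ω, Real.exp (-(s * X.arrivalSum n ω)) * (lam *
        ((Real.exp (-(α * (X.clearTime n ω - X.arrivalSum n ω))) -
          Real.exp (-((lam + s) * (X.clearTime n ω - X.arrivalSum n ω)))) / (lam + s - α)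
          + Real.exp (-((lam + s) * (X.clearTime n ω - X.arrivalSum n ω))) / (lam + s))) ∂P) *
        laplace G α := by
    rw [workTransform, integral_eq_lintegral_of_nonneg_ae
      (ae_of_all _ fun ω => (Real.exp_pos _).le) (by fun_prop)]
    simp_rw [h1]
    rw [X.lintegral_mul_service n hym (φ := fun x => ENNReal.ofReal (Real.exp (-(α * x))))
      (by fun_prop), ENNReal.toReal_mul, h2, laplace]
    rw [integral_eq_lintegral_of_nonneg_ae (f := fun x => Real.exp (-(α * x)))
      (ae_of_all _ fun x => (Real.exp_pos _).le) (by fun_prop)]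
    rw [integral_eq_lintegral_of_nonneg_ae _ (by fun_prop)]
    filter_upwards [hreg] with ω hω
    have hV := sub_nonneg.2 (hω.arrivalSum_le_clearTime n)
    refine mul_nonneg (Real.exp_pos _).le (mul_nonneg hlam.le (add_nonneg ?_ (by positivity)))
    rcases lt_or_gt_of_ne hne with h | h
    · refine div_nonneg ?_ (by linarith)
      rw [sub_nonneg]
      exact Real.exp_le_exp.2 (by nlinarith)
    · refine div_nonneg_of_nonpos ?_ (by linarith)
      rw [sub_nonpos]
      exact Real.exp_le_exp.2 (by nlinarith)
  have hd : lam + s - α ≠ 0 := sub_ne_zero.2 hne.symm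
  have i1 := X.integrable_workTransform hlam hG_nonneg hκ hα n
  have i2 := X.integrable_workTransform hlam hG_nonneg hκ hκ.le n
  have h4 : (lam + s - α) * (∫ ω, Real.exp (-(s * X.arrivalSum n ω)) * (lam *
        ((Real.exp (-(α * (X.clearTime n ω - X.arrivalSum n ω))) -
          Real.exp (-((lam + s) * (X.clearTime n ω - X.arrivalSum n ω)))) / (lam + s - α)
          + Real.exp (-((lam + s) * (X.clearTime n ω - X.arrivalSum n ω))) / (lam + s))) ∂P)
      = lam * (X.workTransform s α n - α / (lam + s) * X.workTransform s (lam + s) n) := by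
    rw [workTransform, workTransform, ← integral_const_mul, ← integral_const_mul (α / (lam + s)),
      ← integral_sub i1 (i2.const_mul _), ← integral_const_mul]
    congr 1 with ω
    rw [sub_eq_add_neg (-(s * X.arrivalSum n ω)) (α * _),
      sub_eq_add_neg (-(s * X.arrivalSum n ω)) ((lam + s) * _), Real.exp_add, Real.exp_add]
    field_simp
    ring
  rw [h3, ← mul_assoc, h4]; ring

/-- The kernel equation of the workload, solved for the generating function of the transforms:
`η` is a zero of the kernel. -/
lemma tsum_workTransform (hlam : 0 < lam) (hG_nonneg : ∀ᵐ x ∂G, 0 ≤ x)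
    (X : MG1Queue P lam G) {s z η : ℝ} (hs : 0 < s) (hz : 0 < z) (hη : 0 < η)
    (hη' : η < lam * z + s) (hroot : lam * z + s - η = lam * z * laplace G η) :
    Summable (fun n => z ^ n * X.workTransform (s + lam * (z - 1)) s n) ∧
    (∑' n, z ^ n * X.workTransform (s + lam * (z - 1)) s n) * (1 - laplace G s)
      = (∫ ω, Real.exp (-(s * X.initialWork ω)) ∂P)
        - s / η * laplace G s * ∫ ω, Real.exp (-(η * X.initialWork ω)) ∂P := by
  set s' := s + lam * (z - 1) with hs'
  have hκ : lam + s' = lam * z + s := by rw [hs']; ring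
  have hκ0 : 0 < lam + s' := by rw [hκ]; positivity
  have hr : z * (lam / (lam + s')) < 1 := by
    rw [← mul_div_assoc, div_lt_one hκ0, hκ]; linarith
  have hsum : ∀ α, 0 ≤ α → Summable fun n => z ^ n * X.workTransform s' α n := by
    intro α hα
    refine Summable.of_nonneg_of_le (fun n => mul_nonneg (by positivity)
      (X.workTransform_nonneg _ _ _)) (fun n => ?_)
      (summable_geometric_of_lt_one (by positivity) hr)
    rw [mul_pow]
    exact mul_le_mul_of_nonneg_left (X.workTransform_le hlam hG_nonneg hκ0 hα n) (by positivity)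
  have h0 : ∀ α, X.workTransform s' α 0 = ∫ ω, Real.exp (-(α * X.initialWork ω)) ∂P := by
    intro α
    simp [workTransform, arrivalSum, clearTime_zero]
  have hkey : ∀ α, 0 ≤ α → α ≠ lam + s' →
      (lam + s' - α) * ((∑' n, z ^ n * X.workTransform s' α n) - X.workTransform s' α 0)
      = lam * z * laplace G α * ((∑' n, z ^ n * X.workTransform s' α n)
        - α / (lam + s') * ∑' n, z ^ n * X.workTransform s' (lam + s') n) := by
    intro α hα hne
    have e1 : (∑' n, z ^ n * X.workTransform s' α n) - X.workTransform s' α 0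
        = ∑' n, z ^ (n + 1) * X.workTransform s' α (n + 1) := by
      rw [(hsum α hα).tsum_eq_zero_add]; simp
    rw [e1, ← tsum_mul_left, ← tsum_mul_left, ← (hsum α hα).tsum_sub
      ((hsum _ hκ0.le).mul_left _), ← tsum_mul_left]
    refine tsum_congr fun n => ?_
    have := X.workTransform_succ hlam hG_nonneg hκ0 hα hne n
    rw [mul_left_comm, this, pow_succ]
    ring
  refine ⟨hsum s hs.le, ?_⟩
  -- at the zero `η` the unknown generating function drops out and leaves the one for `lam * z + s`
  have k1 := hkey η hη.le (by rw [hκ]; exact hη'.ne)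
  have hlz : 0 < lam * z := by positivity
  have k2 := hkey s hs.le (by rw [hκ]; linarith)
  rw [hκ] at k1 k2
  rw [hroot] at k1
  have hL : lam * z * laplace G η ≠ 0 := by rw [← hroot]; linarith
  have k3 := mul_left_cancel₀ hL k1
  rw [show lam * z + s - s = lam * z by ring, mul_assoc (lam * z)] at k2
  have k4 := mul_left_cancel₀ hlz.ne' k2
  rw [h0] at k3 k4
  have hκne : lam * z + s ≠ 0 := by positivity
  generalize (∑' n, z ^ n * X.workTransform s' (lam * z + s) n) = Fκ at k3 k4
  have k5 : Fκ = (lam * z + s) / η * ∫ ω, Real.exp (-(η * X.initialWork ω)) ∂P := by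
    field_simp at k3 ⊢
    linarith
  rw [k5] at k4
  have : s / (lam * z + s) * ((lam * z + s) / η * ∫ ω, Real.exp (-(η * X.initialWork ω)) ∂P)
      = s / η * ∫ ω, Real.exp (-(η * X.initialWork ω)) ∂P := by
    field_simp
  rw [this] at k4
  linarith

end MG1Queue

/-! ### The covariance in terms of transforms -/

lemma hasDerivAt_integral_exp_neg {Ω : Type*} [MeasurableSpace Ω] {P : Measure Ω}
    [IsProbabilityMeasure P] {V : Ω → ℝ} (hV : AEMeasurable V P) (hV0 : ∀ᵐ ω ∂P, 0 ≤ V ω)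
    {η : ℝ} (hη : 0 < η) :
    HasDerivAt (fun x => ∫ ω, Real.exp (-(x * V ω)) ∂P)
      (-∫ ω, V ω * Real.exp (-(η * V ω)) ∂P) η := by
  have hsub : Set.Iio 0 ⊆ integrableExpSet V P := by
    intro t ht
    have ht' : t < 0 := ht
    refine (integrable_const (1 : ℝ)).mono' (by fun_prop) ?_
    filter_upwards [hV0] with ω hω
    rw [Real.norm_of_nonneg (Real.exp_pos _).le]
    exact Real.exp_le_one_iff.2 (by nlinarith)
  have hint : -η ∈ interior (integrableExpSet V P) :=
    interior_mono hsub (by rw [isOpen_Iio.interior_eq]; simpa using hη)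
  have h := (hasDerivAt_mgf hint).comp η (hasDerivAt_neg η)
  convert! h using 1
  · ext x; simp [mgf]
  · simp only [neg_mul, mul_neg, mul_one]

namespace MG1Queue

variable {Ω : Type*} [MeasurableSpace Ω] {P : Measure Ω} {lam : ℝ} {G : Measure ℝ}

lemma mul_exp_neg_le {s x : ℝ} (hs : 0 < s) : x * Real.exp (-(s * x)) ≤
    2 / s * Real.exp (-(s / 2 * x)) := by
  have h1 : s / 2 * x ≤ Real.exp (s / 2 * x) := by
    linarith [Real.add_one_le_exp (s / 2 * x)]
  have h2 : Real.exp (-(s * x)) = Real.exp (-(s / 2 * x)) * Real.exp (-(s / 2 * x)) := by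
    rw [← Real.exp_add]; congr 1; ring
  have h3 : Real.exp (s / 2 * x) * Real.exp (-(s / 2 * x)) = 1 := by
    rw [← Real.exp_add]; simp
  have h4 : s / 2 * x * Real.exp (-(s / 2 * x)) ≤ 1 := by
    rw [← h3]; exact mul_le_mul_of_nonneg_right h1 (Real.exp_pos _).le
  rw [h2]
  have h5 : x * Real.exp (-(s / 2 * x)) ≤ 2 / s := by
    rw [le_div_iff₀ hs]; linarith
  calc x * (Real.exp (-(s / 2 * x)) * Real.exp (-(s / 2 * x)))
      = x * Real.exp (-(s / 2 * x)) * Real.exp (-(s / 2 * x)) := by ring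
    _ ≤ _ := mul_le_mul_of_nonneg_right h5 (Real.exp_pos _).le

variable [IsProbabilityMeasure P]

lemma integrable_exp_clearTime (hG_nonneg : ∀ᵐ x ∂G, 0 ≤ x)
    (X : MG1Queue P lam G) {s : ℝ} (hs : 0 < s) (n : ℕ) :
    Integrable (fun ω => Real.exp (-(s * X.clearTime n ω))) P := by
  refine (integrable_const (1 : ℝ)).mono' (by fun_prop) ?_
  filter_upwards [X.ae_isRegular hG_nonneg] with ω hω
  rw [Real.norm_of_nonneg (Real.exp_pos _).le]
  have := (hω.arrivalSum_nonneg n).trans (hω.arrivalSum_le_clearTime n)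
  exact Real.exp_le_one_iff.2 (by nlinarith)

lemma integrable_arrivalSum_mul_exp (hlam : 0 < lam) (hG_nonneg : ∀ᵐ x ∂G, 0 ≤ x)
    (X : MG1Queue P lam G) {s : ℝ} (hs : 0 < s) (n : ℕ) :
    Integrable (fun ω => X.arrivalSum n ω * Real.exp (-(s * X.clearTime n ω))) P ∧
    ∫ ω, X.arrivalSum n ω * Real.exp (-(s * X.clearTime n ω)) ∂P
      ≤ 2 / s * (lam / (lam + s / 2)) ^ n := by
  have hi := X.integrable_exp_arrivalSum hlam (s := s / 2) (by positivity) n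
  have hle : ∀ᵐ ω ∂P, ‖X.arrivalSum n ω * Real.exp (-(s * X.clearTime n ω))‖
      ≤ 2 / s * Real.exp (-(s / 2 * X.arrivalSum n ω)) := by
    filter_upwards [X.ae_isRegular hG_nonneg] with ω hω
    have h0 := hω.arrivalSum_nonneg n
    have h1 := hω.arrivalSum_le_clearTime n
    rw [Real.norm_of_nonneg (by positivity)]
    refine le_trans (mul_le_mul_of_nonneg_left (Real.exp_le_exp.2 ?_) h0) (mul_exp_neg_le hs)
    nlinarith
  have h1 : Integrable (fun ω => X.arrivalSum n ω * Real.exp (-(s * X.clearTime n ω))) P :=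
    (hi.1.const_mul _).mono' (by fun_prop) hle
  refine ⟨h1, ?_⟩
  rw [← hi.2, ← integral_const_mul]
  refine integral_mono_ae h1 (hi.1.const_mul _) ?_
  filter_upwards [hle] with ω hω
  exact (le_abs_self _).trans hω

lemma summable_arrivalSum_mul_exp (hlam : 0 < lam) (hG_nonneg : ∀ᵐ x ∂G, 0 ≤ x)
    (X : MG1Queue P lam G) {s : ℝ} (hs : 0 < s) :
    Summable fun n => ∫ ω, X.arrivalSum n ω * Real.exp (-(s * X.clearTime n ω)) ∂P := by
  refine Summable.of_nonneg_of_le (fun n => integral_nonneg_of_ae ?_)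
    (fun n => (X.integrable_arrivalSum_mul_exp hlam hG_nonneg hs n).2)
    ((summable_geometric_of_lt_one (by positivity) ?_).mul_left _)
  · filter_upwards [X.ae_isRegular hG_nonneg] with ω hω
    exact mul_nonneg (hω.arrivalSum_nonneg n) (Real.exp_pos _).le
  · rw [div_lt_one (by positivity)]; linarith

lemma summable_mul_exp_clearTime (hlam : 0 < lam) (hG_nonneg : ∀ᵐ x ∂G, 0 ≤ x)
    (X : MG1Queue P lam G) {s : ℝ} (hs : 0 < s) :
    Summable fun n : ℕ => n * ∫ ω, Real.exp (-(s * X.clearTime n ω)) ∂P := by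
  have hr : lam / (lam + s) < 1 := by rw [div_lt_one (by positivity)]; linarith
  have hgeo := summable_pow_mul_geometric_of_norm_lt_one 1
    (show ‖lam / (lam + s)‖ < 1 by rwa [Real.norm_of_nonneg (by positivity)])
  simp only [pow_one] at hgeo
  refine Summable.of_nonneg_of_le (fun n => mul_nonneg (Nat.cast_nonneg _)
    (integral_nonneg fun _ => (Real.exp_pos _).le)) (fun n => ?_) hgeo
  refine mul_le_mul_of_nonneg_left ?_ (Nat.cast_nonneg _)
  have hi := X.integrable_exp_arrivalSum hlam (s := s) (by positivity) n
  rw [← hi.2]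
  refine integral_mono_ae (X.integrable_exp_clearTime hG_nonneg hs n) hi.1 ?_
  filter_upwards [X.ae_isRegular hG_nonneg] with ω hω
  have h1 := hω.arrivalSum_le_clearTime n
  exact Real.exp_le_exp.2 (by nlinarith)

/-- The Laplace-Stieltjes transform of `t ↦ Cov(A(t), D(t))`.  The terms with `n = 0` vanish. -/
noncomputable def covTransform (X : MG1Queue P lam G) (s : ℝ) : ℝ :=
  (∑' n : ℕ, n * ∫ ω, Real.exp (-(s * X.clearTime n ω)) ∂P)
    - lam * ∑' n, ∫ ω, X.arrivalSum n ω * Real.exp (-(s * X.clearTime n ω)) ∂P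

/-- The transform `X.covTransform s` for `s = η - lam * (1 - laplace G η)`.  The solution of the
kernel equation depends on the parameter `z` of the generating function only through the zero of
the kernel, and `z` is an explicit function of this zero; as the tilted sum lies above its
tangent at `z = 1`, the two derivatives agree. -/
lemma covTransform_eq (hlam : 0 < lam) [IsProbabilityMeasure G] (hG_nonneg : ∀ᵐ x ∂G, 0 ≤ x)
    (X : MG1Queue P lam G) {s η : ℝ} (hη : 0 < η) (hs : 0 < s)
    (hsη : s = η - lam * (1 - laplace G η)) (hg : ∀ α, 0 < α → 0 < laplace G α ∧ laplace G α < 1) :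
    X.covTransform s * ((1 - lam * ∫ x, x * Real.exp (-(η * x)) ∂G) / (lam * (1 - laplace G η)))
      = s * laplace G s / (1 - laplace G s) *
        ((∫ ω, Real.exp (-(η * X.initialWork ω)) ∂P)
          + η * ∫ ω, X.initialWork ω * Real.exp (-(η * X.initialWork ω)) ∂P) / η ^ 2 := by
  set g' := -∫ x, x * Real.exp (-(η * x)) ∂G with hg'
  set a : ℝ → ℝ := fun x => ∫ ω, Real.exp (-(x * X.initialWork ω)) ∂P with ha
  set a' := -∫ ω, X.initialWork ω * Real.exp (-(η * X.initialWork ω)) ∂P with ha'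
  have hgd : HasDerivAt (laplace G) g' η :=
    hasDerivAt_integral_exp_neg (V := id) aemeasurable_id hG_nonneg hη
  have had : HasDerivAt a a' η := hasDerivAt_integral_exp_neg
    X.measurable_initialWork.aemeasurable
    (by filter_upwards [X.ae_isRegular hG_nonneg] with ω hω using hω.initialWork_nonneg) hη
  have hgη := hg η hη
  have hgs := hg s hs
  set z : ℝ → ℝ := fun x => (x - s) / (lam * (1 - laplace G x)) with hz
  have hd0 : lam * (1 - laplace G η) ≠ 0 := (mul_pos hlam (by linarith)).ne'
  have hsη' : η - s = lam * (1 - laplace G η) := by linarith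
  have hz1 : z η = 1 := by rw [hz]; simp only; rw [hsη', div_self hd0]
  have hzd : HasDerivAt z ((1 + lam * g') / (lam * (1 - laplace G η))) η := by
    have h1 := ((hasDerivAt_id η).sub_const s).div ((hgd.const_sub 1).const_mul lam) hd0
    convert! h1 using 1
    simp only [id_eq]
    rw [hsη']
    field_simp
    ring
  set Φ : ℝ → ℝ := fun x => (a s - s / x * laplace G s * a x) / (1 - laplace G s) with hΦ
  have hΦd : HasDerivAt Φ
      (-(s * laplace G s / (1 - laplace G s) * ((a' * η - a η) / η ^ 2))) η := by
    have h1 := ((((had.div (hasDerivAt_id η) hη.ne').const_mul (s * laplace G s)).const_sub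
      (a s)).div_const (1 - laplace G s))
    convert! h1 using 1
    · ext x
      simp only [hΦ, id_eq, Pi.div_apply]
      congr 2; ring
    · simp only [id_eq, mul_one]; ring
  set J1 := ∑' n : ℕ, n * ∫ ω, Real.exp (-(s * X.clearTime n ω)) ∂P with hJ1
  set J2 := ∑' n, ∫ ω, X.arrivalSum n ω * Real.exp (-(s * X.clearTime n ω)) ∂P with hJ2
  -- the generating function at `z x`, for `x` near `η`
  have hF : ∀ x, s < x → 0 < z x ∧
      Summable (fun n => z x ^ n * X.workTransform (s + lam * (z x - 1)) s n) ∧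
      Φ x = ∑' n, z x ^ n * X.workTransform (s + lam * (z x - 1)) s n := by
    intro x hx
    have hx0 := hs.trans hx
    have hgx := hg x hx0
    have h1 : 0 < lam * (1 - laplace G x) := mul_pos hlam (by linarith)
    have hzx : 0 < z x := div_pos (by linarith) h1
    have h2 : lam * z x * (1 - laplace G x) = x - s := by
      have : 1 - laplace G x ≠ 0 := by linarith
      rw [hz]; simp only; field_simp
    have h3 : 0 < lam * z x * laplace G x := mul_pos (mul_pos hlam hzx) hgx.1
    have h4 := X.tsum_workTransform hlam hG_nonneg hs hzx hx0 (by linarith) (by linarith)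
    refine ⟨hzx, h4.1, ?_⟩
    rw [hΦ]; simp only
    rw [div_eq_iff (by linarith), h4.2]
  have hsη'' : s < η := by
    have : 0 < lam * (1 - laplace G η) := mul_pos hlam (by linarith)
    linarith
  have hW1 : ∀ n, X.workTransform s s n = ∫ ω, Real.exp (-(s * X.clearTime n ω)) ∂P := by
    intro n
    rw [workTransform]; congr 1 with ω; congr 1; ring
  -- `z ^ n = exp (n log z)` and `1 + y ≤ exp y`, applied under the expectation
  have htang : ∀ x, s < x → Φ η ≤ Φ x - Real.log (z x) * J1 + lam * (z x - 1) * J2 := by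
    intro x hx
    obtain ⟨hzx, hsx, hΦx⟩ := hF x hx
    obtain ⟨-, hsη1, hΦη⟩ := hF η hsη''
    have s1 := X.summable_mul_exp_clearTime hlam hG_nonneg hs
    have s2 := X.summable_arrivalSum_mul_exp hlam hG_nonneg hs
    rw [hΦη, hΦx, hz1, hJ1, hJ2, ← tsum_mul_left, ← tsum_mul_left,
      ← hsx.tsum_sub (s1.mul_left _), ← (hsx.sub (s1.mul_left _)).tsum_add (s2.mul_left _)]
    rw [hz1] at hsη1
    refine hsη1.tsum_le_tsum (fun n => ?_) ((hsx.sub (s1.mul_left _)).add (s2.mul_left _))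
    have i0 := X.integrable_exp_clearTime hG_nonneg hs n
    have i1 := (X.integrable_arrivalSum_mul_exp hlam hG_nonneg hs n).1
    have i2 := X.integrable_workTransform hlam hG_nonneg (s := s + lam * (z x - 1)) (α := s)
      (by have := mul_pos hlam hzx; linarith) hs.le n
    rw [one_pow, one_mul, sub_self, mul_zero, add_zero, hW1]
    have : Real.log (z x) * (n * ∫ ω, Real.exp (-(s * X.clearTime n ω)) ∂P)
        = ∫ ω, Real.log (z x) * n * Real.exp (-(s * X.clearTime n ω)) ∂P := by
      rw [integral_const_mul]; ring
    have i3 : Integrable (fun ω => z x ^ n * Real.exp (-((s + lam * (z x - 1)) *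
        X.arrivalSum n ω) - s * (X.clearTime n ω - X.arrivalSum n ω))
        - Real.log (z x) * n * Real.exp (-(s * X.clearTime n ω))) P :=
      (i2.const_mul _).sub (i0.const_mul _)
    rw [this, workTransform, ← integral_const_mul, ← integral_const_mul,
      ← integral_sub (i2.const_mul _) (i0.const_mul _), ← integral_add i3 (i1.const_mul _)]
    refine integral_mono i0 (i3.add (i1.const_mul _)) ?_
    intro ω
    have e1 : z x ^ n * Real.exp (-((s + lam * (z x - 1)) * X.arrivalSum n ω) -
        s * (X.clearTime n ω - X.arrivalSum n ω))
        = Real.exp (n * Real.log (z x) - lam * (z x - 1) * X.arrivalSum n ω) *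
          Real.exp (-(s * X.clearTime n ω)) := by
      rw [← Real.exp_add, show z x ^ n = Real.exp (n * Real.log (z x)) by
        rw [mul_comm, Real.exp_mul, Real.exp_log hzx, Real.rpow_natCast], ← Real.exp_add]
      congr 1; ring
    have e2 := mul_le_mul_of_nonneg_right (Real.add_one_le_exp
      (n * Real.log (z x) - lam * (z x - 1) * X.arrivalSum n ω))
      (Real.exp_pos (-(s * X.clearTime n ω))).le
    simp only
    rw [e1]
    nlinarith
  have hmin : IsLocalMin (fun x => Φ x - Real.log (z x) * J1 + lam * (z x - 1) * J2) η := by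
    filter_upwards [lt_mem_nhds hsη''] with x hx
    have := htang x hx
    simpa [hz1] using this
  have hder := (hΦd.sub ((hzd.log (by rw [hz1]; norm_num)).mul_const J1)).add
    (((hzd.sub_const 1).const_mul lam).mul_const J2)
  have h0 := hmin.hasDerivAt_eq_zero hder
  rw [hz1, div_one] at h0
  have hint : (∫ x, x * Real.exp (-(η * x)) ∂G) = -g' := by rw [hg']; ring
  have hint2 : (∫ ω, X.initialWork ω * Real.exp (-(η * X.initialWork ω)) ∂P) = -a' := by
    rw [ha']; ring
  rw [hint, hint2, covTransform, ← hJ1, ← hJ2]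
  change (J1 - lam * J2) * _ = s * laplace G s / (1 - laplace G s) * (a η + η * -a') / η ^ 2
  have e3 : (1 - lam * -g') = 1 + lam * g' := by ring
  rw [e3]
  have e4 : s * laplace G s / (1 - laplace G s) * (a η + η * -a') / η ^ 2
      = -(s * laplace G s / (1 - laplace G s) * ((a' * η - a η) / η ^ 2)) := by ring
  rw [e4]
  linarith

end MG1Queue

/-! ### An Abelian theorem -/

lemma integral_exp_neg_mul_Ioi_zero {s : ℝ} (hs : 0 < s) :
    IntegrableOn (fun t => Real.exp (-(s * t))) (Set.Ioi 0) ∧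
      ∫ t in Set.Ioi (0 : ℝ), Real.exp (-(s * t)) = 1 / s := by
  have h1 := integrableOn_exp_mul_Ioi (a := -s) (by linarith) 0
  have h2 := integral_exp_mul_Ioi (a := -s) (by linarith) 0
  simp only [neg_mul, mul_zero, Real.exp_zero] at h1 h2
  exact ⟨h1, by rw [h2]; rw [neg_div_neg_eq]⟩

lemma integral_mul_exp_neg_mul_Ioi_zero {s : ℝ} (hs : 0 < s) :
    IntegrableOn (fun t => t * Real.exp (-(s * t))) (Set.Ioi 0) ∧
      ∫ t in Set.Ioi (0 : ℝ), t * Real.exp (-(s * t)) = 1 / s ^ 2 := by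
  have h2 := Real.integral_rpow_mul_exp_neg_mul_Ioi (a := 2) (by norm_num) hs
  have e : ∀ t : ℝ, t ^ ((2 : ℝ) - 1) = t := fun t => by norm_num
  simp only [e] at h2
  rw [show (1 / s) ^ (2 : ℝ) * Real.Gamma 2 = 1 / s ^ 2 by
    rw [Real.Gamma_two]; norm_num] at h2
  refine ⟨?_, h2⟩
  by_contra hcon
  rw [integral_undef hcon] at h2
  have : 0 < 1 / s ^ 2 := by positivity
  linarith

/-- Abel's theorem for a function that tends to `0`. -/
lemma tendsto_mul_laplace_zero {r : ℝ → ℝ}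
    (hint : ∀ s, 0 < s → IntegrableOn (fun t => Real.exp (-(s * t)) * r t) (Set.Ioi 0))
    (hr : Tendsto r atTop (𝓝 0)) :
    Tendsto (fun s => s * ∫ t in Set.Ioi 0, Real.exp (-(s * t)) * r t) (𝓝[>] 0) (𝓝 0) := by
  rw [Metric.tendsto_nhds]
  intro ε hε
  obtain ⟨T0, hT0⟩ := (Metric.tendsto_atTop.1 hr) (ε / 2) (by positivity)
  set T := max T0 0 with hT
  have hT' : ∀ t, T < t → |r t| ≤ ε / 2 := fun t ht => by
    have := hT0 t (le_trans (le_max_left _ _) ht.le)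
    rw [Real.dist_eq, sub_zero] at this
    exact this.le
  have hr1 : IntegrableOn r (Set.Ioc 0 T) := by
    have h1 : IntegrableOn (fun t => Real.exp t * (Real.exp (-(1 * t)) * r t)) (Set.Icc 0 T) :=
      IntegrableOn.continuousOn_mul Real.continuous_exp.continuousOn
        ((integrableOn_Icc_iff_integrableOn_Ioc).2
          ((hint 1 one_pos).mono_set Set.Ioc_subset_Ioi_self))
        isCompact_Icc
    refine (h1.mono_set Set.Ioc_subset_Icc_self).congr_fun (fun t _ => ?_) measurableSet_Ioc
    simp only
    rw [← mul_assoc, ← Real.exp_add]; simp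
  set C := ∫ t in Set.Ioc 0 T, |r t| with hC
  have hC0 : 0 ≤ C := integral_nonneg fun _ => abs_nonneg _
  have hs0 : ∀ᶠ s in 𝓝[>] (0 : ℝ), s < ε / (2 * (C + 1)) :=
    (gt_mem_nhds (by positivity)).filter_mono nhdsWithin_le_nhds
  filter_upwards [self_mem_nhdsWithin, hs0] with s hs hs1
  have hs' : (0 : ℝ) < s := hs
  rw [Real.dist_eq, sub_zero, abs_mul, abs_of_pos hs',
    ← Set.Ioc_union_Ioi_eq_Ioi (le_max_right T0 0),
    setIntegral_union (Set.Ioc_disjoint_Ioi le_rfl) measurableSet_Ioi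
      ((hint s hs').mono_set Set.Ioc_subset_Ioi_self)
      ((hint s hs').mono_set (Set.Ioi_subset_Ioi (le_max_right _ _)))]
  have b1 : |∫ t in Set.Ioc 0 T, Real.exp (-(s * t)) * r t| ≤ C := by
    rw [← Real.norm_eq_abs]
    refine (norm_integral_le_integral_norm _).trans ?_
    refine setIntegral_mono_on ((hint s hs').mono_set Set.Ioc_subset_Ioi_self).norm hr1.abs
      measurableSet_Ioc fun t ht => ?_
    rw [norm_mul, Real.norm_of_nonneg (Real.exp_pos _).le, Real.norm_eq_abs]
    have h2 : Real.exp (-(s * t)) ≤ 1 := Real.exp_le_one_iff.2 (by nlinarith [ht.1])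
    nlinarith [abs_nonneg (r t)]
  have b2 : |∫ t in Set.Ioi T, Real.exp (-(s * t)) * r t| ≤ ε / 2 * (1 / s) := by
    rw [← Real.norm_eq_abs]
    have hE := integral_exp_neg_mul_Ioi_zero hs'
    have hsub : Set.Ioi T ⊆ Set.Ioi 0 := Set.Ioi_subset_Ioi (le_max_right _ _)
    calc ‖∫ t in Set.Ioi T, Real.exp (-(s * t)) * r t‖
        ≤ ∫ t in Set.Ioi T, ‖Real.exp (-(s * t)) * r t‖ := norm_integral_le_integral_norm _
      _ ≤ ∫ t in Set.Ioi T, ε / 2 * Real.exp (-(s * t)) := by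
        refine setIntegral_mono_on ((hint s hs').mono_set hsub).norm
          ((hE.1.mono_set hsub).const_mul _) measurableSet_Ioi fun t ht => ?_
        rw [norm_mul, Real.norm_of_nonneg (Real.exp_pos _).le, Real.norm_eq_abs, mul_comm]
        exact mul_le_mul_of_nonneg_right (hT' t ht) (Real.exp_pos _).le
      _ ≤ ∫ t in Set.Ioi 0, ε / 2 * Real.exp (-(s * t)) :=
        setIntegral_mono_set (hE.1.const_mul _)
          (ae_of_all _ fun t => by positivity) hsub.eventuallyLE
      _ = ε / 2 * (1 / s) := by rw [integral_const_mul, hE.2]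
  have b3 : s * C < ε / 2 := by
    rw [lt_div_iff₀ (by positivity)] at hs1
    nlinarith
  calc s * |(∫ t in Set.Ioc 0 T, Real.exp (-(s * t)) * r t)
        + ∫ t in Set.Ioi T, Real.exp (-(s * t)) * r t|
      ≤ s * (C + ε / 2 * (1 / s)) := by
        refine mul_le_mul_of_nonneg_left ((abs_add_le _ _).trans (add_le_add b1 b2)) hs'.le
    _ = s * C + ε / 2 := by field_simp
    _ < ε := by linarith

/-- If `f t = a * t + b + o(1)`, its Laplace transform determines `a` and `b`. -/
lemma tendsto_laplace_of_asymptote {f : ℝ → ℝ} {a b : ℝ}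
    (hint : ∀ s, 0 < s → IntegrableOn (fun t => Real.exp (-(s * t)) * f t) (Set.Ioi 0))
    (hf : Tendsto (fun t => f t - (a * t + b)) atTop (𝓝 0)) :
    Tendsto (fun s => s * (∫ t in Set.Ioi 0, Real.exp (-(s * t)) * f t) - a / s)
      (𝓝[>] 0) (𝓝 b) := by
  have hlin : ∀ s, 0 < s →
      IntegrableOn (fun t => Real.exp (-(s * t)) * (a * t + b)) (Set.Ioi 0) ∧
      ∫ t in Set.Ioi 0, Real.exp (-(s * t)) * (a * t + b) = a * (1 / s ^ 2) + b * (1 / s) := by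
    intro s hs
    have h1 := integral_exp_neg_mul_Ioi_zero hs
    have h2 := integral_mul_exp_neg_mul_Ioi_zero hs
    have e : (fun t => Real.exp (-(s * t)) * (a * t + b))
        = fun t => a * (t * Real.exp (-(s * t))) + b * Real.exp (-(s * t)) := by
      ext t; ring
    rw [e]
    refine ⟨(h2.1.const_mul a).add (h1.1.const_mul b), ?_⟩
    rw [integral_add (h2.1.const_mul a) (h1.1.const_mul b), integral_const_mul, integral_const_mul,
      h1.2, h2.2]
  have hr := tendsto_mul_laplace_zero (r := fun t => f t - (a * t + b))
    (fun s hs => by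
      have := (hint s hs).sub (hlin s hs).1
      refine this.congr_fun (fun t _ => ?_) measurableSet_Ioi
      simp only [Pi.sub_apply]; ring) hf
  have h2 := hr.add_const b
  rw [zero_add] at h2
  refine h2.congr' ?_
  filter_upwards [self_mem_nhdsWithin] with s hs
  have hs' : (0 : ℝ) < s := hs
  simp_rw [mul_sub (Real.exp _) (f _)]
  rw [integral_sub (hint s hs') (hlin s hs').1, (hlin s hs').2]
  field_simp
  ring

lemma integrable_tsum_of_summable_integral_norm {α : Type*} [MeasurableSpace α] {μ : Measure α}
    {F : ℕ → α → ℝ} (hF : ∀ n, Integrable (F n) μ) (hs : Summable fun n => ∫ a, ‖F n a‖ ∂μ) :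
    Integrable (fun a => ∑' n, F n a) μ := by
  refine ⟨AEStronglyMeasurable.tsum fun n => (hF n).1, ?_⟩
  have h1 : ∫⁻ a, ∑' n, ‖F n a‖ₑ ∂μ < ⊤ := by
    rw [lintegral_tsum fun n => (hF n).1.enorm]
    have : ∀ n, ∫⁻ a, ‖F n a‖ₑ ∂μ = ENNReal.ofReal (∫ a, ‖F n a‖ ∂μ) := fun n => by
      rw [ofReal_integral_norm_eq_lintegral_enorm (hF n)]
    simp_rw [this]
    rw [← ENNReal.ofReal_tsum_of_nonneg (fun n => integral_nonneg fun _ => norm_nonneg _) hs]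
    exact ENNReal.ofReal_lt_top
  exact lt_of_le_of_lt (lintegral_mono fun a => enorm_tsum_le_tsum_enorm) h1

lemma integral_exp_mul_indicator {s b : ℝ} (hs : 0 < s) (hb : 0 ≤ b) :
    IntegrableOn (fun t => Real.exp (-(s * t)) * {t | b ≤ t}.indicator 1 t) (Set.Ioi 0) ∧
    ∫ t in Set.Ioi 0, Real.exp (-(s * t)) * {t | b ≤ t}.indicator 1 t
      = Real.exp (-(s * b)) / s := by
  have e : (fun t => Real.exp (-(s * t)) * {t | b ≤ t}.indicator 1 t)
      = (Set.Ici b).indicator fun t => Real.exp (-s * t) := by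
    ext t; simp [Set.indicator]
  rw [e]
  have h1 := (integrableOn_exp_mul_Ioi (a := -s) (by linarith) 0).indicator
    (measurableSet_Ici (a := b))
  refine ⟨h1, ?_⟩
  rw [setIntegral_indicator measurableSet_Ici]
  have : (Set.Ioi 0 ∩ Set.Ici b : Set ℝ) =ᵐ[volume] Set.Ioi b := by
    rcases hb.eq_or_lt with rfl | hb
    · rw [Set.inter_eq_left.2 Set.Ioi_subset_Ici_self]
      exact Filter.EventuallyEq.refl _ _
    · rw [Set.inter_eq_right.2 (Set.Ici_subset_Ioi.2 hb)]
      exact Ioi_ae_eq_Ici.symm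
  rw [setIntegral_congr_set this, integral_exp_mul_Ioi (by linarith), neg_div_neg_eq, neg_mul]

/-! ### The Laplace transform of the covariance -/

namespace MG1Queue

variable {Ω : Type*} [MeasurableSpace Ω] {P : Measure Ω} [IsProbabilityMeasure P] {lam : ℝ}
  {G : Measure ℝ}

lemma laplace_covTerm (hlam : 0 < lam) (hG_nonneg : ∀ᵐ x ∂G, 0 ≤ x)
    (X : MG1Queue P lam G) {s : ℝ} (hs : 0 < s) (n : ℕ) :
    IntegrableOn (fun t => Real.exp (-(s * t)) * X.covTerm n t) (Set.Ioi 0) ∧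
    ∫ t in Set.Ioi 0, Real.exp (-(s * t)) * X.covTerm n t
      = (n * (∫ ω, Real.exp (-(s * X.clearTime n ω)) ∂P)
        - lam * ∫ ω, X.arrivalSum n ω * Real.exp (-(s * X.clearTime n ω)) ∂P) / s ∧
    ∫ t in Set.Ioi 0, ‖Real.exp (-(s * t)) * X.covTerm n t‖
      ≤ (n * (∫ ω, Real.exp (-(s * X.clearTime n ω)) ∂P)
        + lam * ∫ ω, X.arrivalSum n ω * Real.exp (-(s * X.clearTime n ω)) ∂P) / s := by
  have i0 := X.integrable_exp_clearTime hG_nonneg hs n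
  have i1 := (X.integrable_arrivalSum_mul_exp hlam hG_nonneg hs n).1
  have hreg := X.ae_isRegular hG_nonneg
  set ν : Measure ℝ := volume.restrict (Set.Ioi 0) with hν
  set H : Ω → ℝ → ℝ := fun ω t => (n - lam * X.arrivalSum n ω) *
    (Real.exp (-(s * t)) * {t | X.clearTime n ω ≤ t}.indicator 1 t) with hH
  have hHm : Measurable (Function.uncurry H) := by
    have : Function.uncurry H = fun p : Ω × ℝ => (n - lam * X.arrivalSum n p.1) *
        (Real.exp (-(s * p.2)) * {p : Ω × ℝ | X.clearTime n p.1 ≤ p.2}.indicator 1 p) := by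
      ext p; simp [H, Function.uncurry, Set.indicator]
    rw [this]
    have h1 : Measurable ({p : Ω × ℝ | X.clearTime n p.1 ≤ p.2}.indicator (1 : Ω × ℝ → ℝ)) :=
      measurable_one.indicator (measurableSet_le (by fun_prop) measurable_snd)
    fun_prop
  have hexp : ∀ ω, X.IsRegular ω → ∫ t, H ω t ∂ν
      = (n - lam * X.arrivalSum n ω) * (Real.exp (-(s * X.clearTime n ω)) / s) := by
    intro ω hω
    rw [hH, integral_const_mul, (integral_exp_mul_indicator hs
      ((hω.arrivalSum_nonneg n).trans (hω.arrivalSum_le_clearTime n))).2]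
  have hexpn : ∀ ω, X.IsRegular ω → ∫ t, ‖H ω t‖ ∂ν
      = |n - lam * X.arrivalSum n ω| * (Real.exp (-(s * X.clearTime n ω)) / s) := by
    intro ω hω
    rw [← (integral_exp_mul_indicator hs
      ((hω.arrivalSum_nonneg n).trans (hω.arrivalSum_le_clearTime n))).2, ← integral_const_mul]
    congr 1 with t
    rw [hH, norm_mul, Real.norm_eq_abs, Real.norm_of_nonneg]
    exact mul_nonneg (Real.exp_pos _).le (Set.indicator_nonneg (fun _ _ => zero_le_one) _)
  have i2 : Integrable (fun ω => |n - lam * X.arrivalSum n ω| *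
      (Real.exp (-(s * X.clearTime n ω)) / s)) P := by
    have i3 : Integrable (fun ω => (n - lam * X.arrivalSum n ω) *
        (Real.exp (-(s * X.clearTime n ω)) / s)) P := by
      refine (((i0.const_mul (n : ℝ)).sub (i1.const_mul lam)).div_const s).congr
        (ae_of_all _ fun ω => ?_)
      simp only [Pi.sub_apply]; ring
    refine i3.norm.congr (ae_of_all _ fun ω => ?_)
    simp only
    rw [norm_mul, Real.norm_eq_abs, Real.norm_of_nonneg (by positivity)]
  have hHi : Integrable (Function.uncurry H) (P.prod ν) := by
    rw [integrable_prod_iff hHm.aestronglyMeasurable]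
    constructor
    · filter_upwards [hreg] with ω hω
      change Integrable (fun t => (n - lam * X.arrivalSum n ω) * _) ν
      exact ((integral_exp_mul_indicator hs
        ((hω.arrivalSum_nonneg n).trans (hω.arrivalSum_le_clearTime n))).1).const_mul _
    · refine i2.congr ?_
      filter_upwards [hreg] with ω hω
      exact (hexpn ω hω).symm
  have hcov : ∀ t, ∫ ω, H ω t ∂P = Real.exp (-(s * t)) * X.covTerm n t := by
    intro t
    rw [covTerm, ← integral_const_mul]
    congr 1 with ω
    simp only [H, Set.indicator, Set.mem_ofPred_eq, Pi.one_apply]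
    ring
  refine ⟨?_, ?_, ?_⟩
  · have := hHi.integral_prod_right
    simp only [Function.uncurry] at this
    simp_rw [hcov] at this
    exact this
  · simp_rw [← hcov]
    rw [← integral_integral_swap hHi, integral_congr_ae (by
      filter_upwards [hreg] with ω hω using hexp ω hω), ← integral_const_mul, ← integral_const_mul,
      ← integral_sub (i0.const_mul _) (i1.const_mul _), ← integral_div]
    congr 1 with ω
    ring
  · calc ∫ t, ‖Real.exp (-(s * t)) * X.covTerm n t‖ ∂ν
        ≤ ∫ t, ∫ ω, ‖H ω t‖ ∂P ∂ν := by
          simp_rw [← hcov]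
          exact integral_mono_of_nonneg (ae_of_all _ fun _ => norm_nonneg _)
            hHi.norm.integral_prod_right (ae_of_all _ fun t => norm_integral_le_integral_norm _)
      _ = ∫ ω, |n - lam * X.arrivalSum n ω| * (Real.exp (-(s * X.clearTime n ω)) / s) ∂P := by
          rw [← integral_integral_swap (f := fun ω t => ‖H ω t‖) hHi.norm]
          refine integral_congr_ae ?_
          filter_upwards [hreg] with ω hω using hexpn ω hω
      _ ≤ _ := by
          rw [← integral_const_mul, ← integral_const_mul,
            ← integral_add (i0.const_mul _) (i1.const_mul _), ← integral_div]
          refine integral_mono_ae i2 (((i0.const_mul _).add (i1.const_mul _)).div_const s) ?_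
          filter_upwards [hreg] with ω hω
          have h1 : |(n : ℝ) - lam * X.arrivalSum n ω| ≤ n + lam * X.arrivalSum n ω := by
            have := mul_nonneg hlam.le (hω.arrivalSum_nonneg n)
            have : (0 : ℝ) ≤ n := Nat.cast_nonneg n
            rw [abs_le]; constructor <;> linarith
          calc _ ≤ (n + lam * X.arrivalSum n ω) * (Real.exp (-(s * X.clearTime n ω)) / s) :=
                mul_le_mul_of_nonneg_right h1 (by positivity)
            _ = _ := by ring

/-- `X.covTransform` is the transform of `Cov(A(t), D(t))`, represented by its series. -/
lemma laplace_tsum_covTerm (hlam : 0 < lam) (hG_nonneg : ∀ᵐ x ∂G, 0 ≤ x)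
    (X : MG1Queue P lam G) {s : ℝ} (hs : 0 < s) :
    IntegrableOn (fun t => Real.exp (-(s * t)) * ∑' n, X.covTerm (n + 1) t) (Set.Ioi 0) ∧
    s * ∫ t in Set.Ioi 0, Real.exp (-(s * t)) * ∑' n, X.covTerm (n + 1) t
      = X.covTransform s := by
  have s1 := X.summable_mul_exp_clearTime hlam hG_nonneg hs
  have s2 := X.summable_arrivalSum_mul_exp hlam hG_nonneg hs
  have hF := fun n => X.laplace_covTerm hlam hG_nonneg hs (n + 1)
  have hsum : Summable fun n => ∫ t in Set.Ioi 0, ‖Real.exp (-(s * t)) * X.covTerm (n + 1) t‖ :=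
    Summable.of_nonneg_of_le (fun n => integral_nonneg fun _ => norm_nonneg _) (fun n => (hF n).2.2)
      ((summable_nat_add_iff (f := fun n : ℕ =>
        ((n : ℝ) * (∫ ω, Real.exp (-(s * X.clearTime n ω)) ∂P)
        + lam * ∫ ω, X.arrivalSum n ω * Real.exp (-(s * X.clearTime n ω)) ∂P) / s) 1).2
        ((s1.add (s2.mul_left lam)).div_const s))
  simp_rw [← tsum_mul_left]
  refine ⟨integrable_tsum_of_summable_integral_norm (fun n => (hF n).1) hsum, ?_⟩
  rw [← integral_tsum_of_summable_integral_norm (fun n => (hF n).1) hsum]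
  simp_rw [(hF _).2.1]
  have h0 : (((0 : ℕ) : ℝ) * (∫ ω, Real.exp (-(s * X.clearTime 0 ω)) ∂P)
        - lam * ∫ ω, X.arrivalSum 0 ω * Real.exp (-(s * X.clearTime 0 ω)) ∂P) / s = 0 := by
    simp [arrivalSum]
  have h1 := ((s1.sub (s2.mul_left lam)).div_const s).tsum_eq_zero_add
  rw [h0, zero_add] at h1
  rw [← h1, tsum_div_const, s1.tsum_sub (s2.mul_left lam), tsum_mul_left, covTransform]
  field_simp

end MG1Queue

/-! ### Expansion of the transforms at the origin -/

lemma abs_exp_neg_sub_le_sq {y : ℝ} (hy : 0 ≤ y) : |Real.exp (-y) - 1 + y| ≤ y ^ 2 := by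
  rcases le_or_gt y 1 with h | h
  · have := Real.abs_exp_sub_one_sub_id_le (x := -y) (by rwa [abs_neg, abs_of_nonneg hy])
    rwa [sub_neg_eq_add, neg_sq] at this
  · have h1 := Real.exp_pos (-y)
    have h2 : Real.exp (-y) ≤ 1 := Real.exp_le_one_iff.2 (by linarith)
    rw [abs_le]; constructor <;> nlinarith

lemma abs_exp_neg_sub_le_cube {y : ℝ} (hy : 0 ≤ y) :
    |Real.exp (-y) - 1 + y - y ^ 2 / 2| ≤ y ^ 3 := by
  rcases le_or_gt y 1 with h | h
  · have := Real.exp_bound (x := -y) (by rwa [abs_neg, abs_of_nonneg hy]) (n := 3) (by norm_num)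
    simp only [Finset.sum_range_succ, Finset.sum_range_zero, abs_neg, abs_of_nonneg hy] at this
    norm_num [Nat.factorial] at this
    have h3 : 0 ≤ y ^ 3 := by positivity
    calc _ = |Real.exp (-y) - (1 + -y + y ^ 2 / 2)| := by congr 1; ring
      _ ≤ y ^ 3 * (2 / 9) := this
      _ ≤ y ^ 3 := by linarith
  · have h1 := Real.exp_pos (-y)
    have h2 : Real.exp (-y) ≤ 1 := Real.exp_le_one_iff.2 (by linarith)
    have h3 : y ^ 2 ≤ y ^ 3 := pow_le_pow_right₀ h.le (by norm_num)
    rw [abs_le]; constructor <;> nlinarith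

lemma integrable_pow_of_le {G : Measure ℝ} [IsFiniteMeasure G] {m n : ℕ} (hmn : m ≤ n)
    (hn : Integrable (fun x : ℝ => x ^ n) G) : Integrable (fun x : ℝ => x ^ m) G := by
  refine ((integrable_const (1 : ℝ)).add hn.norm).mono' (by fun_prop) (ae_of_all _ fun x => ?_)
  simp only [Pi.add_apply, norm_pow]
  rcases le_or_gt ‖x‖ 1 with h | h
  · have := pow_le_one₀ (n := m) (norm_nonneg x) h
    have : 0 ≤ ‖x‖ ^ n := by positivity
    linarith
  · have := pow_le_pow_right₀ h.le hmn
    linarith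

section Moments

variable {G : Measure ℝ} [IsProbabilityMeasure G]

lemma integrable_exp_neg_mul_of_nonneg (hG : ∀ᵐ x ∂G, 0 ≤ x) {α : ℝ} (hα : 0 ≤ α) :
    Integrable (fun x => Real.exp (-(α * x))) G := by
  refine Integrable.of_bound (by fun_prop) 1 ?_
  filter_upwards [hG] with x hx
  rw [Real.norm_of_nonneg (Real.exp_pos _).le, Real.exp_le_one_iff]
  nlinarith

lemma laplace_pos_lt_one (hG : ∀ᵐ x ∂G, 0 ≤ x) (hg₁ : 0 < ∫ x, x ∂G) {α : ℝ} (hα : 0 < α) :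
    0 < laplace G α ∧ laplace G α < 1 := by
  have hi := integrable_exp_neg_mul_of_nonneg hG hα.le
  refine ⟨integral_exp_pos hi, ?_⟩
  have h1 : ∀ᵐ x ∂G, 0 ≤ 1 - Real.exp (-(α * x)) := by
    filter_upwards [hG] with x hx
    have : Real.exp (-(α * x)) ≤ 1 := Real.exp_le_one_iff.2 (by nlinarith)
    linarith
  have hi1 : Integrable (fun x => 1 - Real.exp (-(α * x))) G := (integrable_const 1).sub hi
  have h2 : ∫ x, 1 - Real.exp (-(α * x)) ∂G = 1 - laplace G α := by
    rw [integral_sub (integrable_const 1) hi, laplace]; simp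
  have h3 : 0 ≤ 1 - laplace G α := h2 ▸ integral_nonneg_of_ae h1
  refine lt_of_le_of_ne (by linarith) fun h => ?_
  rw [h, sub_self] at h2
  rw [integral_eq_zero_iff_of_nonneg_ae h1 hi1] at h2
  have h4 : (fun x => x) =ᵐ[G] (0 : ℝ → ℝ) := by
    filter_upwards [h2] with x hx
    simp only [Pi.zero_apply] at hx ⊢
    have : Real.exp (-(α * x)) = 1 := by linarith
    rw [Real.exp_eq_one_iff] at this
    rcases mul_eq_zero.1 (neg_eq_zero.1 this) with h | h
    · exact absurd h hα.ne'
    · exact h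
  rw [integral_congr_ae h4] at hg₁
  simp at hg₁

lemma abs_laplace_expansion (hG : ∀ᵐ x ∂G, 0 ≤ x)
    (hg₃ : Integrable (fun x : ℝ => x ^ 3) G) {α : ℝ} (hα : 0 ≤ α) :
    |laplace G α - 1 + α * (∫ x, x ∂G) - α ^ 2 * (∫ x, x ^ 2 ∂G) / 2|
      ≤ α ^ 3 * ∫ x, x ^ 3 ∂G := by
  have i1 : Integrable (fun x : ℝ => x) G := by
    simpa using integrable_pow_of_le (m := 1) (by norm_num) hg₃
  have i2 := integrable_pow_of_le (m := 2) (by norm_num) hg₃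
  have i0 := integrable_exp_neg_mul_of_nonneg hG hα
  have e : laplace G α - 1 + α * (∫ x, x ∂G) - α ^ 2 * (∫ x, x ^ 2 ∂G) / 2
      = ∫ x, Real.exp (-(α * x)) - 1 + α * x - α ^ 2 / 2 * x ^ 2 ∂G := by
    have j1 : Integrable (fun x => Real.exp (-(α * x)) - 1) G := i0.sub (integrable_const 1)
    have j2 : Integrable (fun x => Real.exp (-(α * x)) - 1 + α * x) G := j1.add (i1.const_mul α)
    rw [integral_sub j2 (i2.const_mul _), integral_add j1 (i1.const_mul α),
      integral_sub i0 (integrable_const 1),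
      integral_const_mul, integral_const_mul, laplace]
    simp; ring
  rw [e, ← integral_const_mul, ← Real.norm_eq_abs]
  refine norm_integral_le_of_norm_le (hg₃.const_mul _) ?_
  filter_upwards [hG] with x hx
  have := abs_exp_neg_sub_le_cube (mul_nonneg hα hx)
  rw [Real.norm_eq_abs]
  convert! this using 2 <;> ring

lemma abs_laplace_deriv_expansion (hG : ∀ᵐ x ∂G, 0 ≤ x)
    (hg₃ : Integrable (fun x : ℝ => x ^ 3) G) {α : ℝ} (hα : 0 ≤ α) :
    |(∫ x, x * Real.exp (-(α * x)) ∂G) - (∫ x, x ∂G) + α * (∫ x, x ^ 2 ∂G)|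
      ≤ α ^ 2 * ∫ x, x ^ 3 ∂G := by
  have i1 : Integrable (fun x : ℝ => x) G := by
    simpa using integrable_pow_of_le (m := 1) (by norm_num) hg₃
  have i2 := integrable_pow_of_le (m := 2) (by norm_num) hg₃
  have i0 : Integrable (fun x => x * Real.exp (-(α * x))) G := by
    refine i1.mono (by fun_prop) ?_
    filter_upwards [hG] with x hx
    rw [norm_mul, Real.norm_of_nonneg (Real.exp_pos _).le]
    exact mul_le_of_le_one_right (norm_nonneg _) (Real.exp_le_one_iff.2 (by nlinarith))
  have e : (∫ x, x * Real.exp (-(α * x)) ∂G) - (∫ x, x ∂G) + α * (∫ x, x ^ 2 ∂G)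
      = ∫ x, x * Real.exp (-(α * x)) - x + α * x ^ 2 ∂G := by
    have j1 : Integrable (fun x => x * Real.exp (-(α * x)) - x) G := i0.sub i1
    rw [integral_add j1 (i2.const_mul α), integral_sub i0 i1, integral_const_mul]
  rw [e, ← integral_const_mul, ← Real.norm_eq_abs]
  refine norm_integral_le_of_norm_le (hg₃.const_mul _) ?_
  filter_upwards [hG] with x hx
  have := mul_le_mul_of_nonneg_left (abs_exp_neg_sub_le_sq (mul_nonneg hα hx)) hx
  rw [Real.norm_eq_abs]
  calc |x * Real.exp (-(α * x)) - x + α * x ^ 2| = x * |Real.exp (-(α * x)) - 1 + α * x| := by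
        rw [← abs_of_nonneg hx, ← abs_mul, abs_of_nonneg hx]; congr 1; ring
    _ ≤ _ := this
    _ = α ^ 2 * x ^ 3 := by ring

/-- `(1 - laplace G α) / α = g₁ - g₂ α / 2 + o(α)`. -/
lemma tendsto_laplace_quotient (hG : ∀ᵐ x ∂G, 0 ≤ x)
    (hg₃ : Integrable (fun x : ℝ => x ^ 3) G) :
    Tendsto (fun α => ((1 - laplace G α) / α - ∫ x, x ∂G) / α) (𝓝[>] 0)
      (𝓝 (-(∫ x, x ^ 2 ∂G) / 2)) := by
  rw [tendsto_iff_norm_sub_tendsto_zero]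
  have hlim : Tendsto (fun α : ℝ => α * ∫ x, x ^ 3 ∂G) (𝓝[>] 0) (𝓝 0) := by
    have : Tendsto (fun α : ℝ => α * ∫ x, x ^ 3 ∂G) (𝓝 0) (𝓝 (0 * ∫ x, x ^ 3 ∂G)) :=
      tendsto_id.mul_const _
    rw [zero_mul] at this
    exact this.mono_left nhdsWithin_le_nhds
  refine squeeze_zero' (.of_forall fun _ => norm_nonneg _) ?_ hlim
  filter_upwards [self_mem_nhdsWithin] with α hα
  have hα' : (0 : ℝ) < α := hα
  have h := abs_laplace_expansion hG hg₃ hα'.le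
  have e : ((1 - laplace G α) / α - ∫ x, x ∂G) / α - -(∫ x, x ^ 2 ∂G) / 2
      = -(laplace G α - 1 + α * (∫ x, x ∂G) - α ^ 2 * (∫ x, x ^ 2 ∂G) / 2) / α ^ 2 := by
    field_simp; ring
  rw [e, norm_div, norm_neg, Real.norm_eq_abs, Real.norm_of_nonneg (by positivity : 0 ≤ α ^ 2),
    div_le_iff₀ (by positivity)]
  linarith

lemma tendsto_laplace_deriv_quotient (hG : ∀ᵐ x ∂G, 0 ≤ x)
    (hg₃ : Integrable (fun x : ℝ => x ^ 3) G) :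
    Tendsto (fun α => ((∫ x, x * Real.exp (-(α * x)) ∂G) - ∫ x, x ∂G) / α) (𝓝[>] 0)
      (𝓝 (-(∫ x, x ^ 2 ∂G))) := by
  rw [tendsto_iff_norm_sub_tendsto_zero]
  have hlim : Tendsto (fun α : ℝ => α * ∫ x, x ^ 3 ∂G) (𝓝[>] 0) (𝓝 0) := by
    have : Tendsto (fun α : ℝ => α * ∫ x, x ^ 3 ∂G) (𝓝 0) (𝓝 (0 * ∫ x, x ^ 3 ∂G)) :=
      tendsto_id.mul_const _
    rw [zero_mul] at this
    exact this.mono_left nhdsWithin_le_nhds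
  refine squeeze_zero' (.of_forall fun _ => norm_nonneg _) ?_ hlim
  filter_upwards [self_mem_nhdsWithin] with α hα
  have hα' : (0 : ℝ) < α := hα
  have h := abs_laplace_deriv_expansion hG hg₃ hα'.le
  have e : ((∫ x, x * Real.exp (-(α * x)) ∂G) - ∫ x, x ∂G) / α - -(∫ x, x ^ 2 ∂G)
      = ((∫ x, x * Real.exp (-(α * x)) ∂G) - (∫ x, x ∂G) + α * (∫ x, x ^ 2 ∂G)) / α := by
    generalize ∫ x, x * Real.exp (-(α * x)) ∂G = m
    field_simp; ring
  rw [e, norm_div, Real.norm_eq_abs, Real.norm_of_nonneg hα'.le, div_le_iff₀ hα']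
  linarith

end Moments

/-- A nonnegative random variable `V` with finite mean satisfies
`E[(1 + η V) exp (-η V)] = 1 + o(η)`. -/
lemma tendsto_one_add_mul_exp_quotient {Ω : Type*} [MeasurableSpace Ω] {P : Measure Ω}
    [IsProbabilityMeasure P] {V : Ω → ℝ} (hV : Integrable V P) (hV0 : ∀ᵐ ω ∂P, 0 ≤ V ω) :
    Tendsto (fun η => ((∫ ω, Real.exp (-(η * V ω)) ∂P)
      + η * (∫ ω, V ω * Real.exp (-(η * V ω)) ∂P) - 1) / η) (𝓝[>] 0) (𝓝 0) := by
  have key : Tendsto (fun η => ∫ ω, ((1 + η * V ω) * Real.exp (-(η * V ω)) - 1) / η ∂P)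
      (𝓝[>] 0) (𝓝 (∫ _, (0 : ℝ) ∂P)) := by
    have hb : ∀ y : ℝ, 0 ≤ y → |(1 + y) * Real.exp (-y) - 1| ≤ y ∧
        |(1 + y) * Real.exp (-y) - 1| ≤ y ^ 2 := by
      intro y hy
      have h1 := Real.one_sub_le_exp_neg y
      have h2 : (1 + y) * Real.exp (-y) ≤ 1 := by
        have := Real.add_one_le_exp y
        calc (1 + y) * Real.exp (-y) ≤ Real.exp y * Real.exp (-y) := by
              gcongr; linarith
          _ = 1 := by rw [← Real.exp_add]; simp
      have h3 := Real.exp_pos (-y)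
      rw [abs_of_nonpos (by linarith)]
      constructor <;> nlinarith
    refine tendsto_integral_filter_of_dominated_convergence V ?_ ?_ hV ?_
    · refine .of_forall fun η => ?_
      have := hV.1
      fun_prop
    · filter_upwards [self_mem_nhdsWithin] with η hη
      filter_upwards [hV0] with ω hω
      have hη' : (0 : ℝ) < η := hη
      rw [norm_div, Real.norm_eq_abs, Real.norm_of_nonneg hη'.le, div_le_iff₀ hη', mul_comm (V ω)]
      exact (hb _ (by positivity)).1
    · filter_upwards [hV0] with ω hω
      have hlim : Tendsto (fun η : ℝ => η * V ω ^ 2) (𝓝[>] 0) (𝓝 0) := by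
        have : Tendsto (fun η : ℝ => η * V ω ^ 2) (𝓝 0) (𝓝 (0 * V ω ^ 2)) :=
          tendsto_id.mul_const _
        rw [zero_mul] at this
        exact this.mono_left nhdsWithin_le_nhds
      refine squeeze_zero_norm' ?_ hlim
      filter_upwards [self_mem_nhdsWithin] with η hη
      have hη' : (0 : ℝ) < η := hη
      rw [norm_div, Real.norm_eq_abs, Real.norm_of_nonneg hη'.le, div_le_iff₀ hη']
      calc _ ≤ (η * V ω) ^ 2 := (hb _ (by positivity)).2
        _ = _ := by ring
  rw [integral_zero] at key
  refine key.congr' ?_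
  filter_upwards [self_mem_nhdsWithin] with η hη
  have hη' : (0 : ℝ) < η := hη
  have i0 : Integrable (fun ω => Real.exp (-(η * V ω))) P := by
    refine Integrable.of_bound (by have := hV.1; fun_prop) 1 ?_
    filter_upwards [hV0] with ω hω
    rw [Real.norm_of_nonneg (Real.exp_pos _).le, Real.exp_le_one_iff]
    nlinarith [mul_nonneg hη'.le hω]
  have i1 : Integrable (fun ω => V ω * Real.exp (-(η * V ω))) P := by
    refine hV.mono (by have := hV.1; fun_prop) ?_
    filter_upwards [hV0] with ω hω
    rw [norm_mul, Real.norm_of_nonneg (Real.exp_pos _).le]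
    exact mul_le_of_le_one_right (norm_nonneg _) (Real.exp_le_one_iff.2
      (by nlinarith [mul_nonneg hη'.le hω]))
  rw [integral_div, ← integral_const_mul, ← integral_add i0 (i1.const_mul η)]
  have i2 : Integrable
      (fun ω => Real.exp (-(η * V ω)) + η * (V ω * Real.exp (-(η * V ω)))) P :=
    i0.add (i1.const_mul η)
  have h1 := integral_sub i2 (integrable_const (1 : ℝ))
  rw [integral_const, probReal_univ, one_smul] at h1
  rw [← h1]
  congr 2 with ω
  ring

/-- `s(η) = η - lam (1 - laplace G η)` tends to `0` through positive values, at the rate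
`(1 - lam g₁) η`. -/
lemma tendsto_kernel_root {lam : ℝ} {G : Measure ℝ} [IsProbabilityMeasure G] (hG : ∀ᵐ x ∂G, 0 ≤ x)
    (hg₃ : Integrable (fun x : ℝ => x ^ 3) G) (hρ : lam * ∫ x, x ∂G < 1) :
    Tendsto (fun η => (η - lam * (1 - laplace G η)) / η) (𝓝[>] 0) (𝓝 (1 - lam * ∫ x, x ∂G)) ∧
    Tendsto (fun η => η - lam * (1 - laplace G η)) (𝓝[>] 0) (𝓝[>] 0) := by
  have hid : Tendsto (fun η : ℝ => η) (𝓝[>] 0) (𝓝 0) := tendsto_id.mono_left nhdsWithin_le_nhds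
  have hu : Tendsto (fun η => (1 - laplace G η) / η) (𝓝[>] 0) (𝓝 (∫ x, x ∂G)) := by
    have := ((tendsto_laplace_quotient hG hg₃).mul hid).add_const (∫ x, x ∂G)
    rw [mul_zero, zero_add] at this
    refine this.congr' ?_
    filter_upwards [self_mem_nhdsWithin] with η hη
    have hη' : (0 : ℝ) < η := hη
    field_simp; ring
  have h1 : Tendsto (fun η => (η - lam * (1 - laplace G η)) / η) (𝓝[>] 0)
      (𝓝 (1 - lam * ∫ x, x ∂G)) := by
    refine ((hu.const_mul lam).const_sub 1).congr' ?_
    filter_upwards [self_mem_nhdsWithin] with η hη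
    have hη' : (0 : ℝ) < η := hη
    field_simp
  have hev : ∀ᶠ η in 𝓝[>] (0 : ℝ), 0 < (η - lam * (1 - laplace G η)) / η :=
    h1.eventually (lt_mem_nhds (by linarith))
  refine ⟨h1, tendsto_nhdsWithin_iff.2 ⟨?_, ?_⟩⟩
  · have := h1.mul hid
    rw [mul_zero] at this
    refine this.congr' ?_
    filter_upwards [self_mem_nhdsWithin] with η hη
    have hη' : (0 : ℝ) < η := hη
    field_simp
  · filter_upwards [self_mem_nhdsWithin, hev] with η hη h
    exact (div_pos_iff_of_pos_right hη).1 h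

namespace MG1Queue

variable {Ω : Type*} [MeasurableSpace Ω] {P : Measure Ω} [IsProbabilityMeasure P] {lam : ℝ}
  {G : Measure ℝ} [IsProbabilityMeasure G]

/-- The expansion `covTransform s = lam / s - L + o(1)` along `s = s(η)`. -/
lemma tendsto_covTransform_sub (hlam : 0 < lam) (hG : ∀ᵐ x ∂G, 0 ≤ x)
    (hg₁ : 0 < ∫ x, x ∂G) (hg₃ : Integrable (fun x : ℝ => x ^ 3) G) (hρ : lam * ∫ x, x ∂G < 1)
    (X : MG1Queue P lam G) (hV : Integrable X.initialWork P) :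
    Tendsto (fun η => X.covTransform (η - lam * (1 - laplace G η))
        - lam / (η - lam * (1 - laplace G η))) (𝓝[>] 0)
      (𝓝 (-(lam * (∫ x, x ∂G) + lam ^ 2 * (∫ x, x ^ 2 ∂G) * (2 - lam * ∫ x, x ∂G)
        / (2 * (1 - lam * ∫ x, x ∂G) ^ 2)))) := by
  set g₁ := ∫ x, x ∂G with hg₁def
  set g₂ := ∫ x, x ^ 2 ∂G
  have hρ' : 0 < 1 - lam * g₁ := by linarith
  set s : ℝ → ℝ := fun η => η - lam * (1 - laplace G η) with hs
  set u : ℝ → ℝ := fun η => (1 - laplace G η) / η with hu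
  set m : ℝ → ℝ := fun η => ∫ x, x * Real.exp (-(η * x)) ∂G with hm
  set a : ℝ → ℝ := fun η => (∫ ω, Real.exp (-(η * X.initialWork ω)) ∂P)
      + η * (∫ ω, X.initialWork ω * Real.exp (-(η * X.initialWork ω)) ∂P) with ha
  obtain ⟨hsq, hs0⟩ := tendsto_kernel_root hG hg₃ hρ
  have hid : Tendsto (fun η : ℝ => η) (𝓝[>] 0) (𝓝 0) := tendsto_id.mono_left nhdsWithin_le_nhds
  have hpos : ∀ᶠ η in 𝓝[>] (0 : ℝ), 0 < η := self_mem_nhdsWithin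
  have hspos : ∀ᶠ η in 𝓝[>] (0 : ℝ), 0 < s η := hs0.eventually self_mem_nhdsWithin
  have hval : ∀ {f : ℝ → ℝ} {c d : ℝ}, Tendsto (fun η => (f η - c) / η) (𝓝[>] 0) (𝓝 d) →
      Tendsto f (𝓝[>] 0) (𝓝 c) := by
    intro f c d h
    have := (h.mul hid).add_const c
    rw [mul_zero, zero_add] at this
    refine this.congr' ?_
    filter_upwards [hpos] with η hη
    field_simp; ring
  have Uq : Tendsto (fun η => (u η - g₁) / η) (𝓝[>] 0) (𝓝 (-g₂ / 2)) :=
    tendsto_laplace_quotient hG hg₃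
  have Mq : Tendsto (fun η => (m η - g₁) / η) (𝓝[>] 0) (𝓝 (-g₂)) :=
    tendsto_laplace_deriv_quotient hG hg₃
  have Aq : Tendsto (fun η => (a η - 1) / η) (𝓝[>] 0) (𝓝 0) :=
    tendsto_one_add_mul_exp_quotient hV
      (by filter_upwards [X.ae_isRegular hG] with ω hω using hω.initialWork_nonneg)
  have hus : Tendsto (fun η => u (s η)) (𝓝[>] 0) (𝓝 g₁) := (hval Uq).comp hs0
  have Usq : Tendsto (fun η => (u (s η) - g₁) / η) (𝓝[>] 0) (𝓝 (-g₂ / 2 * (1 - lam * g₁))) := by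
    refine ((Uq.comp hs0).mul hsq).congr' ?_
    filter_upwards [hpos, hspos] with η hη hη2
    simp only [Function.comp_apply]
    rw [show η - lam * (1 - laplace G η) = s η from rfl]
    field_simp
  have Fq : Tendsto (fun η => (laplace G (s η) - 1) / η) (𝓝[>] 0)
      (𝓝 (-(g₁ * (1 - lam * g₁)))) := by
    refine (hus.mul hsq).neg.congr' ?_
    filter_upwards [hpos, hspos] with η hη hη2
    rw [show η - lam * (1 - laplace G η) = s η from rfl]
    simp only [hu]
    field_simp; ring
  have hw := ((hval Uq).const_mul lam).const_sub 1
  have hw' := ((hval Mq).const_mul lam).const_sub 1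
  -- the numerator of the difference, divided by `η`, telescopes into difference quotients
  have hnum := ((((((Fq.mul (hval Uq)).mul (hval Aq)).mul hw).add
    ((Uq.mul (hval Aq)).mul hw)).add ((Aq.const_mul g₁).mul hw)).sub (Usq.mul hw')).add
    ((Mq.sub Uq).const_mul (g₁ * lam))
  have hden := (hus.mul hw').mul hw
  have hlim := (hnum.const_mul lam).div hden (by positivity)
  have hw'pos : ∀ᶠ η in 𝓝[>] (0 : ℝ), 0 < 1 - lam * m η := hw'.eventually (lt_mem_nhds hρ')
  convert hlim.congr' ?_ using 2
  · field_simp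
    ring
  · filter_upwards [hpos, hspos, hw'pos] with η hη hη2 hη3
    have hlap := fun α (hα : 0 < α) => laplace_pos_lt_one hG hg₁ hα
    have key := X.covTransform_eq hlam hG hη hη2 rfl hlap
    have hA : 0 < 1 - laplace G η := by linarith [(hlap η hη).2]
    have hB : 0 < 1 - laplace G (s η) := by linarith [(hlap _ hη2).2]
    have hwη : 1 - lam * u η = s η / η := by simp only [hu, hs]; field_simp
    change X.covTransform (s η) * ((1 - lam * m η) / (lam * (1 - laplace G η)))
      = s η * laplace G (s η) / (1 - laplace G (s η)) * a η / η ^ 2 at key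
    change _ = X.covTransform (s η) - lam / s η
    have key2 : X.covTransform (s η) = lam * laplace G (s η) * u η * a η
        / (u (s η) * η * (1 - lam * m η)) := by
      have h0 : (1 - lam * m η) / (lam * (1 - laplace G η)) ≠ 0 := by positivity
      rw [eq_div_of_mul_eq h0 key]
      simp only [hu]
      field_simp
    have hus_pos : 0 < u (s η) := div_pos hB hη2
    have hs_eq : s η = η * (1 - lam * u η) := by rw [hwη]; field_simp
    have hwpos : 0 < 1 - lam * u η := by rw [hwη]; positivity
    have hlams : lam / s η = lam / (η * (1 - lam * u η)) := by rw [← hs_eq]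
    rw [key2, hlams]
    simp only [Pi.div_apply]
    generalize u (s η) = us at *
    generalize laplace G (s η) = φ at *
    field_simp
    ring

end MG1Queue

/-! ### The mean of the initial work -/

lemma lintegral_id_expMeasure_lt_top {lam : ℝ} (hlam : 0 < lam) :
    ∫⁻ x, ENNReal.ofReal x ∂(expMeasure lam) < ⊤ := by
  rw [lintegral_expMeasure]
  have h := ((integral_mul_exp_neg_mul_Ioi_zero hlam).1.const_mul lam).lintegral_lt_top
  convert! h using 1
  refine setLIntegral_congr_fun measurableSet_Ioi fun x hx => ?_
  have hx' : (0 : ℝ) < x := hx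
  rw [← ENNReal.ofReal_mul (by positivity)]
  congr 1; ring

namespace MG1Queue

variable {Ω : Type*} [MeasurableSpace Ω] {P : Measure Ω} {lam : ℝ} {G : Measure ℝ}

lemma IsRegular.clearTime_le {X : MG1Queue P lam G} {ω : Ω} (h : X.IsRegular ω) (n : ℕ) :
    X.clearTime n ω ≤ X.initialWork ω +
      ∑ i ∈ Finset.range n, (X.interarrival i ω + X.service (X.initial ω + i) ω) := by
  induction n with
  | zero => simp [clearTime_zero]
  | succ n ih =>
    rw [clearTime_succ, Finset.sum_range_succ, ← add_assoc, ← add_assoc]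
    refine add_le_add_left (max_le ?_ ?_) _
    · rw [arrivalSum_succ, add_le_add_iff_right, arrivalSum]
      refine (Finset.sum_le_sum fun i _ => ?_).trans (le_add_of_nonneg_left h.initialWork_nonneg)
      linarith [h.service_nonneg (X.initial ω + i)]
    · linarith [h.interarrival_pos n]

lemma measurable_service_initial_add (X : MG1Queue P lam G) (n : ℕ) :
    Measurable fun ω => X.service (X.initial ω + n) ω :=
  (measurable_from_prod_countable_right (f := fun p : ℕ × Ω => X.service p.1 p.2)
    X.measurable_service).comp ((X.measurable_initial.add_const n).prodMk measurable_id)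

lemma IsRegular.le_departures {X : MG1Queue P lam G} {ω : Ω} (h : X.IsRegular ω) {t : ℝ}
    (hfin : {n : ℕ | X.arrivalTime n ω ≤ t}.Finite) {n : ℕ} (hn : X.clearTime n ω ≤ t) :
    n ≤ X.departures t ω := by
  have hle : ∀ i ∈ Finset.range n, X.clearTime (i + 1) ω ≤ t := by
    intro i hi
    obtain ⟨m, rfl⟩ := Nat.exists_eq_add_of_lt (Finset.mem_range.1 hi)
    rw [← h.departureTime_initial_add] at hn ⊢
    exact (h.monotone_departureTime (by omega)).trans hn
  have h1 : (n : ENNReal) ≤ X.departures t ω := by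
    rw [h.departures_eq hfin]
    refine le_trans ?_ le_add_self
    refine le_trans ?_ (ENNReal.sum_le_tsum (Finset.range n))
    rw [Finset.sum_congr rfl fun i hi => Set.indicator_of_mem (by exact hle i hi) _]
    simp
  exact_mod_cast h1

variable [IsProbabilityMeasure P]

/-- The services of the arriving customers have the law `G`. -/
lemma lintegral_service_initial_add [IsProbabilityMeasure G] (X : MG1Queue P lam G) (n : ℕ)
    {φ : ℝ → ENNReal} (hφ : Measurable φ) :
    ∫⁻ ω, φ (X.service (X.initial ω + n) ω) ∂P = ∫⁻ x, φ x ∂G := by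
  have := X.lintegral_mul_service n (y := fun _ => 1) measurable_const hφ
  simpa using this

lemma tendsto_measureReal_lt_initialWork (X : MG1Queue P lam G) :
    Tendsto (fun t => P.real {ω | t < X.initialWork ω}) atTop (𝓝 0) := by
  have : IsProbabilityMeasure (P.map X.initialWork) :=
    Measure.isProbabilityMeasure_map X.measurable_initialWork.aemeasurable
  have h := (tendsto_cdf_atTop (P.map X.initialWork)).const_sub 1
  rw [sub_self] at h
  refine h.congr fun t => ?_
  rw [cdf_eq_real, map_measureReal_apply X.measurable_initialWork measurableSet_Iic,
    ← probReal_compl_eq_one_sub (X.measurable_initialWork measurableSet_Iic)]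
  congr 1 with ω
  simp

/-- The mean number of departures grows at least linearly: the work of the first `n` arriving
customers and the time until their arrival have a mean proportional to `n`, so that at least `n`
customers have left by time `t` with probability `1 / 2`, for some `n` of the order of `t`. -/
lemma exists_mul_le_integral_departures [IsProbabilityMeasure G] (hlam : 0 < lam)
    (hG : ∀ᵐ x ∂G, 0 ≤ x) (hg₁ : Integrable (fun x => x) G) (X : MG1Queue P lam G)
    (hQ0 : MemLp (fun ω => (X.queueLength 0 ω : ℝ)) 2 P) :
    ∃ c, 0 < c ∧ ∀ᶠ t in atTop, c * t ≤ ∫ ω, (X.departures t ω : ℝ) ∂P := by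
  set κ₀ : ENNReal := (∫⁻ x, ENNReal.ofReal x ∂(expMeasure lam)) + ∫⁻ x, ENNReal.ofReal x ∂G
    with hκ₀
  have hκ₀_top : κ₀ ≠ ⊤ :=
    ENNReal.add_ne_top.2 ⟨(lintegral_id_expMeasure_lt_top hlam).ne, hg₁.lintegral_lt_top.ne⟩
  set κ : ℝ := κ₀.toReal + 1 with hκ
  have hκ1 : 1 ≤ κ := by linarith [(ENNReal.toReal_nonneg : 0 ≤ κ₀.toReal)]
  have hκle : κ₀ ≤ ENNReal.ofReal κ := by
    rw [← ENNReal.ofReal_toReal hκ₀_top]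
    exact ENNReal.ofReal_le_ofReal (by linarith)
  set u : ℕ → Ω → ENNReal := fun n ω => ∑ i ∈ Finset.range n,
    (ENNReal.ofReal (X.interarrival i ω) + ENNReal.ofReal (X.service (X.initial ω + i) ω)) with hu
  have hum : ∀ n, Measurable (u n) := fun n => Finset.measurable_sum _ fun i _ =>
    (X.measurable_interarrival i).ennreal_ofReal.add
      (X.measurable_service_initial_add i).ennreal_ofReal
  have huint : ∀ n, ∫⁻ ω, u n ω ∂P = n * κ₀ := by
    intro n
    simp only [hu]
    rw [lintegral_finsetSum _ (by
        intro i _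
        exact (X.measurable_interarrival i).ennreal_ofReal.add
          (X.measurable_service_initial_add i).ennreal_ofReal),
      Finset.sum_congr rfl (g := fun _ => κ₀) fun i _ => ?_]
    · simp
    · rw [lintegral_add_left (X.measurable_interarrival i).ennreal_ofReal,
        X.lintegral_service_initial_add i ENNReal.measurable_ofReal, hκ₀,
        ← X.law_interarrival i,
        lintegral_map ENNReal.measurable_ofReal (X.measurable_interarrival i)]
  have hV := X.tendsto_measureReal_lt_initialWork.comp
    (tendsto_id.atTop_div_const (two_pos : (0 : ℝ) < 2))
  refine ⟨1 / (32 * κ), by positivity, ?_⟩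
  filter_upwards [hV.eventually (gt_mem_nhds (show (0 : ℝ) < 1 / 4 by norm_num)),
    eventually_ge_atTop (16 * κ)] with t hVt ht
  have ht0 : 0 < t := by linarith
  simp only [Function.comp_apply, id] at hVt
  -- `κ` exceeds the mean of an interarrival and a service time; by the inequality of Markov `n` of
  -- them last longer than `t / 2` with probability at most `2 * n * κ / t ≤ 1 / 4`
  set n := ⌊t / (16 * κ)⌋₊ + 1 with hn
  have hn1 : t / (16 * κ) ≤ n := by rw [hn]; push_cast; exact (Nat.lt_floor_add_one _).le
  have hn2 : (n : ℝ) ≤ t / (16 * κ) + 1 := by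
    rw [hn]; push_cast; gcongr; exact Nat.floor_le (by positivity)
  have hmarkov : P.real {ω | ENNReal.ofReal (t / 2) ≤ u n ω} ≤ 1 / 4 := by
    have h1 := mul_meas_ge_le_lintegral (μ := P) (hum n) (ENNReal.ofReal (t / 2))
    rw [huint] at h1
    have h2 : ENNReal.ofReal (t / 2) * P {ω | ENNReal.ofReal (t / 2) ≤ u n ω}
        ≤ ENNReal.ofReal (n * κ) := by
      refine h1.trans ?_
      rw [ENNReal.ofReal_mul (Nat.cast_nonneg _), ENNReal.ofReal_natCast]
      gcongr
    have h3 := ENNReal.toReal_mono ENNReal.ofReal_ne_top h2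
    rw [ENNReal.toReal_mul, ENNReal.toReal_ofReal (by positivity),
      ENNReal.toReal_ofReal (by positivity)] at h3
    change t / 2 * P.real _ ≤ _ at h3
    have h4 : n * κ ≤ t / 8 := by
      calc n * κ ≤ (t / (16 * κ) + 1) * κ := by gcongr
        _ = t / 16 + κ := by field_simp
        _ ≤ t / 8 := by linarith
    nlinarith
  have hset : MeasurableSet {ω | X.clearTime n ω ≤ t} :=
    measurableSet_le (X.measurable_clearTime n) measurable_const
  have hcompl : P.real {ω | X.clearTime n ω ≤ t}ᶜ ≤ 1 / 4 + 1 / 4 := by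
    refine le_trans ?_ ((measureReal_union_le _ _).trans (add_le_add hVt.le hmarkov))
    refine ENNReal.toReal_mono (measure_ne_top _ _) (measure_mono_ae ?_)
    filter_upwards [X.ae_isRegular hG] with ω hω hgt
    by_contra hcon
    obtain ⟨h1, h2⟩ := not_or.1 hcon
    have h1' : X.initialWork ω ≤ t / 2 := not_lt.1 h1
    have h2' : u n ω < ENNReal.ofReal (t / 2) := not_le.1 h2
    have h3 : u n ω = ENNReal.ofReal (∑ i ∈ Finset.range n,
        (X.interarrival i ω + X.service (X.initial ω + i) ω)) := by
      rw [ENNReal.ofReal_sum_of_nonneg fun i _ =>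
        add_nonneg (hω.interarrival_pos i).le (hω.service_nonneg _)]
      exact Finset.sum_congr rfl fun i _ =>
        (ENNReal.ofReal_add (hω.interarrival_pos i).le (hω.service_nonneg _)).symm
    rw [h3, ENNReal.ofReal_lt_ofReal_iff (by positivity)] at h2'
    exact hgt (show X.clearTime n ω ≤ t by linarith [hω.clearTime_le n])
  have hprob : 1 / 2 ≤ P.real {ω | X.clearTime n ω ≤ t} := by
    rw [probReal_compl_eq_one_sub hset] at hcompl
    linarith
  have hmean : n * P.real {ω | X.clearTime n ω ≤ t} ≤ ∫ ω, (X.departures t ω : ℝ) ∂P := by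
    rw [← integral_indicator_one hset, ← integral_const_mul]
    refine integral_mono_ae ?_ ((X.memLp_departures hlam hG hQ0 ht0.le).integrable one_le_two) ?_
    · exact (((integrable_const (1 : ℝ)).indicator hset).const_mul _)
    · filter_upwards [X.ae_finite_arrivalTime_le hlam t, X.ae_isRegular hG] with ω h1 h2
      by_cases h : X.clearTime n ω ≤ t
      · rw [Set.indicator_of_mem (by exact h)]
        simpa using h2.le_departures h1 h
      · rw [Set.indicator_of_notMem (by exact h)]
        simp
  calc 1 / (32 * κ) * t = t / (16 * κ) * (1 / 2) := by field_simp; norm_num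
    _ ≤ n * P.real {ω | X.clearTime n ω ≤ t} := by gcongr
    _ ≤ _ := hmean

/-- While the residual service lasts nobody leaves, so that the queue is long: on this event,
which is independent of the arrivals, the mean of `Q(t)` exceeds its overall mean
by at least `E D(t) - E Q(0)`.  A bounded variance makes the event improbable. -/
lemma sq_mul_measureReal_residual_le (hlam : 0 < lam) (hG : ∀ᵐ x ∂G, 0 ≤ x)
    (X : MG1Queue P lam G) (hQ0 : MemLp (fun ω => (X.queueLength 0 ω : ℝ)) 2 P) {t δ : ℝ}
    (ht : 0 ≤ t) (hδ : 0 ≤ δ)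
    (hδ' : δ ≤ (∫ ω, (X.departures t ω : ℝ) ∂P) - ∫ ω, (X.queueLength 0 ω : ℝ) ∂P) :
    δ ^ 2 * P.real {ω | 0 < X.initial ω ∧ t < X.residual ω}
      ≤ variance (fun ω => (X.queueLength t ω : ℝ)) P := by
  set H : Set Ω := {ω | 0 < X.initial ω ∧ t < X.residual ω} with hH
  have hHm : MeasurableSet H := (measurableSet_lt measurable_const X.measurable_initial).inter
    (measurableSet_lt measurable_const X.measurable_residual)
  have hQ := X.memLp_queueLength hlam hG hQ0 ht
  have hA := X.memLp_arrivals hlam hG ht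
  have hD := X.memLp_departures hlam hG hQ0 ht
  have iQ := hQ.integrable one_le_two
  have iA := hA.integrable one_le_two
  have iD := hD.integrable one_le_two
  have iQ0 := hQ0.integrable one_le_two
  set m := ∫ ω, (X.queueLength t ω : ℝ) ∂P with hm
  have hmean : m = (∫ ω, (X.queueLength 0 ω : ℝ) ∂P) + lam * t
      - ∫ ω, (X.departures t ω : ℝ) ∂P := by
    rw [← X.integral_arrivals hlam ht, ← integral_add iQ0 iA, hm, eq_sub_iff_add_eq,
      ← integral_add iQ iD]
    exact integral_congr_ae (X.ae_balance hlam hG ht)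
  have hind : IndepFun (H.indicator (1 : Ω → ℝ)) (fun ω => (X.arrivals t ω : ℝ)) P := by
    have h1 : Measurable fun p : (ℕ × ℝ) × (ℕ → ℝ) =>
        {p : (ℕ × ℝ) × (ℕ → ℝ) | 0 < p.1.1 ∧ t < p.1.2}.indicator (1 : (ℕ × ℝ) × (ℕ → ℝ) → ℝ) p :=
      measurable_one.indicator
        ((measurableSet_lt measurable_const (measurable_fst.comp measurable_fst)).inter
          (measurableSet_lt measurable_const (measurable_snd.comp measurable_fst)))
    have h2 : Measurable fun e : ℕ → ℝ => (arrivalCount e t).toReal := by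
      exact (measurable_arrivalCount.comp (measurable_const.prodMk measurable_id)).ennreal_toReal
    refine (X.indepFun_start_service_interarrival.comp h1 h2).congr ?_ ?_
    · exact ae_of_all _ fun ω => by simp [Set.indicator, H]
    · filter_upwards [X.ae_arrivals_eq hlam t] with ω hω
      simp [← hω]
  have hone : Integrable (H.indicator (1 : Ω → ℝ)) P := (integrable_const (1 : ℝ)).indicator hHm
  have hpA : ∫ ω, H.indicator 1 ω * (X.arrivals t ω : ℝ) ∂P = P.real H * (lam * t) := by
    rw [hind.integral_fun_mul_eq_mul_integral hone.1 hA.1, integral_indicator_one hHm,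
      X.integral_arrivals hlam ht]
  have iHA : Integrable (fun ω => H.indicator (1 : Ω → ℝ) ω * (X.arrivals t ω : ℝ)) P := by
    refine iA.mono (hone.1.mul hA.1) (ae_of_all _ fun ω => ?_)
    rw [norm_mul]
    refine mul_le_of_le_one_left (norm_nonneg _) ?_
    by_cases h : ω ∈ H <;> simp [h]
  have hvar : variance (fun ω => (X.queueLength t ω : ℝ)) P
      = ∫ ω, ((X.queueLength t ω : ℝ) - m) ^ 2 ∂P := variance_eq_integral hQ.1.aemeasurable
  have hp : 0 ≤ P.real H := measureReal_nonneg
  have hlow : 2 * δ * (P.real H * (lam * t)) - (2 * δ * m + δ ^ 2) * P.real H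
      ≤ variance (fun ω => (X.queueLength t ω : ℝ)) P := by
    rw [hvar, ← hpA, ← integral_indicator_one hHm, ← integral_const_mul, ← integral_const_mul,
      ← integral_sub (iHA.const_mul _) (hone.const_mul _)]
    refine integral_mono_ae ((iHA.const_mul _).sub (hone.const_mul _))
      ((hQ.sub (memLp_const m)).integrable_sq) ?_
    filter_upwards [X.ae_finite_arrivalTime_le hlam t, X.ae_isRegular hG] with ω h1 h2
    by_cases hω : ω ∈ H
    · have hD0 : X.departures t ω = 0 := by
        have : {k : ℕ | X.departureTime k ω ≤ t} = ∅ := by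
          ext k
          simp only [Set.mem_ofPred_eq, Set.mem_empty_iff_false, iff_false, not_le]
          refine lt_of_lt_of_le ?_ (h2.monotone_departureTime (Nat.zero_le k))
          simp only
          rw [departureTime_zero_of_initial_pos hω.1]
          exact hω.2
        rw [departures, this, Set.ncard_empty]
      have hQA : (X.arrivals t ω : ℝ) ≤ X.queueLength t ω := by
        have := h2.queueLength_add_departures ht h1
        rw [hD0] at this
        exact_mod_cast (by omega : X.arrivals t ω ≤ X.queueLength t ω)
      simp only [Set.indicator_of_mem hω, Pi.one_apply]
      -- `(q - m) ^ 2 ≥ 2 * δ * (q - m) - δ ^ 2`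
      nlinarith [sq_nonneg ((X.queueLength t ω : ℝ) - m - δ)]
    · simp only [Set.indicator_of_notMem hω]
      nlinarith [sq_nonneg ((X.queueLength t ω : ℝ) - m)]
  have : δ * P.real H ≤ (lam * t - m) * P.real H :=
    mul_le_mul_of_nonneg_right (by rw [hmean]; linarith) hp
  nlinarith

/-- A residual service with the tail `O(t⁻²)` has a finite mean. -/
lemma lintegral_residual_lt_top [IsProbabilityMeasure G] (hlam : 0 < lam)
    (hG : ∀ᵐ x ∂G, 0 ≤ x) (hg₁ : Integrable (fun x => x) G) (X : MG1Queue P lam G)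
    (hQ0 : MemLp (fun ω => (X.queueLength 0 ω : ℝ)) 2 P) {C : ℝ}
    (hvar : ∀ᶠ t in atTop, variance (fun ω => (X.queueLength t ω : ℝ)) P ≤ C) :
    ∫⁻ ω, ENNReal.ofReal ({ω | 0 < X.initial ω}.indicator X.residual ω) ∂P < ⊤ := by
  obtain ⟨c, hc, hD⟩ := X.exists_mul_le_integral_departures hlam hG hg₁ hQ0
  set q := ∫ ω, (X.queueLength 0 ω : ℝ) ∂P
  have hq : 0 ≤ q := integral_nonneg fun _ => Nat.cast_nonneg _
  set f : Ω → ℝ := {ω | 0 < X.initial ω}.indicator X.residual with hf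
  have hfm : Measurable f :=
    X.measurable_residual.indicator (measurableSet_lt measurable_const X.measurable_initial)
  have hf0 : 0 ≤ᵐ[P] f := by
    filter_upwards [X.ae_isRegular hG] with ω hω
    by_cases h : 0 < X.initial ω
    · simpa [f, h] using (hω.residual_pos h).le
    · simp [f, h]
  obtain ⟨T, hT⟩ := eventually_atTop.1 (hD.and (hvar.and (eventually_ge_atTop (max 1 (2 * q / c)))))
  have hT1 : 1 ≤ T := (le_max_left _ _).trans (hT T le_rfl).2.2
  have hbound : ∀ t ∈ Set.Ioi T,
      P {ω | t < f ω} ≤ ENNReal.ofReal (4 * C / c ^ 2 * t ^ (-2 : ℝ)) := by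
    intro t ht
    obtain ⟨h1, h2, h3⟩ := hT t (le_of_lt ht)
    have ht0 : 0 < t := by linarith [Set.mem_Ioi.1 ht]
    have h4 : 2 * q / c ≤ t := (le_max_right _ _).trans h3
    rw [div_le_iff₀ hc] at h4
    have h5 := X.sq_mul_measureReal_residual_le hlam hG hQ0 ht0.le (δ := c * t / 2) (by positivity)
      (by linarith)
    have h6 : {ω | t < f ω} = {ω | 0 < X.initial ω ∧ t < X.residual ω} := by
      ext ω
      by_cases h : 0 < X.initial ω
      · simp [f, h]
      · simp [f, h, ht0.le]
    rw [h6, ← ofReal_measureReal]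
    refine ENNReal.ofReal_le_ofReal ?_
    rw [Real.rpow_neg ht0.le, Real.rpow_two, ← div_eq_mul_inv, div_div, le_div_iff₀ (by positivity)]
    nlinarith
  have hint : IntegrableOn (fun t : ℝ => 4 * C / c ^ 2 * t ^ (-2 : ℝ)) (Set.Ioi T) :=
    (integrableOn_Ioi_rpow_of_lt (by norm_num) (by linarith)).const_mul _
  rw [lintegral_eq_lintegral_meas_lt P hf0 hfm.aemeasurable,
    ← Set.Ioc_union_Ioi_eq_Ioi (by linarith : (0 : ℝ) ≤ T),
    lintegral_union measurableSet_Ioi (Set.Ioc_disjoint_Ioi le_rfl)]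
  refine ENNReal.add_lt_top.2 ⟨?_, ?_⟩
  · calc ∫⁻ t in Set.Ioc 0 T, P {ω | t < f ω} ≤ ∫⁻ t in Set.Ioc 0 T, 1 :=
        lintegral_mono fun _ => prob_le_one
      _ < ⊤ := by simp
  · exact lt_of_le_of_lt (setLIntegral_mono' measurableSet_Ioi hbound) hint.lintegral_lt_top

/-- Apart from the residual service, the initial work consists of a number of services which is
independent of them and has a finite mean. -/
lemma integrable_initialWork [IsProbabilityMeasure G] (hlam : 0 < lam)
    (hG : ∀ᵐ x ∂G, 0 ≤ x) (hg₁ : Integrable (fun x => x) G) (X : MG1Queue P lam G)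
    (hQ0 : MemLp (fun ω => (X.queueLength 0 ω : ℝ)) 2 P) {C : ℝ}
    (hvar : ∀ᶠ t in atTop, variance (fun ω => (X.queueLength t ω : ℝ)) P ≤ C) :
    Integrable X.initialWork P := by
  refine ⟨X.measurable_initialWork.aestronglyMeasurable, ?_⟩
  have hsum : ∫⁻ ω, ∑' k : ℕ, {ω | k < X.initial ω}.indicator 1 ω
      * ENNReal.ofReal (X.service k ω) ∂P < ⊤ := by
    have hm : ∀ k : ℕ, Measurable ({ω | k < X.initial ω}.indicator (1 : Ω → ENNReal)) := fun k =>
      measurable_one.indicator (measurableSet_lt measurable_const X.measurable_initial)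
    rw [lintegral_tsum (by
      intro k
      exact ((hm k).mul (X.measurable_service k).ennreal_ofReal).aemeasurable)]
    have hk : ∀ k : ℕ, ∫⁻ ω, {ω | k < X.initial ω}.indicator 1 ω
        * ENNReal.ofReal (X.service k ω) ∂P
        = (∫⁻ ω, {ω | k < X.initial ω}.indicator 1 ω ∂P) * ∫⁻ x, ENNReal.ofReal x ∂G := by
      intro k
      have hind : IndepFun ({ω | k < X.initial ω}.indicator (1 : Ω → ENNReal))
          (fun ω => ENNReal.ofReal (X.service k ω)) P := by
        have h1 : Measurable fun p : ℕ × ℝ => {n : ℕ | k < n}.indicator (1 : ℕ → ENNReal) p.1 :=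
          (measurable_from_top (f := {n : ℕ | k < n}.indicator (1 : ℕ → ENNReal))).comp
            measurable_fst
        have h2 : Measurable fun p : (ℕ → ℝ) × (ℕ → ℝ) => ENNReal.ofReal (p.2 k) := by fun_prop
        have := X.indep_start.comp h1 h2
        refine this.congr (ae_of_all _ fun ω => ?_) (ae_of_all _ fun ω => rfl)
        simp [Set.indicator]
      have hlaw : ∫⁻ ω, ENNReal.ofReal (X.service k ω) ∂P = ∫⁻ x, ENNReal.ofReal x ∂G := by
        simp only [← X.law_service k]
        exact (lintegral_map ENNReal.measurable_ofReal (X.measurable_service k)).symm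
      rw [← hlaw]
      exact lintegral_mul_eq_lintegral_mul_lintegral_of_indepFun (hm k)
        (X.measurable_service k).ennreal_ofReal hind
    simp_rw [hk]
    rw [ENNReal.tsum_mul_right, ← lintegral_tsum fun k => (hm k).aemeasurable]
    refine ENNReal.mul_lt_top ?_ hg₁.lintegral_lt_top
    have hN := ((X.memLp_initial hG hQ0).integrable one_le_two).lintegral_lt_top
    refine lt_of_le_of_lt (lintegral_mono fun ω => le_of_eq ?_) hN
    rw [ENNReal.ofReal_natCast, tsum_eq_sum (s := Finset.range (X.initial ω))]
    · rw [Finset.sum_congr rfl (g := fun _ => 1) fun k hk => by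
        rw [Set.indicator_of_mem (by exact Finset.mem_range.1 hk), Pi.one_apply]]
      simp
    · intro k hk
      rw [Set.indicator_of_notMem (by exact fun h => hk (Finset.mem_range.2 h))]
  have hR := X.lintegral_residual_lt_top hlam hG hg₁ hQ0 hvar
  refine lt_of_le_of_lt (lintegral_mono_ae (g := fun ω =>
    ENNReal.ofReal ({ω | 0 < X.initial ω}.indicator X.residual ω) +
    ∑' k : ℕ, {ω | k < X.initial ω}.indicator 1 ω * ENNReal.ofReal (X.service k ω)) ?_) ?_
  · filter_upwards [X.ae_isRegular hG] with ω hω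
    rw [← ofReal_norm, Real.norm_of_nonneg hω.initialWork_nonneg, initialWork, initialWorkOf]
    split_ifs with h
    · simp
    · have h' : 0 < X.initial ω := Nat.pos_of_ne_zero h
      rw [Set.indicator_of_mem (by exact h')]
      refine ENNReal.ofReal_add_le.trans (add_le_add_right ?_ _)
      rw [ENNReal.ofReal_sum_of_nonneg fun k _ => hω.service_nonneg k]
      refine le_trans (Finset.sum_le_sum fun k hk => ?_)
        (ENNReal.sum_le_tsum (Finset.Ico 1 (X.initial ω)))
      rw [Set.indicator_of_mem (by exact (Finset.mem_Ico.1 hk).2), Pi.one_apply, one_mul]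
  · rw [lintegral_add_left]
    · exact ENNReal.add_lt_top.2 ⟨hR, hsum⟩
    · exact (X.measurable_residual.indicator
        (measurableSet_lt measurable_const X.measurable_initial)).ennreal_ofReal

end MG1Queue

/-! ### The limit of the covariance -/

theorem mainTheorem5 {Ω : Type*} [MeasurableSpace Ω] (P : Measure Ω) [IsProbabilityMeasure P]
    (lam : ℝ) (hlam : 0 < lam)
    (G : Measure ℝ) [IsProbabilityMeasure G] (hG_nonneg : ∀ᵐ x ∂G, 0 ≤ x)
    (hg₁ : 0 < serviceMoment G 1) (hg₃ : Integrable (fun x : ℝ => x ^ 3) G)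
    (hρ : trafficIntensity lam G < 1)
    (π : Measure ℕ) (hπ : IsStationaryQueueLaw lam G π)
    (X : MG1Queue P lam G)
    (hQ0 : MemLp (fun ω => (X.queueLength 0 ω : ℝ)) 2 P)
    (hAsymptote : ∃ v b : ℝ, Tendsto
      (fun t : ℝ => variance (fun ω => (X.departures t ω : ℝ)) P - (v * t + b)) atTop (𝓝 0))
    (hVar : Tendsto (fun t : ℝ => variance (fun ω => (X.queueLength t ω : ℝ)) P) atTop
      (𝓝 (variance (fun n : ℕ => (n : ℝ)) π)))
    (hCov : Tendsto (fun t : ℝ =>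
      covariance (fun ω => (X.queueLength 0 ω : ℝ)) (fun ω => (X.queueLength t ω : ℝ)) P) atTop
      (𝓝 0)) :
    Tendsto (fun t : ℝ =>
      covariance (fun ω => (X.arrivals t ω : ℝ)) (fun ω => (X.queueLength t ω : ℝ)) P) atTop
      (𝓝 (trafficIntensity lam G / (1 - trafficIntensity lam G) ^ 2 *
        (1 + (sqCoeffVar G - 1) *
          (trafficIntensity lam G * (2 - trafficIntensity lam G) / 2)))) := by
  obtain ⟨v, b, hD⟩ := hAsymptote
  have hm1 : serviceMoment G 1 = ∫ x, x ∂G := by simp [serviceMoment]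
  have hm2 : serviceMoment G 2 = ∫ x, x ^ 2 ∂G := rfl
  have hρeq : trafficIntensity lam G = lam * ∫ x, x ∂G := by
    rw [trafficIntensity, div_inv_eq_mul, hm1]
  rw [sqCoeffVar, hm1, hm2]
  rw [hm1] at hg₁
  rw [hρeq] at hρ ⊢
  have hi1 : Integrable (fun x : ℝ => x) G := by
    simpa using integrable_pow_of_le (m := 1) (by norm_num) hg₃
  have hV : Integrable X.initialWork P :=
    X.integrable_initialWork hlam hG_nonneg hi1 hQ0
      ((hVar.eventually (gt_mem_nhds (lt_add_one _))).mono fun _ h => h.le)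
  have hcov := fun t (ht : (0 : ℝ) ≤ t) =>
    X.covariance_arrivals_queueLength hlam hG_nonneg hQ0 ht
  set K : ℝ → ℝ := fun t =>
    covariance (fun ω => (X.arrivals t ω : ℝ)) (fun ω => (X.queueLength t ω : ℝ)) P with hK
  set Λ : ℝ → ℝ := fun t => ∑' n, X.covTerm (n + 1) t with hΛ
  set w := variance (fun ω => (X.queueLength 0 ω : ℝ)) P
  set β := (w + variance (fun n : ℕ => (n : ℝ)) π - b) / 2 with hβ
  -- the balance of the variances gives the covariance the asymptote `(lam - v) / 2 * t + β`
  have hKasym : Tendsto (fun t => K t - ((lam - v) / 2 * t + β)) atTop (𝓝 0) := by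
    have h1 := ((hVar.sub_const (variance (fun n : ℕ => (n : ℝ)) π)).sub
      ((hCov.const_mul 2).add hD)).div_const 2
    simp only [sub_self, mul_zero, add_zero, zero_div] at h1
    refine h1.congr' ?_
    filter_upwards [eventually_ge_atTop 0] with t ht
    rw [show K t = _ from (hcov t ht).2]
    ring
  have hΛasym : Tendsto (fun t => Λ t - ((lam + v) / 2 * t + -β)) atTop (𝓝 0) := by
    have h1 := hKasym.neg
    rw [neg_zero] at h1
    refine h1.congr' ?_
    filter_upwards [eventually_ge_atTop 0] with t ht
    rw [show K t = lam * t - Λ t from (hcov t ht).1]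
    ring
  have hJ : Tendsto (fun s => X.covTransform s - (lam + v) / 2 / s) (𝓝[>] 0) (𝓝 (-β)) := by
    refine (tendsto_laplace_of_asymptote
      (fun s hs => (X.laplace_tsum_covTerm hlam hG_nonneg hs).1) hΛasym).congr' ?_
    filter_upwards [self_mem_nhdsWithin] with s hs
    rw [(X.laplace_tsum_covTerm hlam hG_nonneg hs).2]
  obtain ⟨-, hs⟩ := tendsto_kernel_root hG_nonneg hg₃ hρ
  have hL := X.tendsto_covTransform_sub hlam hG_nonneg hg₁ hg₃ hρ hV
  have hJs := hJ.comp hs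
  set s : ℝ → ℝ := fun η => η - lam * (1 - laplace G η)
  set L := lam * (∫ x, x ∂G) + lam ^ 2 * (∫ x, x ^ 2 ∂G) * (2 - lam * ∫ x, x ∂G)
        / (2 * (1 - lam * ∫ x, x ∂G) ^ 2) with hLdef
  have hspos : ∀ᶠ η in 𝓝[>] (0 : ℝ), 0 < s η := hs.eventually self_mem_nhdsWithin
  have hs0 : Tendsto s (𝓝[>] 0) (𝓝 0) := hs.mono_right nhdsWithin_le_nhds
  -- two expansions of the same function have the same polar part
  have hα : (lam - v) / 2 = 0 := by
    have h1 := (hJs.sub hL).mul hs0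
    rw [mul_zero] at h1
    refine tendsto_nhds_unique (tendsto_const_nhds.congr' ?_) h1
    filter_upwards [hspos] with η hη
    simp only [Function.comp_apply]
    change _ = (X.covTransform (s η) - (lam + v) / 2 / s η
      - (X.covTransform (s η) - lam / s η)) * s η
    field_simp
    ring
  have hβL : β = L := by
    have hv : (lam + v) / 2 = lam := by linarith
    rw [hv] at hJs
    exact neg_injective (tendsto_nhds_unique hJs hL)
  have hKlim := hKasym.add_const β
  simp only [hα, zero_mul, zero_add, sub_add_cancel] at hKlim
  convert! hKlim using 2
  rw [hβL, hLdef]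
  have : 1 - lam * ∫ x, x ∂G ≠ 0 := by linarith
  field_simp
  ring
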